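/- **Setting.** Let $n\in\{2,3\}$, $k>0$, and let $\Gamma\subset\mathbb R^n$ be the attractor of an iterated function system $\{s_1,\dots,s_M\}$ ($M\ge 2$) of contracting similarities with ratios $\rho_m\in(0,1)$ satisfying the open set condition, i.e. the unique non-empty compact set with $\Gamma=\bigcup_m s_m(\Gamma)$. Let $d$ be the solution of $\sum_m\rho_m^d=1$, and assume $d>n-2$. Let $\mathcal H^d$ be $d$-dimensional Hausdorff measure, normalised to be Lebesgue measure for $d=n$. For $\boldsymbol m=(m_1,\dots,m_\ell)$ put $\Gamma_{\boldsymbol m}=s_{m_1}\circ\dots\circ s_{m_\ell}(\Gamma)$ (with $\Gamma_{\boldsymbol m}=\Gamma$ for the empty index), $\mu_{\boldsymbol m}=\mathcal H^d(\Gamma_{\boldsymbol m})$, and let $x_{\boldsymbol m}=\mu_{\boldsymbol m}^{-1}\int_{\Gamma_{\boldsymbol m}}x\,d\mathcal H^d(x)$ be the barycentre of $\Gamma_{\boldsymbol m}$. For $h>0$ let $L_h(\boldsymbol m)$ be the set of indices $\boldsymbol p$ extending $\boldsymbol m$ (possibly $\boldsymbol p=\boldsymbol m$) with $\operatorname{diam}\Gamma_{\boldsymbol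 p}\le h$ such that $\boldsymbol p=\boldsymbol m$ or the parent of $\Gamma_{\boldsymbol p}$ (delete the last entry of $\boldsymbol p$) has diameter $>h$. For $0<h\le\operatorname{diam}\Gamma$ let $L_h$ be $L_h(\boldsymbol m)$ for the empty index $\boldsymbol m$, let $\boldsymbol m(1),\dots,\boldsymbol m(N)$ be an ordering of $L_h$, and let $f^i=\mu_{\boldsymbol m(i)}^{-1/2}$ on $\Gamma_{\boldsymbol m(i)}$ and $f^i=0$ elsewhere. Let $\Phi(x,y)=\frac{e^{ik|x-y|}}{4\pi|x-y|}$ ($n=3$), $\Phi(x,y)=\frac i4H^{(1)}_0(k|x-y|)$ ($n=2$), $\Phi_{\rm sing}(x,y)=\frac1{4\pi|x-y|}$ ($n=3$), $\Phi_{\rm sing}(x,y)=-\frac1{2\pi}\log|x-y|$ ($n=2$). For functions $u,v$ define $$A_{ij}=\mu_{\boldsymbol m(i)}^{-1/2}\mu_{\boldsymbol m(j)}^{-1/2}\int_{\Gamma_{\boldsymbol m(i)}}\int_{\Gamma_{\boldsymbol m(j)}}\Phi(x,y)\,d\mathcal H^d(y)\,d\mathcal H^d(x),$$ $$b_i=-\mu_{\boldsymbol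 m(i)}^{-1/2}\int_{\Gamma_{\boldsymbol m(i)}}u\,d\mathcal H^d,\qquad \varphi_i=\mu_{\boldsymbol m(i)}^{-1/2}\int_{\Gamma_{\boldsymbol m(i)}}v\,d\mathcal H^d .$$ **Quadrature.** Let $0<h_Q\le h$. The vectors $b^Q,\varphi^Q$ are obtained by replacing each $\int_{\Gamma_{\boldsymbol m}}f\,d\mathcal H^d$ by the composite barycentre rule $\sum_{\boldsymbol p\in L_{h_Q}(\boldsymbol m)}\mu_{\boldsymbol p}f(x_{\boldsymbol p})$. For $i\ne j$, $A^Q_{ij}$ is obtained by replacing the double integral by the tensor product rule $Q_{\boldsymbol m,\boldsymbol m'}[F]=\sum_{\boldsymbol p\in L_{h_Q}(\boldsymbol m)}\sum_{\boldsymbol p'\in L_{h_Q}(\boldsymbol m')}\mu_{\boldsymbol p}\mu_{\boldsymbol p'}F(x_{\boldsymbol p},x_{\boldsymbol p'})$ with $F=\Phi$, $\boldsymbol m=\boldsymbol m(i)$, $\boldsymbol m'=\boldsymbol m(j)$. For $i=j$ and $\boldsymbol m=\boldsymbol m(i)$ (disjoint attractors), $A^Q_{ii}=\mu_{\boldsymbol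 m}^{-1}\big(I^Q_{\boldsymbol m}+Q_{\boldsymbol m,\boldsymbol m}[\Phi-\Phi_{\rm sing}]\big)$, where $\Phi-\Phi_{\rm sing}$ is extended continuously to $x=y$ and, with $R=\sum_{m\ne m'}Q_{(\boldsymbol m,m),(\boldsymbol m,m')}[\Phi_{\rm sing}]$, $$I^Q_{\boldsymbol m}=\frac{R}{1-\sum_m\rho_m^{2d-1}}\ (n=3),\qquad I^Q_{\boldsymbol m}=\frac{R-\frac{\mu_{\boldsymbol m}^2}{2\pi}\sum_m\rho_m^{2d}\log\rho_m}{1-\sum_m\rho_m^{2d}}\ (n=2).$$ Write $|f|_{2,\mathrm{Hull}(\Gamma)}=\max_{x\in\mathrm{Hull}(\Gamma)}\max_{|\alpha|=2}|D^\alpha f(x)|$, $\mathrm{Hull}$ denoting the convex hull, and let $\|\cdot\|_2$ be the Euclidean norm on $\mathbb C^N$ and the induced matrix norm. **Theorem.** (i) Let $u$ be a $C^\infty$ solution of $\Delta u+k^2u=0$ in an open neighbourhood of $\mathrm{Hull}(\Gamma)$. Then, for all $0<h_Q\le h\le\operatorname{diam}\Gamma$, $$\|b-b^Q\|_2\le h_Q^2\,|u|_{2,\mathrm{Hull}(\Gamma)}\,\mathcal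 H^d(\Gamma)^{1/2}.$$ (ii) Let $v$ be $C^\infty$ in an open neighbourhood of $\mathrm{Hull}(\Gamma)$, let $\sigma\in C_0^\infty(\mathbb R^n)$ equal one in a neighbourhood of $\Gamma$, with $\sigma v\in C_0^\infty(\mathbb R^n)$, let $P$ be the orthogonal projection of $H^1(\mathbb R^n)$ onto the orthogonal complement of the closure of $C_0^\infty(\mathbb R^n\setminus\Gamma)$ in $H^1(\mathbb R^n)$, and let $J(\psi)=\langle P(\sigma v),\overline\psi\rangle_{H^1\times H^{-1}}$. Let $\psi_N=\mathrm{tr}_\Gamma^*\big(\sum_jc_jf^j\big)\in H^{-1}(\mathbb R^n)$ with $c\in\mathbb C^N$, i.e. $\langle\phi,\overline{\psi_N}\rangle=\int_\Gamma\phi\sum_jc_jf^j\,d\mathcal H^d$ for all $\phi\in C_0^\infty(\mathbb R^n)$, and let $J^Q(\psi_N)=\sum_jc_j\varphi^Q_j$. Then, for all $0<h_Q\le h\le\operatorname{diam}\Gamma$, $$|J(\psi_N)-J^Q(\psi_N)|\le h_Q^2\,|v|_{2,\mathrm{Hull}(\Gamma)}\,\|c\|_2\,\mathcal H^d(\Gamma)^{1/2}.$$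 (iii) Suppose that $\Gamma$ is hull-disjoint: $\mathrm{Hull}(s_m(\Gamma))\cap\mathrm{Hull}(s_{m'}(\Gamma))=\emptyset$ for all $m\ne m'$. Then there is $C>0$, independent of $h$ and $h_Q$, such that for all $0<h_Q\le h\le\operatorname{diam}\Gamma$, $$\|A-A^Q\|_2\le C\,h_Q\,h^{-(n-1)}\,\mathcal H^d(\Gamma).$$ If, further, $\Gamma$ is homogeneous (all $\rho_m$ equal), then there is $C>0$, independent of $h$ and $h_Q$, such that for all such $h,h_Q$, $$\|A-A^Q\|_2\le C\,h_Q^2\,h^{-n}\,\mathcal H^d(\Gamma).$$ -/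

import Mathlib

open Set Filter Topology MeasureTheory
open scoped ContDiff SchwartzMap LineDeriv

noncomputable section

/-- Euclidean space `ℝⁿ`. -/
abbrev Eucl (n : ℕ) : Type := EuclideanSpace ℝ (Fin n)

/-- The `d`-dimensional Hausdorff measure on `ℝⁿ` in the normalisation for which it coincides with
Lebesgue measure when `d = n`: the factor is `α(d) / 2 ^ d` with `α(d) = π^(d/2) / Γ(d/2 + 1)`
(Mathlib's `μH[d]` is built from `diam ^ d` without any factor). -/
def hausM (n : ℕ) (d : ℝ) : Measure (Eucl n) :=
  ENNReal.ofReal (Real.pi ^ (d / 2) / Real.Gamma (d / 2 + 1) / 2 ^ d) • Measure.hausdorffMeasure d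

/-! ### Iterated function systems of contracting similarities -/

/-- An iterated function system of `M ≥ 2` contracting similarities of `ℝⁿ`. -/
structure IFS (n M : ℕ) where
  map : Fin M → Eucl n → Eucl n
  ratio : Fin M → ℝ
  two_le : 2 ≤ M
  ratio_pos : ∀ m, 0 < ratio m
  ratio_lt_one : ∀ m, ratio m < 1
  dist_map : ∀ m x y, dist (map m x) (map m y) = ratio m * dist x y

namespace IFS

variable {n M : ℕ} (S : IFS n M)

/-- `Γ` is the attractor: the (unique) non-empty compact set with `Γ = ⋃ₘ sₘ(Γ)`. -/
def IsAttractor (Γ : Set (Eucl n)) : Prop :=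
  Γ.Nonempty ∧ IsCompact Γ ∧ Γ = ⋃ m, S.map m '' Γ

/-- The open set condition. -/
def OSC : Prop :=
  ∃ V : Set (Eucl n), V.Nonempty ∧ Bornology.IsBounded V ∧ IsOpen V ∧
    (∀ m, S.map m '' V ⊆ V) ∧ ∀ m m', m ≠ m' → Disjoint (S.map m '' V) (S.map m' '' V)

/-- All contraction factors are equal. -/
def Homogeneous : Prop := ∃ ρ : ℝ, ∀ m, S.ratio m = ρ

/-- The convex hulls of the first level components `sₘ(Γ)` are pairwise disjoint. -/
def HullDisjoint (Γ : Set (Eucl n)) : Prop :=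
  ∀ m m', m ≠ m' → Disjoint (convexHull ℝ (S.map m '' Γ)) (convexHull ℝ (S.map m' '' Γ))

/-- `s_{m₁} ∘ ⋯ ∘ s_{m_ℓ}` for a vector index `(m₁, …, m_ℓ)`; the empty list stands for the
index `0`, that is, for the identity. -/
def wordMap : List (Fin M) → Eucl n → Eucl n
  | [] => id
  | m :: w => S.map m ∘ wordMap w

/-- The component `Γ_w = s_{m₁} ∘ ⋯ ∘ s_{m_ℓ}(Γ)`. -/
def cell (Γ : Set (Eucl n)) (w : List (Fin M)) : Set (Eucl n) := S.wordMap w '' Γ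

/-- The vector indices `p` of the maximal components `Γ_p` of `Γ_w` of diameter at most `h`: those
for which `p` extends `w`, `diam Γ_p ≤ h`, and either `p = w` or the parent of `Γ_p` (drop the last
entry of `p`) has diameter greater than `h`. -/
def subIndex (Γ : Set (Eucl n)) (w : List (Fin M)) (h : ℝ) : Set (List (Fin M)) :=
  {p | w <+: p ∧ Metric.diam (S.cell Γ p) ≤ h ∧
    (p = w ∨ h < Metric.diam (S.cell Γ p.dropLast))}

/-- The index set `L_h` of the mesh of width `h` (for `0 < h ≤ diam Γ`). -/
def meshIndex (Γ : Set (Eucl n)) (h : ℝ) : Set (List (Fin M)) := S.subIndex Γ [] h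

/-- `idx` is an ordering `(m(1), …, m(N))` of the elements of `L_h`. -/
def IsMesh (Γ : Set (Eucl n)) (h : ℝ) {N : ℕ} (idx : Fin N → List (Fin M)) : Prop :=
  Function.Injective idx ∧ Set.range idx = S.meshIndex Γ h

/-- The index sets of the composite quadrature rules are finite. -/
theorem finite_subIndex {Γ : Set (Eucl n)} (hΓ : IsCompact Γ) (w : List (Fin M)) {h : ℝ}
    (hh : 0 < h) : (S.subIndex Γ w h).Finite := by
  have : Nonempty (Fin M) := ⟨⟨0, by have := S.two_le; omega⟩⟩
  obtain ⟨m₀, hm₀⟩ := Finite.exists_max S.ratio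
  set r := S.ratio m₀ with hr
  have hr0 : 0 ≤ r := (S.ratio_pos m₀).le
  have hd : ∀ (p : List (Fin M)) (x y : Eucl n),
      dist (S.wordMap p x) (S.wordMap p y) ≤ r ^ p.length * dist x y := by
    intro p
    induction p with
    | nil => intro x y; simp [wordMap]
    | cons m p ih =>
      intro x y
      simp only [wordMap, Function.comp, S.dist_map, List.length_cons, pow_succ']
      rw [mul_assoc]
      exact mul_le_mul (hm₀ m) (ih x y) dist_nonneg hr0
  have hdiam : ∀ p, Metric.diam (S.cell Γ p) ≤ r ^ p.length * Metric.diam Γ := by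
    intro p
    refine Metric.diam_le_of_forall_dist_le (by have := Metric.diam_nonneg (s := Γ); positivity) ?_
    rintro _ ⟨x, hx, rfl⟩ _ ⟨y, hy, rfl⟩
    refine (hd p x y).trans ?_
    gcongr
    exact Metric.dist_le_diam_of_mem hΓ.isBounded hx hy
  have hlim : Tendsto (fun j : ℕ => r ^ j * Metric.diam Γ) atTop (𝓝 (0 * Metric.diam Γ)) :=
    (tendsto_pow_atTop_nhds_zero_of_lt_one hr0 (S.ratio_lt_one m₀)).mul_const _
  rw [zero_mul] at hlim
  obtain ⟨L, hL⟩ := eventually_atTop.1 (hlim.eventually (gt_mem_nhds hh))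
  refine ((Set.finite_singleton w).union (List.finite_length_lt (Fin M) (L + 1))).subset ?_
  rintro p ⟨-, -, hp | hp⟩
  · exact Or.inl hp
  · refine Or.inr ?_
    by_contra hlen
    have h1 : L ≤ p.dropLast.length := by
      simp only [Set.mem_ofPred_eq, not_lt] at hlen
      rw [List.length_dropLast]; omega
    exact absurd (hp.trans_le (hdiam _)) (not_lt.2 (hL _ h1).le)

/-! ### Composite barycentre rules -/

/-- The `d`-dimensional Hausdorff measure `μ_w` of the component `Γ_w`. -/
def wt (Γ : Set (Eucl n)) (d : ℝ) (w : List (Fin M)) : ℝ := (hausM n d).real (S.cell Γ w)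

/-- The barycentre of the component `Γ_w` with respect to Hausdorff measure. -/
def bary (Γ : Set (Eucl n)) (d : ℝ) (w : List (Fin M)) : Eucl n :=
  ⨍ x in S.cell Γ w, x ∂(hausM n d)

/-- Composite barycentre rule for `∫_{Γ_w} f dℋᵈ` with maximal sub-element diameter `hQ`. -/
def quad1 (Γ : Set (Eucl n)) (d hQ : ℝ) (w : List (Fin M)) (f : Eucl n → ℂ) : ℂ :=
  ∑ᶠ p ∈ S.subIndex Γ w hQ, (S.wt Γ d p : ℂ) * f (S.bary Γ d p)

/-- Tensor product composite barycentre rule for `∫_{Γ_w} ∫_{Γ_w'} F(x, y) dℋᵈ(y) dℋᵈ(x)` with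
maximal sub-element diameter `hQ`. -/
def quad2 (Γ : Set (Eucl n)) (d hQ : ℝ) (w w' : List (Fin M)) (F : Eucl n → Eucl n → ℂ) : ℂ :=
  ∑ᶠ p ∈ S.subIndex Γ w hQ, ∑ᶠ p' ∈ S.subIndex Γ w' hQ,
    (S.wt Γ d p : ℂ) * (S.wt Γ d p' : ℂ) * F (S.bary Γ d p) (S.bary Γ d p')

end IFS

/-! ### The Helmholtz fundamental solution in dimensions two and three -/

/-- The Bessel function `J₀`. -/
def besselJ0 (z : ℝ) : ℝ := ∑' j : ℕ, (-1) ^ j * (z ^ 2 / 4) ^ j / ((j.factorial : ℝ) ^ 2)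

/-- The Bessel function `Y₀` (for `z > 0`). -/
def besselY0 (z : ℝ) : ℝ :=
  2 / Real.pi * (Real.log (z / 2) + Real.eulerMascheroniConstant) * besselJ0 z -
    2 / Real.pi * ∑' j : ℕ,
      (-1) ^ j * (harmonic j : ℝ) * (z ^ 2 / 4) ^ j / ((j.factorial : ℝ) ^ 2)

/-- The Hankel function `H₀⁽¹⁾ = J₀ + i Y₀` (for `z > 0`). -/
def hankel0 (z : ℝ) : ℂ := besselJ0 z + Complex.I * besselY0 z

/-- The fundamental solution `Φ(x, y)` of the Helmholtz equation with wavenumber `k` in `ℝⁿ`,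
`n = 2, 3`. -/
def helmholtzKernel (n : ℕ) (k : ℝ) (x y : Eucl n) : ℂ :=
  if n = 2 then Complex.I / 4 * hankel0 (k * dist x y)
  else Complex.exp (Complex.I * k * dist x y) / (4 * Real.pi * dist x y)

/-- The singular part `Φ_sing(x, y)`, `n = 2, 3`. -/
def singKernel (n : ℕ) (x y : Eucl n) : ℂ :=
  if n = 2 then ((-Real.log (dist x y) / (2 * Real.pi) : ℝ) : ℂ)
  else ((1 / (4 * Real.pi * dist x y) : ℝ) : ℂ)

open Classical in
/-- The regular part `Φ - Φ_sing`, with its limiting value on the diagonal. -/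
def regKernel (n : ℕ) (k : ℝ) (x y : Eucl n) : ℂ :=
  if x = y then
    if n = 2 then
      Complex.I / 4 - ((Real.log (k / 2) + Real.eulerMascheroniConstant) / (2 * Real.pi) : ℝ)
    else Complex.I * k / (4 * Real.pi)
  else helmholtzKernel n k x y - singKernel n x y

/-! ### Galerkin quantities and their quadrature approximations -/

namespace IFS

variable {n M : ℕ} (S : IFS n M) (Γ : Set (Eucl n)) (d : ℝ)

/-- The canonical basis function `χ_w`, equal to `μ_w^{-1/2}` on `Γ_w` and `0` elsewhere. -/
def chi (w : List (Fin M)) : Eucl n → ℂ :=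
  (S.cell Γ w).indicator fun _ => ((√(S.wt Γ d w))⁻¹ : ℝ)

/-- The moments `μ_{m(i)}^{-1/2} ∫_{Γ_{m(i)}} f dℋᵈ`. -/
def moment {N : ℕ} (idx : Fin N → List (Fin M)) (f : Eucl n → ℂ) (i : Fin N) : ℂ :=
  ((√(S.wt Γ d (idx i)))⁻¹ : ℝ) * ∫ x in S.cell Γ (idx i), f x ∂(hausM n d)

/-- The moments evaluated by the composite barycentre rule. -/
def momentQ (hQ : ℝ) {N : ℕ} (idx : Fin N → List (Fin M)) (f : Eucl n → ℂ) (i : Fin N) : ℂ :=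
  ((√(S.wt Γ d (idx i)))⁻¹ : ℝ) * S.quad1 Γ d hQ (idx i) f

/-- The right-hand side vector `b`. -/
def rhs {N : ℕ} (idx : Fin N → List (Fin M)) (u : Eucl n → ℂ) (i : Fin N) : ℂ :=
  -S.moment Γ d idx u i

/-- The quadrature approximation of the right-hand side vector. -/
def rhsQ (hQ : ℝ) {N : ℕ} (idx : Fin N → List (Fin M)) (u : Eucl n → ℂ) (i : Fin N) : ℂ :=
  -S.momentQ Γ d hQ idx u i

/-- The Galerkin matrix `A`. -/
def galMat (k : ℝ) {N : ℕ} (idx : Fin N → List (Fin M)) : Matrix (Fin N) (Fin N) ℂ :=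
  Matrix.of fun i j =>
    ((√(S.wt Γ d (idx i)))⁻¹ : ℝ) * ((√(S.wt Γ d (idx j)))⁻¹ : ℝ) *
      ∫ x in S.cell Γ (idx i), ∫ y in S.cell Γ (idx j), helmholtzKernel n k x y
        ∂(hausM n d) ∂(hausM n d)

/-- Quadrature for the singular integral `∫_{Γ_w} ∫_{Γ_w} Φ_sing`, for `n = 2, 3` and a disjoint
attractor. Splitting `Γ_w` into its components `Γ_{w m}` and using the scaling of `Φ_sing` gives
`I = ∑_m ρ_m^{2d} (I - μ_w² log ρ_m / (2π)) + R` if `n = 2`, and `I = ∑_m ρ_m^{2d-1} I + R` if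
`n = 3`, where `R` is the sum of the regular integrals over `Γ_{w m} × Γ_{w m'}`, `m ≠ m'`.
The rule solves for `I` and evaluates `R` by the tensor product composite barycentre rule. -/
def quadSing (hQ : ℝ) (w : List (Fin M)) : ℂ :=
  let R : ℂ := ∑ m, ∑ m', if m = m' then 0
    else S.quad2 Γ d hQ (w ++ [m]) (w ++ [m']) (singKernel n)
  if n = 2 then
    (R - ((S.wt Γ d w ^ 2 * (∑ m, S.ratio m ^ (2 * d) * Real.log (S.ratio m)) /
        (2 * Real.pi) : ℝ) : ℂ)) / ((1 - ∑ m, S.ratio m ^ (2 * d) : ℝ) : ℂ)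
  else R / ((1 - ∑ m, S.ratio m ^ (2 * d - 1) : ℝ) : ℂ)

/-- The quadrature approximation of the Galerkin matrix for a disjoint attractor: the tensor
product composite barycentre rule off the diagonal, and singularity subtraction on the diagonal. -/
def galMatQ (k hQ : ℝ) {N : ℕ} (idx : Fin N → List (Fin M)) : Matrix (Fin N) (Fin N) ℂ :=
  Matrix.of fun i j =>
    ((√(S.wt Γ d (idx i)))⁻¹ : ℝ) * ((√(S.wt Γ d (idx j)))⁻¹ : ℝ) *
      if i = j then
        S.quadSing Γ d hQ (idx i) + S.quad2 Γ d hQ (idx i) (idx i) (regKernel n k)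
      else S.quad2 Γ d hQ (idx i) (idx j) (helmholtzKernel n k)

end IFS

/-- `|f|_{2,K}`: the maximum over `x ∈ K` of the absolute values of the second order partial
derivatives of `f` at `x`. -/
def seminorm2 {n : ℕ} (f : Eucl n → ℂ) (K : Set (Eucl n)) : ℝ :=
  sSup {r | ∃ x ∈ K, ∃ i j : Fin n, r = ‖iteratedFDeriv ℝ 2 f x
    ![EuclideanSpace.single i 1, EuclideanSpace.single j 1]‖}

/-! ### The Sobolev space `H¹(ℝⁿ)` and its dual -/

/-- `L₂(ℝⁿ)`, complex valued. -/
abbrev L2 (n : ℕ) : Type := Lp ℂ 2 (volume : Measure (Eucl n))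

/-- `H¹(ℝⁿ)` with norm `(‖u‖² + ‖∇u‖²)^{1/2}`, realised as the space of families `p` of
`L₂` functions in which `p (some i)` is the weak `i`-th partial derivative of `u = p none`. -/
def H1 (n : ℕ) : Submodule ℂ (PiLp 2 fun _ : Option (Fin n) => L2 n) where
  carrier := {p | ∀ i : Fin n,
    ∂_{(EuclideanSpace.single i (1 : ℝ) : Eucl n)} (Lp.toTemperedDistributionCLM ℂ volume 2 (p none))
      = Lp.toTemperedDistributionCLM ℂ volume 2 (p (some i))}
  add_mem' := by
    intro p q hp hq i
    simp only [PiLp.add_apply, map_add, LineDeriv.lineDerivOp_add, hp i, hq i]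
  zero_mem' := by
    intro i
    simp only [PiLp.zero_apply, map_zero]
    exact (LineDeriv.lineDerivOpCLM ℂ 𝓢'(Eucl n, ℂ)
      (EuclideanSpace.single i (1 : ℝ) : Eucl n)).map_zero
  smul_mem' := by
    intro c p hp i
    simp only [PiLp.smul_apply, map_smul, LineDeriv.lineDerivOp_smul, hp i]

theorem isClosed_H1 (n : ℕ) : IsClosed (H1 n : Set (PiLp 2 fun _ : Option (Fin n) => L2 n)) := by
  have : (H1 n : Set (PiLp 2 fun _ : Option (Fin n) => L2 n)) = ⋂ i : Fin n, {p |
      ∂_{(EuclideanSpace.single i (1 : ℝ) : Eucl n)}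
        (Lp.toTemperedDistributionCLM ℂ volume 2 (p none)) =
      Lp.toTemperedDistributionCLM ℂ volume 2 (p (some i))} := by
    ext p
    simp [H1]
  rw [this]
  refine isClosed_iInter fun i => isClosed_eq ?_ ?_
  · exact (LineDeriv.lineDerivOpCLM ℂ 𝓢'(Eucl n, ℂ)
      (EuclideanSpace.single i (1 : ℝ) : Eucl n)).continuous.comp
      ((Lp.toTemperedDistributionCLM ℂ volume 2).continuous.comp
        (PiLp.continuous_apply 2 (fun _ : Option (Fin n) => L2 n) none))
  · exact (Lp.toTemperedDistributionCLM ℂ volume 2).continuous.comp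
      (PiLp.continuous_apply 2 (fun _ : Option (Fin n) => L2 n) (some i))

instance instCompleteSpaceH1 (n : ℕ) : CompleteSpace (H1 n) := (isClosed_H1 n).completeSpace_coe

/-- The family `(f, ∂₁ f, …, ∂ₙ f)` of `L₂` functions of a Schwartz function `f`. -/
def schwartzJet {n : ℕ} (f : 𝓢(Eucl n, ℂ)) : Option (Fin n) → L2 n
  | none => f.toLp 2
  | some i => (∂_{(EuclideanSpace.single i (1 : ℝ) : Eucl n)} f).toLp 2

/-- A Schwartz function as an element of `H¹(ℝⁿ)`. -/
def H1.ofSchwartz {n : ℕ} (f : 𝓢(Eucl n, ℂ)) : H1 n :=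
  ⟨WithLp.toLp 2 (schwartzJet f), by
    intro i
    simp only [schwartzJet, Lp.toTemperedDistributionCLM_apply, Lp.toTemperedDistribution_toLp_eq]
    exact TemperedDistribution.lineDerivOp_toTemperedDistributionCLM_eq (μ := volume) f _⟩

/-- `H̃¹(Ω)`: the closure of `C₀^∞(Ω)` in `H¹(ℝⁿ)`. -/
def tildeH1 {n : ℕ} (Ω : Set (Eucl n)) : Submodule ℂ (H1 n) :=
  (Submodule.span ℂ {w | ∃ f : 𝓢(Eucl n, ℂ), HasCompactSupport f ∧ tsupport f ⊆ Ω ∧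
    w = H1.ofSchwartz f}).topologicalClosure

instance instCompleteSpaceTildeH1 {n : ℕ} (Ω : Set (Eucl n)) : CompleteSpace (tildeH1 Ω) :=
  (Submodule.isClosed_topologicalClosure _).completeSpace_coe

/-- The orthogonal projection `P` of `H¹(ℝⁿ)` onto the orthogonal complement of `H̃¹(Γᶜ)`. -/
def projP {n : ℕ} (Γ : Set (Eucl n)) (w : H1 n) : H1 n := (tildeH1 Γᶜ).orthogonal.starProjection w

/-- `H⁻¹(ℝⁿ)`, the dual of `H¹(ℝⁿ)`. An element `ψ` is represented by the linear functional
`w ↦ ⟨w, ψ̄⟩` in the duality pairing of `H¹(ℝⁿ)` with `H⁻¹(ℝⁿ)` that extends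
`(w, ψ) ↦ ∫ w ψ̄`; so `ψ w` is the extension of `∫ w ψ`. -/
abbrev Hneg1 (n : ℕ) : Type := H1 n →L[ℂ] ℂ

/-- `ψ = tr_Γ^* f`, for `f` square integrable on `Γ` with respect to `ℋᵈ`:
`⟨φ, ψ̄⟩ = ∫_Γ (φ|_Γ) f dℋᵈ` for all `φ` in the (dense) set `C₀^∞(ℝⁿ)`. -/
def IsTraceAdjoint {n : ℕ} (Γ : Set (Eucl n)) (d : ℝ) (f : Eucl n → ℂ) (ψ : Hneg1 n) : Prop :=
  ∀ φ : 𝓢(Eucl n, ℂ), HasCompactSupport φ →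
    ψ (H1.ofSchwartz φ) = ∫ x in Γ, φ x * f x ∂(hausM n d)

/-- The functional `J(ψ) = ⟨P w, ψ̄⟩`. -/
def functionalJ {n : ℕ} (Γ : Set (Eucl n)) (w : H1 n) (ψ : Hneg1 n) : ℂ := ψ (projP Γ w)

/-- `σ ∈ C₀^∞(ℝⁿ)` is equal to one in a neighbourhood of `Γ`. -/
def IsCutoff {n : ℕ} (Γ : Set (Eucl n)) (σ : Eucl n → ℂ) : Prop :=
  ContDiff ℝ ∞ σ ∧ HasCompactSupport σ ∧ ∀ᶠ x in 𝓝ˢ Γ, σ x = 1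

end

noncomputable section

/-! A barycentre rule is exact for affine functions, so its error is the integral of a second order
Taylor remainder (`norm_integral_sub_mul_le`). On a component of diameter `δ` and measure `μ` the
remainder at `x` is at most `n |f|₂ / 2` times the squared distance to the barycentre, the factor
`n` coming from Cauchy–Schwarz for the Hessian. The second moment about the barycentre is at most `μ
δ² / 2` (`integral_norm_sub_average_sq_le`). Together this is `(n / 4) |f|₂ δ² μ`, and `n ≤ 4`
yields the constant one in (i) and (ii). Since `∑ ρ_m ^ d = 1`, measures and integrals are additive
under subdivision, so these errors add up over sub-components and over the mesh. In (ii), `ψ_N`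
annihilates `C₀^∞(ℝⁿ ∖ Γ)`; hence the projection drops out of `J`, and `J(ψ_N) = ∑ c_j φ_j`.

For (iii) the kernels are written as `f(|x - y|²)`. For two components with separated hulls the
differences `z = x - y` of hull points form a convex set away from the origin. The linear Taylor
term in `z` integrates to zero, and second derivatives of size `|z| ^ (-q)` give an error `C δ ^
(-q) h_Q² μ μ'` at separation `δ` (`RadialC2.exists_taylor`). Hull-disjointness separates distinct
mesh elements by `c h`, which settles the off-diagonal entries with `q = n`.

On the diagonal, the exact singular integral solves the same scalar linear equation as its
approximation, except that the interaction `R` of distinct children is exact; the error is therefore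
that of `R` divided by `1 - θ` with `θ < 1`. The regular part has second derivatives of size `|z| ^
(-s)` for some `s < d`. Its error is at most `h_Q²` times the energy `∬ |x - y| ^ (-s)`
(`exists_norm_pairInt_sub_quad2_self_le`), which is finite by self-similarity and scales explicitly
with the component.

All entry errors, before normalisation, are thus at most `C h_Q² h ^ (-n) μ_i μ_j`. After
normalisation they are dominated by a rank one matrix with entries proportional to `√μ_i √μ_j`,
whose norm is governed by `∑ μ_i = ℋᵈ(Γ)`. -/

theorem IsCompact.isCompact_convexHull_of_finiteDimensional {E : Type*} [NormedAddCommGroup E]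
    [NormedSpace ℝ E] [FiniteDimensional ℝ E] {s : Set E} (hs : IsCompact s) :
    IsCompact (convexHull ℝ s) := by
  -- Carathéodory: affinely independent points number at most the dimension plus one, so finitely
  -- many `k` suffice. Each piece is a continuous image of the compact set simplex times `s ^ k`.
  have h : convexHull ℝ s = ⋃ k ∈ Finset.range (Module.finrank ℝ E + 2),
      (fun p : (Fin k → ℝ) × (Fin k → E) => ∑ i, p.1 i • p.2 i) ''
        (stdSimplex ℝ (Fin k) ×ˢ Set.pi univ fun _ => s) := by
    apply Subset.antisymm
    · intro x hx
      obtain ⟨ι, hι, z, w, hz, hind, hw, hw1, rfl⟩ := eq_pos_convex_span_of_mem_convexHull hx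
      have hcard := hind.card_le_finrank_succ
      have hle : Module.finrank ℝ (vectorSpan ℝ (range z)) ≤ Module.finrank ℝ E :=
        Submodule.finrank_le _
      let e := Fintype.equivFin ι
      simp only [mem_iUnion, Finset.mem_range]
      refine ⟨Fintype.card ι, by omega, (w ∘ e.symm, z ∘ e.symm), ⟨⟨fun i => (hw _).le, ?_⟩, ?_⟩, ?_⟩
      · rw [← hw1]; exact e.symm.sum_comp w
      · intro i _; exact hz ⟨_, rfl⟩
      · exact e.symm.sum_comp fun i => w i • z i
    · refine iUnion₂_subset fun k _ => ?_
      rintro _ ⟨⟨w, z⟩, ⟨⟨hw, hw1⟩, hz⟩, rfl⟩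
      exact (convex_convexHull ℝ s).sum_mem (fun i _ => hw i) hw1
        fun i _ => subset_convexHull ℝ s (hz i trivial)
  rw [h]
  refine (Finset.range _).isCompact_biUnion fun k _ => ?_
  refine ((isCompact_stdSimplex ℝ (Fin k)).prod (isCompact_univ_pi fun _ => hs)).image ?_
  fun_prop

/-! ### Words, components and the scaling of similarities -/

namespace IFS

variable {n M : ℕ} (S : IFS n M)

/-- The contraction factor of `s_{m₁} ∘ ⋯ ∘ s_{m_ℓ}`. -/
def wordRatio (w : List (Fin M)) : ℝ := (w.map S.ratio).prod

@[simp] theorem wordRatio_nil : S.wordRatio [] = 1 := by simp [wordRatio]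

@[simp] theorem wordRatio_singleton (m : Fin M) : S.wordRatio [m] = S.ratio m := by
  simp [wordRatio]

theorem wordRatio_append (w w' : List (Fin M)) :
    S.wordRatio (w ++ w') = S.wordRatio w * S.wordRatio w' := by simp [wordRatio]

theorem wordRatio_pos (w : List (Fin M)) : 0 < S.wordRatio w := by
  induction w with
  | nil => simp
  | cons m w ih =>
    have : S.wordRatio (m :: w) = S.ratio m * S.wordRatio w := by simp [wordRatio]
    rw [this]; exact mul_pos (S.ratio_pos m) ih

theorem wordMap_append (w w' : List (Fin M)) :
    S.wordMap (w ++ w') = S.wordMap w ∘ S.wordMap w' := by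
  induction w with
  | nil => rfl
  | cons m w ih => simp [wordMap, ih, Function.comp_assoc]

theorem dist_wordMap (w : List (Fin M)) (x y : Eucl n) :
    dist (S.wordMap w x) (S.wordMap w y) = S.wordRatio w * dist x y := by
  induction w with
  | nil => simp [wordMap]
  | cons m w ih =>
    simp only [wordMap, Function.comp, S.dist_map, ih, wordRatio, List.map_cons, List.prod_cons]
    ring

theorem injective_wordMap (w : List (Fin M)) : Function.Injective (S.wordMap w) := by
  intro x y hxy
  have := S.dist_wordMap w x y
  rw [hxy, dist_self] at this
  have h0 := (S.wordRatio_pos w).ne'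
  simpa [h0] using this.symm

theorem lipschitzWith_wordMap (w : List (Fin M)) :
    LipschitzWith (S.wordRatio w).toNNReal (S.wordMap w) :=
  LipschitzWith.of_dist_le_mul fun x y => by
    rw [S.dist_wordMap, Real.coe_toNNReal _ (S.wordRatio_pos w).le]

theorem antilipschitzWith_wordMap (w : List (Fin M)) :
    AntilipschitzWith (S.wordRatio w).toNNReal⁻¹ (S.wordMap w) :=
  AntilipschitzWith.of_le_mul_dist fun x y => by
    rw [S.dist_wordMap, NNReal.coe_inv, Real.coe_toNNReal _ (S.wordRatio_pos w).le,
      inv_mul_cancel_left₀ (S.wordRatio_pos w).ne']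

theorem continuous_wordMap (w : List (Fin M)) : Continuous (S.wordMap w) :=
  (S.lipschitzWith_wordMap w).continuous

theorem measurableEmbedding_wordMap (w : List (Fin M)) : MeasurableEmbedding (S.wordMap w) :=
  (S.continuous_wordMap w).measurableEmbedding (S.injective_wordMap w)

/-- Dividing by the ratio leaves an isometry, and an isometry into a strictly convex real space is
affine. Affinity lets the word maps commute with convex hulls, so separation of hulls can be
rescaled. -/
theorem exists_affineMap_eq_wordMap (w : List (Fin M)) :
    ∃ f : Eucl n →ᵃ[ℝ] Eucl n, ⇑f = S.wordMap w := by
  have hr := S.wordRatio_pos w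
  let g : Eucl n → Eucl n := fun x => (S.wordRatio w)⁻¹ • S.wordMap w x
  have hg : Isometry g := Isometry.of_dist_eq fun x y => by
    simp only [g]
    rw [dist_smul₀, S.dist_wordMap, Real.norm_of_nonneg (by positivity),
      inv_mul_cancel_left₀ hr.ne']
  refine ⟨S.wordRatio w • hg.affineIsometryOfStrictConvexSpace.toAffineMap, ?_⟩
  ext1 x
  simp [g, smul_smul, hr.ne']

variable {S} {Γ : Set (Eucl n)} {d : ℝ}

@[simp] theorem cell_nil : S.cell Γ [] = Γ := by simp [cell, wordMap]

theorem cell_append (w w' : List (Fin M)) :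
    S.cell Γ (w ++ w') = S.wordMap w '' S.cell Γ w' := by
  rw [cell, wordMap_append, image_comp, cell]

theorem convexHull_cell_append (w w' : List (Fin M)) :
    convexHull ℝ (S.cell Γ (w ++ w')) = S.wordMap w '' convexHull ℝ (S.cell Γ w') := by
  obtain ⟨f, hf⟩ := S.exists_affineMap_eq_wordMap w
  rw [cell_append, ← hf, AffineMap.image_convexHull]

theorem IsAttractor.cell_eq_iUnion (hΓ : S.IsAttractor Γ) (w : List (Fin M)) :
    S.cell Γ w = ⋃ m, S.cell Γ (w ++ [m]) := by
  simp_rw [cell_append, ← image_iUnion]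
  have : ⋃ m, S.cell Γ [m] = Γ := by
    conv_rhs => rw [hΓ.2.2]
    simp [cell, wordMap]
  rw [this, cell]

theorem IsAttractor.cell_append_subset (hΓ : S.IsAttractor Γ) (w w' : List (Fin M)) :
    S.cell Γ (w ++ w') ⊆ S.cell Γ w := by
  induction w' using List.reverseRecOn with
  | nil => simp
  | append_singleton w' m ih =>
    rw [← List.append_assoc]
    refine Subset.trans ?_ ih
    conv_rhs => rw [hΓ.cell_eq_iUnion]
    exact subset_iUnion (fun m => S.cell Γ (w ++ w' ++ [m])) m

theorem IsAttractor.cell_anti (hΓ : S.IsAttractor Γ) {w p : List (Fin M)} (h : w <+: p) :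
    S.cell Γ p ⊆ S.cell Γ w := by
  obtain ⟨q, rfl⟩ := h
  exact hΓ.cell_append_subset w q

theorem IsAttractor.cell_subset (hΓ : S.IsAttractor Γ) (w : List (Fin M)) : S.cell Γ w ⊆ Γ := by
  simpa using hΓ.cell_anti (List.nil_prefix (l := w))

theorem IsAttractor.isCompact_cell (hΓ : S.IsAttractor Γ) (w : List (Fin M)) :
    IsCompact (S.cell Γ w) := hΓ.2.1.image (S.continuous_wordMap w)

theorem IsAttractor.measurableSet_cell (hΓ : S.IsAttractor Γ) (w : List (Fin M)) :
    MeasurableSet (S.cell Γ w) := (hΓ.isCompact_cell w).measurableSet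

theorem IsAttractor.cell_nonempty (hΓ : S.IsAttractor Γ) (w : List (Fin M)) :
    (S.cell Γ w).Nonempty := hΓ.1.image _

theorem ediam_cell (w : List (Fin M)) :
    Metric.ediam (S.cell Γ w) = ENNReal.ofReal (S.wordRatio w) * Metric.ediam Γ := by
  apply le_antisymm
  · exact (S.lipschitzWith_wordMap w).ediam_image_le Γ
  · have h := (S.antilipschitzWith_wordMap w).le_mul_ediam_image Γ
    have h0 : (S.wordRatio w).toNNReal ≠ 0 := (Real.toNNReal_pos.2 (S.wordRatio_pos w)).ne'
    have h1 : ENNReal.ofReal (S.wordRatio w) ≠ 0 := by simpa using S.wordRatio_pos w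
    rw [ENNReal.coe_inv h0] at h
    calc _ ≤ ENNReal.ofReal (S.wordRatio w) *
          ((ENNReal.ofReal (S.wordRatio w))⁻¹ * Metric.ediam (S.cell Γ w)) := by
          gcongr; exact h
      _ = _ := by rw [← mul_assoc, ENNReal.mul_inv_cancel h1 ENNReal.ofReal_ne_top, one_mul]

theorem diam_cell (w : List (Fin M)) :
    Metric.diam (S.cell Γ w) = S.wordRatio w * Metric.diam Γ := by
  rw [Metric.diam, ediam_cell, ENNReal.toReal_mul,
    ENNReal.toReal_ofReal (S.wordRatio_pos w).le, Metric.diam]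

theorem IsAttractor.diam_cell_anti (hΓ : S.IsAttractor Γ) {w p : List (Fin M)} (h : w <+: p) :
    Metric.diam (S.cell Γ p) ≤ Metric.diam (S.cell Γ w) :=
  Metric.diam_mono (hΓ.cell_anti h) (hΓ.isCompact_cell w).isBounded

/-! ### Hausdorff measure of the components -/

/-- A similarity is Lipschitz and antilipschitz with reciprocal constants, so the upper and lower
bounds for the measure of the image coincide. -/
theorem hausM_image_wordMap (hd : 0 ≤ d) (w : List (Fin M)) (A : Set (Eucl n)) :
    hausM n d (S.wordMap w '' A) = ENNReal.ofReal (S.wordRatio w ^ d) * hausM n d A := by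
  have hr := S.wordRatio_pos w
  have hr' : (S.wordRatio w).toNNReal ≠ 0 := (Real.toNNReal_pos.2 hr).ne'
  have h1 := (S.lipschitzWith_wordMap w).hausdorffMeasure_image_le hd A
  have h2 := (S.antilipschitzWith_wordMap w).le_hausdorffMeasure_image hd A
  have e : ((S.wordRatio w).toNNReal : ENNReal) ^ d = ENNReal.ofReal (S.wordRatio w ^ d) := by
    rw [← ENNReal.ofReal_rpow_of_pos hr]; rfl
  have hne : ENNReal.ofReal (S.wordRatio w ^ d) ≠ 0 := by simpa using Real.rpow_pos_of_pos hr d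
  rw [ENNReal.coe_inv hr', ENNReal.inv_rpow, e] at h2
  rw [e] at h1
  have h3 : Measure.hausdorffMeasure d (S.wordMap w '' A) =
      ENNReal.ofReal (S.wordRatio w ^ d) * Measure.hausdorffMeasure d A := by
    refine le_antisymm h1 ?_
    calc _ ≤ ENNReal.ofReal (S.wordRatio w ^ d) * ((ENNReal.ofReal (S.wordRatio w ^ d))⁻¹ *
          Measure.hausdorffMeasure d (S.wordMap w '' A)) := by gcongr
      _ = _ := by rw [← mul_assoc, ENNReal.mul_inv_cancel hne ENNReal.ofReal_ne_top, one_mul]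
  simp only [hausM, Measure.smul_apply, smul_eq_mul, h3]
  ring

theorem hausM_cell (hd : 0 ≤ d) (w : List (Fin M)) :
    hausM n d (S.cell Γ w) = ENNReal.ofReal (S.wordRatio w ^ d) * hausM n d Γ :=
  hausM_image_wordMap hd w Γ

/-- This is the expansion of `(∑ m, ρ_m ^ d) ^ L` over words of length `L`. -/
theorem sum_wordRatio_rpow_ofFn (hsum : ∑ m, S.ratio m ^ d = 1) (L : ℕ) :
    ∑ v : Fin L → Fin M, S.wordRatio (List.ofFn v) ^ d = 1 := by
  have h : ∀ v : Fin L → Fin M, S.wordRatio (List.ofFn v) ^ d = ∏ i, S.ratio (v i) ^ d := by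
    intro v
    rw [wordRatio, List.map_ofFn, List.prod_ofFn, ← Real.finsetProd_rpow]
    · rfl
    · exact fun i _ => (S.ratio_pos _).le
  simp_rw [h]
  rw [← Fintype.piFinset_univ,
    ← Finset.prod_univ_sum (fun _ : Fin L => Finset.univ) fun _ m => S.ratio m ^ d]
  simp [hsum]

theorem IsAttractor.subset_iUnion_ofFn (hΓ : S.IsAttractor Γ) (L : ℕ) :
    Γ ⊆ ⋃ v : Fin L → Fin M, S.cell Γ (List.ofFn v) := by
  induction L with
  | zero => intro x hx; simpa using hx
  | succ L ih =>
    refine ih.trans (iUnion_subset fun v => ?_)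
    rw [hΓ.cell_eq_iUnion]
    refine iUnion_subset fun m => ?_
    refine Subset.trans ?_ (subset_iUnion _ (Fin.snoc v m : Fin (L + 1) → Fin M))
    rw [List.ofFn_succ_last]
    simp

variable (S) in
theorem exists_ratio_bound : ∃ r : ℝ, 0 < r ∧ r < 1 ∧ ∀ m, S.ratio m ≤ r := by
  have : Nonempty (Fin M) := ⟨⟨0, by have := S.two_le; omega⟩⟩
  obtain ⟨m₀, hm₀⟩ := Finite.exists_max S.ratio
  exact ⟨_, S.ratio_pos m₀, S.ratio_lt_one m₀, hm₀⟩

variable (S) in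
theorem exists_lt_ratio : ∃ r : ℝ, 0 < r ∧ ∀ m, r ≤ S.ratio m := by
  have : Nonempty (Fin M) := ⟨⟨0, by have := S.two_le; omega⟩⟩
  obtain ⟨m₀, hm₀⟩ := Finite.exists_min S.ratio
  exact ⟨_, S.ratio_pos m₀, hm₀⟩

theorem wordRatio_le_pow {r : ℝ} (hr : 0 < r) (h : ∀ m, S.ratio m ≤ r) (w : List (Fin M)) :
    S.wordRatio w ≤ r ^ w.length := by
  induction w with
  | nil => simp
  | cons m w ih =>
    have : S.wordRatio (m :: w) = S.ratio m * S.wordRatio w := by simp [wordRatio]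
    rw [this, List.length_cons, pow_succ']
    exact mul_le_mul (h m) ih (S.wordRatio_pos w).le hr.le

/-- The level `L` components cover `Γ` with diameters tending to zero, while the sum of their
diameters to the power `d` equals `(diam Γ) ^ d` at every level. -/
theorem IsAttractor.hausM_lt_top (hΓ : S.IsAttractor Γ) (hd : 0 ≤ d)
    (hsum : ∑ m, S.ratio m ^ d = 1) : hausM n d Γ < ⊤ := by
  obtain ⟨r, hr0, hr1, hr⟩ := S.exists_ratio_bound
  have hfin : Metric.ediam Γ ≠ ⊤ := hΓ.2.1.isBounded.ediam_ne_top
  have key : Measure.hausdorffMeasure d Γ ≤ Metric.ediam Γ ^ d := by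
    have h0 : Tendsto (fun L : ℕ => ENNReal.ofReal (r ^ L) * Metric.ediam Γ) atTop (𝓝 0) := by
      have h1 : Tendsto (fun L : ℕ => ENNReal.ofReal (r ^ L)) atTop (𝓝 0) := by
        simpa using ENNReal.tendsto_ofReal (tendsto_pow_atTop_nhds_zero_of_lt_one hr0.le hr1)
      simpa using ENNReal.Tendsto.mul_const h1 (Or.inr hfin)
    refine (Measure.hausdorffMeasure_le_liminf_sum d Γ _ h0
      (fun L (v : Fin L → Fin M) => S.cell Γ (List.ofFn v))
      (.of_forall fun L v => ?_) (.of_forall fun L => hΓ.subset_iUnion_ofFn L)).trans ?_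
    · rw [ediam_cell]
      gcongr
      simpa using wordRatio_le_pow hr0 hr (List.ofFn v)
    · have : ∀ L : ℕ, ∑ v : Fin L → Fin M, Metric.ediam (S.cell Γ (List.ofFn v)) ^ d =
          Metric.ediam Γ ^ d := by
        intro L
        simp_rw [ediam_cell, ENNReal.mul_rpow_of_nonneg _ _ hd,
          ENNReal.ofReal_rpow_of_pos (S.wordRatio_pos _)]
        rw [← Finset.sum_mul, ← ENNReal.ofReal_sum_of_nonneg
          (fun v _ => (Real.rpow_pos_of_pos (S.wordRatio_pos _) d).le),
          sum_wordRatio_rpow_ofFn hsum]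
        simp
      simp [this]
  simp only [hausM, Measure.smul_apply, smul_eq_mul]
  exact ENNReal.mul_lt_top ENNReal.ofReal_lt_top
    (key.trans_lt (ENNReal.rpow_lt_top_of_nonneg hd hfin))

theorem IsAttractor.hausM_cell_lt_top (hΓ : S.IsAttractor Γ) (hd : 0 ≤ d)
    (hsum : ∑ m, S.ratio m ^ d = 1) (w : List (Fin M)) : hausM n d (S.cell Γ w) < ⊤ :=
  (measure_mono (hΓ.cell_subset w)).trans_lt (hΓ.hausM_lt_top hd hsum)

theorem wt_eq (hd : 0 ≤ d) (w : List (Fin M)) :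
    S.wt Γ d w = S.wordRatio w ^ d * (hausM n d).real Γ := by
  rw [wt, measureReal_def, hausM_cell hd, ENNReal.toReal_mul,
    ENNReal.toReal_ofReal (Real.rpow_nonneg (S.wordRatio_pos w).le d), measureReal_def]

theorem wt_nonneg (w : List (Fin M)) : 0 ≤ S.wt Γ d w := measureReal_nonneg

theorem sum_wordRatio_children (hsum : ∑ m, S.ratio m ^ d = 1) (w : List (Fin M)) :
    ∑ m, S.wordRatio (w ++ [m]) ^ d = S.wordRatio w ^ d := by
  simp_rw [wordRatio_append, wordRatio_singleton,
    Real.mul_rpow (S.wordRatio_pos w).le (S.ratio_pos _).le]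
  rw [← Finset.mul_sum, hsum, mul_one]

theorem wt_eq_sum (hd : 0 ≤ d) (hsum : ∑ m, S.ratio m ^ d = 1) (w : List (Fin M)) :
    S.wt Γ d w = ∑ m, S.wt Γ d (w ++ [m]) := by
  simp_rw [wt_eq hd]
  rw [← Finset.sum_mul, sum_wordRatio_children hsum]

/-- Distinct children of a component overlap in a null set. -/
theorem IsAttractor.aedisjoint_cell (hΓ : S.IsAttractor Γ) (hd : 0 ≤ d)
    (hsum : ∑ m, S.ratio m ^ d = 1) (w : List (Fin M)) :
    Pairwise (Function.onFun (AEDisjoint (hausM n d)) fun m => S.cell Γ (w ++ [m])) := by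
  intro m m' hmm
  have hm := hΓ.measurableSet_cell (w ++ [m])
  have hfin := fun v => (hΓ.hausM_cell_lt_top hd hsum v).ne
  -- Subadditivity with two children merged into one set. As the measure of the parent is also the
  -- full sum over its children, the merged pair must have measure at least the sum of the two, and
  -- inclusion–exclusion makes their intersection null.
  have htot : S.wt Γ d w ≤ (hausM n d).real (S.cell Γ (w ++ [m]) ∪ S.cell Γ (w ++ [m'])) +
      ∑ j ∈ (Finset.univ.erase m).erase m', S.wt Γ d (w ++ [j]) := by
    have hsub : S.cell Γ w ⊆ (S.cell Γ (w ++ [m]) ∪ S.cell Γ (w ++ [m'])) ∪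
        ⋃ j ∈ (Finset.univ.erase m).erase m', S.cell Γ (w ++ [j]) := by
      rw [hΓ.cell_eq_iUnion]
      refine iUnion_subset fun j => ?_
      by_cases h1 : j = m
      · subst h1; exact subset_union_left.trans subset_union_left
      by_cases h2 : j = m'
      · subst h2; exact subset_union_right.trans subset_union_left
      refine Subset.trans ?_ subset_union_right
      exact subset_biUnion_of_mem (u := fun j => S.cell Γ (w ++ [j]))
        (by simp [h1, h2] : j ∈ ((Finset.univ.erase m).erase m' : Finset (Fin M)))
    refine (measureReal_mono hsub ?_).trans ((measureReal_union_le _ _).trans ?_)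
    · refine ne_top_of_le_ne_top (hfin w) (measure_mono ?_)
      refine union_subset (union_subset ?_ ?_) (iUnion₂_subset fun j _ => ?_) <;>
        exact hΓ.cell_append_subset _ _
    · gcongr
      exact measureReal_biUnion_finset_le _ _
  have hinter := measureReal_union_add_inter₀' (μ := hausM n d) (s := S.cell Γ (w ++ [m]))
    hm.nullMeasurableSet (t := S.cell Γ (w ++ [m'])) (hfin _) (hfin _)
  rw [wt_eq_sum hd hsum, ← Finset.add_sum_erase _ _ (Finset.mem_univ m),
    ← Finset.add_sum_erase _ _ (Finset.mem_erase.2 ⟨hmm.symm, Finset.mem_univ m'⟩)] at htot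
  have h0 : (hausM n d).real (S.cell Γ (w ++ [m]) ∩ S.cell Γ (w ++ [m'])) = 0 := by
    refine le_antisymm ?_ measureReal_nonneg
    simp only [wt] at htot hinter ⊢
    linarith
  rw [measureReal_def, ENNReal.toReal_eq_zero_iff] at h0
  exact h0.resolve_right (ne_top_of_le_ne_top (hfin (w ++ [m])) (measure_mono inter_subset_left))

theorem restrict_cell (hd : 0 ≤ d) (w : List (Fin M)) :
    (hausM n d).restrict (S.cell Γ w) = ENNReal.ofReal (S.wordRatio w ^ d) •
      ((hausM n d).restrict Γ).map (S.wordMap w) := by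
  have he := S.measurableEmbedding_wordMap w
  ext A hA
  rw [Measure.restrict_apply hA, Measure.smul_apply, he.map_apply,
    Measure.restrict_apply (he.measurable hA), smul_eq_mul, ← hausM_image_wordMap hd]
  congr 1
  rw [cell, inter_comm, ← image_inter_preimage, inter_comm]

/-! ### Summation over the index sets of the composite rules -/

theorem prefix_dropLast_of_ne {α : Type*} {w p : List α} (h : w <+: p) (hne : p ≠ w) :
    w <+: p.dropLast := by
  obtain ⟨q, rfl⟩ := h
  rcases List.eq_nil_or_concat q with rfl | ⟨q, m, rfl⟩
  · simp at hne
  · rw [List.concat_eq_append, ← List.append_assoc, List.dropLast_concat]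
    exact List.prefix_append w q

/-- With `subIndex_eq_iUnion` this turns the index set into a stopping rule: stop once the diameter
is at most `h`, otherwise pass to the children. -/
theorem IsAttractor.subIndex_eq_singleton (hΓ : S.IsAttractor Γ) {w : List (Fin M)} {h : ℝ}
    (hw : Metric.diam (S.cell Γ w) ≤ h) : S.subIndex Γ w h = {w} := by
  ext p
  simp only [subIndex, Set.mem_ofPred_eq, mem_singleton_iff]
  refine ⟨fun ⟨hp, _, h2⟩ => ?_, fun hp => by subst hp; exact ⟨List.prefix_rfl, hw, Or.inl rfl⟩⟩
  by_contra hpw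
  have h3 := h2.resolve_left hpw
  have := hΓ.diam_cell_anti (prefix_dropLast_of_ne hp hpw)
  linarith

theorem subIndex_eq_iUnion {w : List (Fin M)} {h : ℝ}
    (hw : h < Metric.diam (S.cell Γ w)) :
    S.subIndex Γ w h = ⋃ m, S.subIndex Γ (w ++ [m]) h := by
  ext p
  simp only [subIndex, Set.mem_ofPred_eq, mem_iUnion]
  constructor
  · rintro ⟨⟨q, rfl⟩, h1, h2⟩
    rcases q with _ | ⟨m, q⟩
    · simp only [List.append_nil] at h1; linarith
    · refine ⟨m, ⟨q, by simp⟩, h1, ?_⟩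
      rcases h2 with h2 | h2
      · simp at h2
      · exact Or.inr h2
  · rintro ⟨m, hp, h1, h2⟩
    refine ⟨(List.prefix_append w [m]).trans hp, h1, Or.inr ?_⟩
    rcases h2 with rfl | h2
    · simpa using hw
    · exact h2

/-- A quantity that is additive under subdivision is the sum of its values on the components of
diameter at most `h`. -/
theorem IsAttractor.eq_finsum_subIndex (hΓ : S.IsAttractor Γ) {E : Type*} [AddCommMonoid E]
    {F : List (Fin M) → E} (hF : ∀ w, F w = ∑ m, F (w ++ [m])) {h : ℝ} (hh : 0 < h)
    (w : List (Fin M)) : F w = ∑ᶠ p ∈ S.subIndex Γ w h, F p := by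
  obtain ⟨r, hr0, hr1, hr⟩ := S.exists_ratio_bound
  -- Here `k` bounds the number of subdivisions still needed: each one shrinks the diameter by a
  -- factor of at most `r < 1`.
  have key : ∀ (k : ℕ) (w : List (Fin M)), Metric.diam (S.cell Γ w) * r ^ k ≤ h →
      F w = ∑ᶠ p ∈ S.subIndex Γ w h, F p := by
    intro k
    induction k with
    | zero =>
      intro w hw
      rw [hΓ.subIndex_eq_singleton (by simpa using hw), finsum_mem_singleton]
    | succ k ih =>
      intro w hw
      rcases le_or_gt (Metric.diam (S.cell Γ w)) h with h1 | h1
      · rw [hΓ.subIndex_eq_singleton h1, finsum_mem_singleton]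
      · rw [subIndex_eq_iUnion h1, finsum_mem_iUnion, finsum_eq_sum_of_fintype, hF]
        · refine Finset.sum_congr rfl fun m _ => ih _ (le_trans ?_ hw)
          rw [diam_cell, wordRatio_append, diam_cell, wordRatio_singleton, pow_succ']
          have h2 := (S.wordRatio_pos w).le
          have h3 := Metric.diam_nonneg (s := Γ)
          have h4 := hr m
          calc S.wordRatio w * S.ratio m * Metric.diam Γ * r ^ k
              ≤ S.wordRatio w * r * Metric.diam Γ * r ^ k := by gcongr
            _ = _ := by ring
        · intro m m' hmm
          refine Set.disjoint_left.2 ?_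
          rintro p ⟨⟨q, hq⟩, -⟩ ⟨⟨q', hq'⟩, -⟩
          rw [← hq'] at hq
          simp only [List.append_assoc, List.singleton_append, List.append_cancel_left_eq,
            List.cons.injEq] at hq
          exact hmm hq.1
        · exact fun m => S.finite_subIndex hΓ.2.1 _ hh
  have hlim : Tendsto (fun k : ℕ => Metric.diam (S.cell Γ w) * r ^ k) atTop (𝓝 0) := by
    simpa using (tendsto_pow_atTop_nhds_zero_of_lt_one hr0.le hr1).const_mul _
  obtain ⟨k, hk⟩ := (hlim.eventually (gt_mem_nhds hh)).exists
  exact key k w hk.le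

/-- Two distinct components in a composite rule lie in distinct children of a common ancestor. -/
theorem IsAttractor.exists_common_ancestor (hΓ : S.IsAttractor Γ) {w p p' : List (Fin M)} {h : ℝ}
    (hp : p ∈ S.subIndex Γ w h) (hp' : p' ∈ S.subIndex Γ w h) (hne : p ≠ p') :
    ∃ (v : List (Fin M)) (m m' : Fin M), m ≠ m' ∧ v ++ [m] <+: p ∧ v ++ [m'] <+: p' ∧
      h < Metric.diam (S.cell Γ v) := by
  -- Stopped indices form an antichain: the parent of a proper extension of `p` still lies in `Γ_p`,
  -- so its diameter is at most `h`, and the extension would not be maximal.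
  have hnp : ∀ {p p' : List (Fin M)}, p ∈ S.subIndex Γ w h → p' ∈ S.subIndex Γ w h → p ≠ p' →
      ¬ p <+: p' := by
    intro p p' hp hp' hne hpp
    have h1 : p' ≠ w := by
      rintro rfl
      exact hne (hpp.eq_of_length (le_antisymm hpp.length_le hp.1.length_le))
    have h2 := hp'.2.2.resolve_left h1
    have h3 := hΓ.diam_cell_anti (prefix_dropLast_of_ne hpp hne.symm)
    linarith [hp.2.1]
  -- Cut two incomparable words at their first disagreement.
  have hsplit : ∀ q q' : List (Fin M), ¬ q <+: q' → ¬ q' <+: q → ∃ v m m', m ≠ m' ∧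
      v ++ [m] <+: q ∧ v ++ [m'] <+: q' := by
    intro q
    induction q with
    | nil => intro q' h1; exact absurd List.nil_prefix h1
    | cons a q ih =>
      intro q' h1 h2
      rcases q' with _ | ⟨b, q'⟩
      · exact absurd List.nil_prefix h2
      by_cases hab : a = b
      · subst hab
        obtain ⟨v, m, m', hm, h3, h4⟩ := ih q' (by simpa using h1) (by simpa using h2)
        exact ⟨a :: v, m, m', hm, by simpa using h3, by simpa using h4⟩
      · exact ⟨[], a, b, hab, by simp, by simp⟩
  obtain ⟨v, m, m', hm, h1, h2⟩ := hsplit p p' (hnp hp hp' hne) (hnp hp' hp hne.symm)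
  refine ⟨v, m, m', hm, h1, h2, ?_⟩
  have h3 : p ≠ w := by
    rintro rfl
    exact hnp hp hp' hne hp'.1
  -- The parent of `p` has diameter above `h`, and it lies in `Γ_v` because `p` properly extends
  -- `v`.
  refine (hp.2.2.resolve_left h3).trans_le (hΓ.diam_cell_anti ?_)
  obtain ⟨q, rfl⟩ := h1
  refine prefix_dropLast_of_ne (by simp) ?_
  intro h4
  have := congrArg List.length h4
  simp at this

end IFS

/-! ### Taylor remainders and moments about the barycentre -/

/-- Second order Taylor estimate on the unit interval. -/
theorem norm_sub_sub_le_of_hasDerivAt {E : Type*} [NormedAddCommGroup E] [NormedSpace ℝ E]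
    {g g₁ g₂ : ℝ → E} {C : ℝ}
    (h₁ : ∀ t ∈ Icc (0 : ℝ) 1, HasDerivAt g (g₁ t) t)
    (h₂ : ∀ t ∈ Icc (0 : ℝ) 1, HasDerivAt g₁ (g₂ t) t)
    (hC : ∀ t ∈ Icc (0 : ℝ) 1, ‖g₂ t‖ ≤ C) : ‖g 1 - g 0 - g₁ 0‖ ≤ C / 2 := by
  have hb₁ : ∀ t ∈ Icc (0 : ℝ) 1, ‖g₁ t - g₁ 0‖ ≤ C * (t - 0) :=
    norm_image_sub_le_of_norm_deriv_right_le_segment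
      (fun t ht => (h₂ t ht).continuousAt.continuousWithinAt)
      (fun t ht => (h₂ t (Ico_subset_Icc_self ht)).hasDerivWithinAt)
      fun t ht => hC t (Ico_subset_Icc_self ht)
  have hd : ∀ t ∈ Icc (0 : ℝ) 1,
      HasDerivAt (fun t => g t - g 0 - t • g₁ 0) (g₁ t - g₁ 0) t := fun t ht => by
    simpa using! ((h₁ t ht).sub_const (g 0)).sub ((hasDerivAt_id t).smul_const (g₁ 0))
  have h := image_norm_le_of_norm_deriv_right_le_deriv_boundary
    (f := fun t => g t - g 0 - t • g₁ 0) (a := 0) (b := 1)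
    (B := fun t => C / 2 * t ^ 2) (B' := fun t => C * t)
    (fun t ht => (hd t ht).continuousAt.continuousWithinAt)
    (fun t ht => (hd t (Ico_subset_Icc_self ht)).hasDerivWithinAt) (by simp)
    (fun t => by
      have := (hasDerivAt_pow 2 t).const_mul (C / 2)
      convert! this using 1; simp; ring)
    (fun t ht => by simpa using hb₁ t (Ico_subset_Icc_self ht))
  simpa using h (right_mem_Icc.2 zero_le_one)

/-- The error of a barycentre rule is bounded by the integral of a second order remainder. -/
theorem norm_integral_sub_mul_le {Ω E : Type*} [MeasurableSpace Ω] [NormedAddCommGroup E]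
    [NormedSpace ℝ E] [CompleteSpace E] {ρ : Measure Ω} [IsFiniteMeasure ρ] {X : Ω → E} {z₀ : E}
    (hX : Integrable (fun a => X a - z₀) ρ) (hz : ∫ a, X a - z₀ ∂ρ = 0) {G : Ω → ℂ}
    (hG : Integrable G ρ) (G₀ : ℂ) (L : E →L[ℝ] ℂ) {B : Ω → ℝ} (hB : Integrable B ρ)
    (h : ∀ᵐ a ∂ρ, ‖G a - G₀ - L (X a - z₀)‖ ≤ B a) :
    ‖(∫ a, G a ∂ρ) - (ρ.real univ : ℂ) * G₀‖ ≤ ∫ a, B a ∂ρ := by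
  -- The first order term disappears because `z₀` is the mean of `X`; only the remainder survives.
  have hL : ∫ a, L (X a - z₀) ∂ρ = 0 := by
    rw [L.integral_comp_comm hX, hz, map_zero]
  have e : ∫ a, G a - G₀ - L (X a - z₀) ∂ρ = (∫ a, G a ∂ρ) - (ρ.real univ : ℂ) * G₀ := by
    rw [integral_sub (f := fun a => G a - G₀) (hG.sub (integrable_const _)) (L.integrable_comp hX), hL, sub_zero,
      integral_sub hG (integrable_const _), integral_const, Complex.real_smul]
  rw [← e]
  exact norm_integral_le_of_norm_le hB h

section SecondMoment

variable {E : Type*} [NormedAddCommGroup E] [InnerProductSpace ℝ E] [FiniteDimensional ℝ E]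
  [MeasurableSpace E] [BorelSpace E] {ρ : Measure E} [IsFiniteMeasure ρ] {A : Set E}

theorem Continuous.integrable_of_ae_mem_compact {F : Type*} [NormedAddCommGroup F]
    {f : E → F} (hf : Continuous f) (hA : IsCompact A) (hρ : ∀ᵐ x ∂ρ, x ∈ A) :
    Integrable f ρ := by
  have := hf.continuousOn.integrableOn_compact (μ := ρ) hA
  rwa [IntegrableOn, Measure.restrict_eq_self_of_ae_mem hρ] at this

/-- The second moment about the barycentre is at most half of mass times squared diameter. -/
theorem integral_norm_sub_average_sq_le (hA : IsCompact A) (hρ : ∀ᵐ x ∂ρ, x ∈ A) :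
    ∫ x, ‖x - ⨍ y, y ∂ρ‖ ^ 2 ∂ρ ≤ ρ.real univ * Metric.diam A ^ 2 / 2 := by
  set xb := ⨍ y, y ∂ρ with hxb
  set V := ∫ x, ‖x - xb‖ ^ 2 ∂ρ with hV
  set m := ρ.real univ with hm
  have hint : ∀ {f : E → ℝ}, Continuous f → Integrable f ρ :=
    fun hf => hf.integrable_of_ae_mem_compact hA hρ
  have h0 : ∫ x, (x - xb) ∂ρ = 0 := integral_sub_average ρ fun x => x
  -- Parallel axis identity: the cross term vanishes at the barycentre.
  have h1 : ∀ y, ∫ x, ‖x - y‖ ^ 2 ∂ρ = V + m * ‖y - xb‖ ^ 2 := by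
    intro y
    have e : ∀ x, ‖x - y‖ ^ 2 =
        ‖x - xb‖ ^ 2 + 2 * inner ℝ (xb - y) (x - xb) + ‖y - xb‖ ^ 2 := by
      intro x
      have : x - y = (x - xb) + (xb - y) := by abel
      rw [this, norm_add_sq_real, norm_sub_rev xb y, real_inner_comm]
    simp_rw [e]
    rw [integral_add, integral_add, integral_const_mul, integral_inner, h0, inner_zero_right,
      integral_const]
    · simp [hV, hm]
    · exact (by fun_prop : Continuous fun x : E => x - xb).integrable_of_ae_mem_compact hA hρ
    all_goals exact hint (by fun_prop)
  have h2 : ∀ y ∈ A, V + m * ‖y - xb‖ ^ 2 ≤ m * Metric.diam A ^ 2 := by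
    intro y hy
    rw [← h1]
    have : ∫ _, Metric.diam A ^ 2 ∂ρ = m * Metric.diam A ^ 2 := by simp [hm]
    rw [← this]
    refine integral_mono_ae (hint (by fun_prop)) (integrable_const _) ?_
    filter_upwards [hρ] with x hx
    have := Metric.dist_le_diam_of_mem hA.isBounded hx hy
    rw [dist_eq_norm] at this
    gcongr
  -- Integrating the identity in `y` as well counts `V` twice, giving `2 m V ≤ m² (diam A)²`; this
  -- is the source of the factor one half.
  have h3 : ∫ y, (V + m * ‖y - xb‖ ^ 2) ∂ρ ≤ ∫ _, m * Metric.diam A ^ 2 ∂ρ := by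
    refine integral_mono_ae (hint (by fun_prop)) (integrable_const _) ?_
    filter_upwards [hρ] with y hy using h2 y hy
  rw [integral_add (integrable_const _) (hint (by fun_prop)), integral_const_mul, ← hV] at h3
  simp only [integral_const, smul_eq_mul, ← hm] at h3
  rcases (measureReal_nonneg : 0 ≤ ρ.real univ).eq_or_lt with h4 | h4
  · have h5 : ρ = 0 := by
      rw [eq_comm, measureReal_eq_zero_iff] at h4
      exact Measure.measure_univ_eq_zero.1 h4
    rw [hV, hm, h5]; simp
  · have : m * (2 * V) ≤ m * (m * Metric.diam A ^ 2) := by linarith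
    have := le_of_mul_le_mul_left this h4
    linarith

end SecondMoment

section Seminorm

variable {n : ℕ}

theorem seminorm2_nonneg (f : Eucl n → ℂ) (K : Set (Eucl n)) : 0 ≤ seminorm2 f K :=
  Real.sSup_nonneg (by rintro _ ⟨x, _, i, j, rfl⟩; exact norm_nonneg _)

variable {f : Eucl n → ℂ} {U K : Set (Eucl n)}

theorem hasFDerivAt_fderiv_of_contDiffOn (hU : IsOpen U) (hf : ContDiffOn ℝ ∞ f U) {x : Eucl n}
    (hx : x ∈ U) : HasFDerivAt f (fderiv ℝ f x) x ∧
      HasFDerivAt (fderiv ℝ f) (fderiv ℝ (fderiv ℝ f) x) x := by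
  have h1 : ContDiffAt ℝ ∞ f x := hf.contDiffAt (hU.mem_nhds hx)
  exact ⟨(h1.differentiableAt (by simp)).hasFDerivAt,
    ((h1.fderiv_right (m := 1) (by norm_cast)).differentiableAt (by simp)).hasFDerivAt⟩

theorem continuousOn_fderiv_fderiv (hU : IsOpen U) (hf : ContDiffOn ℝ ∞ f U) :
    ContinuousOn (fderiv ℝ (fderiv ℝ f)) U := by
  have h1 : ContDiffOn ℝ 1 (fderiv ℝ f) U := hf.fderiv_of_isOpen hU (by norm_cast)
  exact h1.continuousOn_fderiv_of_isOpen hU (by simp)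

theorem norm_fderiv_fderiv_single_le (hU : IsOpen U) (hf : ContDiffOn ℝ ∞ f U) (hK : IsCompact K)
    (hKU : K ⊆ U) {x : Eucl n} (hx : x ∈ K) (i j : Fin n) :
    ‖fderiv ℝ (fderiv ℝ f) x (EuclideanSpace.single i 1) (EuclideanSpace.single j 1)‖ ≤
      seminorm2 f K := by
  -- Compactness bounds the set under the supremum; for an unbounded set `sSup` would be the default
  -- value zero.
  obtain ⟨C, hC⟩ := hK.exists_bound_of_continuousOn (E := Eucl n →L[ℝ] Eucl n →L[ℝ] ℂ)
    ((continuousOn_fderiv_fderiv hU hf).mono hKU)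
  refine le_csSup ⟨C, ?_⟩ ⟨x, hx, i, j, by rw [iteratedFDeriv_two_apply]; rfl⟩
  rintro _ ⟨y, hy, i, j, rfl⟩
  rw [iteratedFDeriv_two_apply]
  refine (ContinuousLinearMap.le_opNorm₂ _ _ _).trans ?_
  simpa using hC y hy

/-- The seminorm controls single entries of the Hessian, so the quadratic form is at most `(∑
|v_i|)²` times it; Cauchy–Schwarz then costs the factor `n`. -/
theorem norm_fderiv_fderiv_le (hU : IsOpen U) (hf : ContDiffOn ℝ ∞ f U) (hK : IsCompact K)
    (hKU : K ⊆ U) {x : Eucl n} (hx : x ∈ K) (v : Eucl n) :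
    ‖fderiv ℝ (fderiv ℝ f) x v v‖ ≤ n * seminorm2 f K * ‖v‖ ^ 2 := by
  have hv : v = ∑ i, v i • (EuclideanSpace.single i (1 : ℝ) : Eucl n) := by
    have := (EuclideanSpace.basisFun (Fin n) ℝ).sum_repr v
    simpa using this.symm
  set D := fderiv ℝ (fderiv ℝ f) x
  have e : D v v = ∑ i, ∑ j, (v i * v j) •
      D (EuclideanSpace.single i 1) (EuclideanSpace.single j 1) := by
    conv_lhs => rw [hv]
    simp only [map_sum, map_smul, sum_apply, smul_apply,
      Finset.smul_sum, smul_smul]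
    exact Finset.sum_comm.trans (by simp only [mul_comm])
  have hs := seminorm2_nonneg f K
  calc ‖D v v‖ ≤ ∑ i, ∑ j, |v i| * |v j| * seminorm2 f K := by
        rw [e]
        refine (norm_sum_le _ _).trans (Finset.sum_le_sum fun i _ => ?_)
        refine (norm_sum_le _ _).trans (Finset.sum_le_sum fun j _ => ?_)
        rw [norm_smul, Real.norm_eq_abs, abs_mul]
        gcongr
        exact norm_fderiv_fderiv_single_le hU hf hK hKU hx i j
    _ = (∑ i, |v i|) ^ 2 * seminorm2 f K := by
        rw [sq, Finset.sum_mul_sum, Finset.sum_mul]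
        simp_rw [Finset.sum_mul]
    _ ≤ (n * ∑ i, |v i| ^ 2) * seminorm2 f K := by
        gcongr
        simpa using sq_sum_le_card_mul_sum_sq (s := Finset.univ) (f := fun i => |v i|)
    _ = _ := by
        rw [EuclideanSpace.norm_sq_eq]
        simp only [Real.norm_eq_abs]; ring

theorem norm_taylor_le (hU : IsOpen U) (hf : ContDiffOn ℝ ∞ f U) (hK : IsCompact K)
    (hKc : Convex ℝ K) (hKU : K ⊆ U) {x y : Eucl n} (hx : x ∈ K) (hy : y ∈ K) :
    ‖f y - f x - fderiv ℝ f x (y - x)‖ ≤ n * seminorm2 f K / 2 * ‖y - x‖ ^ 2 := by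
  have hseg : ∀ t ∈ Icc (0 : ℝ) 1, x + t • (y - x) ∈ K := fun t ht =>
    hKc.add_smul_sub_mem hx hy ht
  have hline : ∀ t : ℝ, HasDerivAt (fun t : ℝ => x + t • (y - x)) (y - x) t := fun t => by
    simpa using! ((hasDerivAt_id t).smul_const (y - x)).const_add x
  have h := norm_sub_sub_le_of_hasDerivAt (g := fun t : ℝ => f (x + t • (y - x)))
    (g₁ := fun t => fderiv ℝ f (x + t • (y - x)) (y - x))
    (g₂ := fun t => fderiv ℝ (fderiv ℝ f) (x + t • (y - x)) (y - x) (y - x))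
    (fun t ht => (hasFDerivAt_fderiv_of_contDiffOn hU hf (hKU (hseg t ht))).1.comp_hasDerivAt t
      (hline t))
    (fun t ht => by
      have := (hasFDerivAt_fderiv_of_contDiffOn hU hf (hKU (hseg t ht))).2.comp_hasDerivAt t
        (hline t)
      exact (ContinuousLinearMap.apply ℝ ℂ (y - x)).hasFDerivAt.comp_hasDerivAt t this)
    fun t ht => norm_fderiv_fderiv_le hU hf hK hKU (hseg t ht) (y - x)
  simp only [one_smul, add_sub_cancel, zero_smul, add_zero] at h
  exact h.trans_eq (by ring)

end Seminorm

/-! ### Quadrature errors of the moments and of the functional -/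

namespace IFS

variable {n M : ℕ} {S : IFS n M} {Γ : Set (Eucl n)} {d : ℝ}

theorem IsAttractor.isCompact_convexHull (hΓ : S.IsAttractor Γ) :
    IsCompact (convexHull ℝ Γ) := hΓ.2.1.isCompact_convexHull_of_finiteDimensional

theorem IsAttractor.isCompact_convexHull_cell (hΓ : S.IsAttractor Γ) (w : List (Fin M)) :
    IsCompact (convexHull ℝ (S.cell Γ w)) :=
  (hΓ.isCompact_cell w).isCompact_convexHull_of_finiteDimensional

theorem IsAttractor.isFiniteMeasure_restrict (hΓ : S.IsAttractor Γ) (hd : 0 ≤ d)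
    (hsum : ∑ m, S.ratio m ^ d = 1) (w : List (Fin M)) :
    IsFiniteMeasure ((hausM n d).restrict (S.cell Γ w)) :=
  ⟨by simpa using hΓ.hausM_cell_lt_top hd hsum w⟩

theorem IsAttractor.ae_mem_cell (hΓ : S.IsAttractor Γ) (w : List (Fin M)) :
    ∀ᵐ x ∂(hausM n d).restrict (S.cell Γ w), x ∈ S.cell Γ w :=
  ae_restrict_mem (hΓ.measurableSet_cell w)

/-- The weight must be nonzero because the average over a null set is the default value `0`, which
need not lie in the hull. Null components are treated separately throughout. -/
theorem IsAttractor.bary_mem (hΓ : S.IsAttractor Γ) (hd : 0 ≤ d)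
    (hsum : ∑ m, S.ratio m ^ d = 1) (w : List (Fin M)) (hw : S.wt Γ d w ≠ 0) :
    S.bary Γ d w ∈ convexHull ℝ (S.cell Γ w) := by
  have := hΓ.isFiniteMeasure_restrict hd hsum w
  refine (convex_convexHull ℝ _).set_average_mem (hΓ.isCompact_convexHull_cell w).isClosed
    ?_ (hΓ.hausM_cell_lt_top hd hsum w).ne ?_ ?_
  · intro h0; exact hw (by simp [wt, measureReal_def, h0])
  · filter_upwards [hΓ.ae_mem_cell w] with x hx using subset_convexHull ℝ _ hx
  · exact continuous_id.integrable_of_ae_mem_compact (hΓ.isCompact_cell w) (hΓ.ae_mem_cell w)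

theorem setIntegral_eq_zero_of_wt_eq_zero (hΓ : S.IsAttractor Γ) (hd : 0 ≤ d)
    (hsum : ∑ m, S.ratio m ^ d = 1) {w : List (Fin M)} (hw : S.wt Γ d w = 0)
    {F : Type*} [NormedAddCommGroup F] [NormedSpace ℝ F] (f : Eucl n → F) :
    ∫ x in S.cell Γ w, f x ∂(hausM n d) = 0 := by
  rw [wt, measureReal_eq_zero_iff (hΓ.hausM_cell_lt_top hd hsum w).ne] at hw
  rw [Measure.restrict_eq_zero.2 hw, integral_zero_measure]

/-- The constant `n / 4` is `n / 2` from the Taylor remainder times one half from the second moment.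
-/
theorem norm_setIntegral_sub_le (hΓ : S.IsAttractor Γ) (hd : 0 ≤ d)
    (hsum : ∑ m, S.ratio m ^ d = 1) {f : Eucl n → ℂ} {U : Set (Eucl n)} (hU : IsOpen U)
    (hΓU : convexHull ℝ Γ ⊆ U) (hf : ContDiffOn ℝ ∞ f U) (w : List (Fin M)) :
    ‖(∫ x in S.cell Γ w, f x ∂(hausM n d)) - (S.wt Γ d w : ℂ) * f (S.bary Γ d w)‖ ≤
      n / 4 * Metric.diam (S.cell Γ w) ^ 2 * seminorm2 f (convexHull ℝ Γ) * S.wt Γ d w := by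
  by_cases hw : S.wt Γ d w = 0
  · rw [setIntegral_eq_zero_of_wt_eq_zero hΓ hd hsum hw, hw]; simp
  have := hΓ.isFiniteMeasure_restrict hd hsum w
  have hmem := hΓ.ae_mem_cell (d := d) w
  have hcomp := hΓ.isCompact_cell w
  have hull : convexHull ℝ (S.cell Γ w) ⊆ convexHull ℝ Γ := convexHull_mono (hΓ.cell_subset w)
  have hfi : Integrable f ((hausM n d).restrict (S.cell Γ w)) := by
    have hc : ContinuousOn f (S.cell Γ w) := hf.continuousOn.mono
      (((subset_convexHull ℝ _).trans hull).trans hΓU)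
    have := hc.integrableOn_compact (μ := (hausM n d).restrict (S.cell Γ w)) hcomp
    rwa [IntegrableOn, Measure.restrict_eq_self_of_ae_mem hmem] at this
  have h := norm_integral_sub_mul_le (ρ := (hausM n d).restrict (S.cell Γ w))
    (X := fun x => x) (z₀ := S.bary Γ d w) (G := f)
    (B := fun x => n * seminorm2 f (convexHull ℝ Γ) / 2 * ‖x - S.bary Γ d w‖ ^ 2)
    ((by fun_prop : Continuous fun x : Eucl n => x - S.bary Γ d w).integrable_of_ae_mem_compact
      hcomp hmem)
    (integral_sub_average _ _) hfi (f (S.bary Γ d w)) (fderiv ℝ f (S.bary Γ d w))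
    (Continuous.integrable_of_ae_mem_compact (by fun_prop) hcomp hmem)
    (by
      filter_upwards [hmem] with x hx
      exact norm_taylor_le hU hf hΓ.isCompact_convexHull (convex_convexHull ℝ Γ) hΓU
        (hull (hΓ.bary_mem hd hsum w hw)) (hull (subset_convexHull ℝ _ hx)))
  have hV := integral_norm_sub_average_sq_le hcomp hmem
  rw [integral_const_mul] at h
  have e : ((hausM n d).restrict (S.cell Γ w)).real univ = S.wt Γ d w := by
    simp [wt]
  rw [e] at h hV
  refine h.trans ?_
  have hs := seminorm2_nonneg f (convexHull ℝ Γ)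
  calc _ ≤ n * seminorm2 f (convexHull ℝ Γ) / 2 *
        (S.wt Γ d w * Metric.diam (S.cell Γ w) ^ 2 / 2) := by gcongr; exact hV
    _ = _ := by ring

theorem IsAttractor.setIntegral_cell_eq_sum (hΓ : S.IsAttractor Γ) (hd : 0 ≤ d)
    (hsum : ∑ m, S.ratio m ^ d = 1) {f : Eucl n → ℂ} (hf : IntegrableOn f Γ (hausM n d))
    (w : List (Fin M)) : ∫ x in S.cell Γ w, f x ∂(hausM n d) =
      ∑ m, ∫ x in S.cell Γ (w ++ [m]), f x ∂(hausM n d) := by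
  rw [hΓ.cell_eq_iUnion, integral_iUnion_ae (fun m => (hΓ.measurableSet_cell _).nullMeasurableSet)
    (hΓ.aedisjoint_cell hd hsum w), tsum_fintype]
  exact hf.mono_set (iUnion_subset fun m => hΓ.cell_subset _)

theorem norm_moment_sub_momentQ_le (hn : n ≤ 4) (hΓ : S.IsAttractor Γ) (hd : 0 ≤ d)
    (hsum : ∑ m, S.ratio m ^ d = 1) {f : Eucl n → ℂ} {U : Set (Eucl n)} (hU : IsOpen U)
    (hΓU : convexHull ℝ Γ ⊆ U) (hf : ContDiffOn ℝ ∞ f U) {hQ : ℝ} (hQ0 : 0 < hQ) {N : ℕ}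
    (idx : Fin N → List (Fin M)) (i : Fin N) :
    ‖S.moment Γ d idx f i - S.momentQ Γ d hQ idx f i‖ ≤
      hQ ^ 2 * seminorm2 f (convexHull ℝ Γ) * √(S.wt Γ d (idx i)) := by
  set w := idx i
  have hs := seminorm2_nonneg f (convexHull ℝ Γ)
  have hfin := S.finite_subIndex hΓ.2.1 w hQ0
  have hfi : IntegrableOn f Γ (hausM n d) := by
    have hm := hΓ.ae_mem_cell (d := d) []
    have := hΓ.isFiniteMeasure_restrict hd hsum []
    rw [cell_nil] at hm this
    have hc : ContinuousOn f Γ := hf.continuousOn.mono ((subset_convexHull ℝ _).trans hΓU)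
    have := hc.integrableOn_compact (μ := (hausM n d).restrict Γ) hΓ.2.1
    rwa [IntegrableOn, Measure.restrict_eq_self_of_ae_mem hm] at this
  have key : ‖(∫ x in S.cell Γ w, f x ∂(hausM n d)) - S.quad1 Γ d hQ w f‖ ≤
      hQ ^ 2 * seminorm2 f (convexHull ℝ Γ) * S.wt Γ d w := by
    rw [hΓ.eq_finsum_subIndex (hΓ.setIntegral_cell_eq_sum hd hsum hfi) hQ0 w, quad1,
      finsum_mem_eq_finite_toFinset_sum _ hfin, finsum_mem_eq_finite_toFinset_sum _ hfin,
      ← Finset.sum_sub_distrib, hΓ.eq_finsum_subIndex (wt_eq_sum hd hsum) hQ0 w,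
      finsum_mem_eq_finite_toFinset_sum _ hfin, Finset.mul_sum]
    refine (norm_sum_le _ _).trans (Finset.sum_le_sum fun p hp => ?_)
    have hp' : Metric.diam (S.cell Γ p) ≤ hQ := (hfin.mem_toFinset.1 hp).2.1
    refine (norm_setIntegral_sub_le hΓ hd hsum hU hΓU hf p).trans ?_
    have hw := S.wt_nonneg (Γ := Γ) (d := d) p
    have hd0 := Metric.diam_nonneg (s := S.cell Γ p)
    have hn' : (n : ℝ) / 4 ≤ 1 := by
      have : (n : ℝ) ≤ 4 := by exact_mod_cast hn
      linarith
    calc _ ≤ 1 * hQ ^ 2 * seminorm2 f (convexHull ℝ Γ) * S.wt Γ d p := by gcongr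
      _ = _ := by ring
  rw [moment, momentQ, ← mul_sub, norm_mul, Complex.norm_real,
    Real.norm_of_nonneg (inv_nonneg.2 (Real.sqrt_nonneg _))]
  have hw := S.wt_nonneg (Γ := Γ) (d := d) w
  calc _ ≤ (√(S.wt Γ d w))⁻¹ * (hQ ^ 2 * seminorm2 f (convexHull ℝ Γ) * S.wt Γ d w) := by
        gcongr
    _ = hQ ^ 2 * seminorm2 f (convexHull ℝ Γ) * (S.wt Γ d w / √(S.wt Γ d w)) := by ring
    -- With the convention `0 / 0 = 0` this identity also covers elements of zero weight.
    _ = _ := by rw [Real.div_sqrt]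

theorem IsMesh.sum_eq (hΓ : S.IsAttractor Γ) {h : ℝ} (hh : 0 < h) {N : ℕ}
    {idx : Fin N → List (Fin M)} (hidx : S.IsMesh Γ h idx) {E : Type*} [AddCommMonoid E]
    {F : List (Fin M) → E} (hF : ∀ w, F w = ∑ m, F (w ++ [m])) : ∑ i, F (idx i) = F [] := by
  rw [hΓ.eq_finsum_subIndex hF hh [], ← meshIndex, ← hidx.2, finsum_mem_range hidx.1,
    finsum_eq_sum_of_fintype]

theorem IsMesh.sum_wt (hΓ : S.IsAttractor Γ) (hd : 0 ≤ d)
    (hsum : ∑ m, S.ratio m ^ d = 1) {h : ℝ} (hh : 0 < h) {N : ℕ}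
    {idx : Fin N → List (Fin M)} (hidx : S.IsMesh Γ h idx) :
    ∑ i, S.wt Γ d (idx i) = (hausM n d).real Γ := by
  rw [hidx.sum_eq hΓ hh (wt_eq_sum hd hsum), wt, cell_nil]

/-- Each squared entry error is at most a common constant times the measure of the element, and
these measures add up to that of `Γ`. -/
theorem norm_moment_sub_momentQ_vec_le (hn : n ≤ 4) (hΓ : S.IsAttractor Γ) (hd : 0 ≤ d)
    (hsum : ∑ m, S.ratio m ^ d = 1) {f : Eucl n → ℂ} {U : Set (Eucl n)} (hU : IsOpen U)
    (hΓU : convexHull ℝ Γ ⊆ U) (hf : ContDiffOn ℝ ∞ f U) {h hQ : ℝ} (hQ0 : 0 < hQ) (hQh : hQ ≤ h)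
    {N : ℕ} {idx : Fin N → List (Fin M)} (hidx : S.IsMesh Γ h idx) :
    ‖WithLp.toLp 2 (S.moment Γ d idx f - S.momentQ Γ d hQ idx f)‖ ≤
      hQ ^ 2 * seminorm2 f (convexHull ℝ Γ) * √((hausM n d).real Γ) := by
  have hs := seminorm2_nonneg f (convexHull ℝ Γ)
  rw [EuclideanSpace.norm_eq]
  have : √((hausM n d).real Γ) ^ 2 = (hausM n d).real Γ := Real.sq_sqrt measureReal_nonneg
  refine Real.sqrt_le_iff.2 ⟨by positivity, ?_⟩
  rw [mul_pow, this, ← hidx.sum_wt hΓ hd hsum (hQ0.trans_le hQh), Finset.mul_sum]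
  refine Finset.sum_le_sum fun i _ => ?_
  have h1 := norm_moment_sub_momentQ_le hn hΓ hd hsum hU hΓU hf hQ0 idx i
  calc _ ≤ (hQ ^ 2 * seminorm2 f (convexHull ℝ Γ) * √(S.wt Γ d (idx i))) ^ 2 := by
        gcongr; exact h1
    _ = _ := by rw [mul_pow, Real.sq_sqrt (wt_nonneg _)]

/-- The quadrature error in the right-hand side. -/
theorem norm_rhs_sub_rhsQ_le (hn : n ≤ 4) (hΓ : S.IsAttractor Γ) (hd : 0 ≤ d)
    (hsum : ∑ m, S.ratio m ^ d = 1) {f : Eucl n → ℂ} {U : Set (Eucl n)} (hU : IsOpen U)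
    (hΓU : convexHull ℝ Γ ⊆ U) (hf : ContDiffOn ℝ ∞ f U) {h hQ : ℝ} (hQ0 : 0 < hQ) (hQh : hQ ≤ h)
    {N : ℕ} {idx : Fin N → List (Fin M)} (hidx : S.IsMesh Γ h idx) :
    ‖WithLp.toLp 2 (S.rhs Γ d idx f - S.rhsQ Γ d hQ idx f)‖ ≤
      hQ ^ 2 * seminorm2 f (convexHull ℝ Γ) * √((hausM n d).real Γ) := by
  have : S.rhs Γ d idx f - S.rhsQ Γ d hQ idx f =
      -(S.moment Γ d idx f - S.momentQ Γ d hQ idx f) := by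
    ext i; simp [rhs, rhsQ]; ring
  rw [this, WithLp.toLp_neg, norm_neg]
  exact norm_moment_sub_momentQ_vec_le hn hΓ hd hsum hU hΓU hf hQ0 hQh hidx

/-- The functional `J` is independent of the values of its argument off `Γ`. -/
theorem functionalJ_eq {f : Eucl n → ℂ} {ψ : Hneg1 n} (hψ : IsTraceAdjoint Γ d f ψ)
    (w : H1 n) : functionalJ Γ w ψ = ψ w := by
  -- Test functions supported off `Γ` integrate to zero over `Γ`; continuity of `ψ` extends this to
  -- the closure. The part of `w` removed by `P` lies in that closure.
  have hker : tildeH1 Γᶜ ≤ LinearMap.ker (ψ : H1 n →ₗ[ℂ] ℂ) := by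
    refine Submodule.topologicalClosure_minimal _ (Submodule.span_le.2 ?_) ψ.isClosed_ker
    rintro _ ⟨φ, hφ, hsupp, rfl⟩
    change ψ (H1.ofSchwartz φ) = 0
    rw [hψ φ hφ]
    refine setIntegral_eq_zero_of_forall_eq_zero fun x hx => ?_
    have : φ x = 0 := by
      by_contra h0
      exact hsupp (subset_tsupport _ h0) hx
    rw [this, zero_mul]
  have h1 : w - projP Γ w ∈ tildeH1 Γᶜ := by
    rw [projP, Submodule.starProjection_orthogonal']
    simp
  have h2 : ψ (w - projP Γ w) = 0 := hker h1
  rw [map_sub, sub_eq_zero] at h2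
  exact h2.symm

/-- The quadrature error in the functional `J`. -/
theorem norm_functionalJ_sub_le (hn : n ≤ 4) (hΓ : S.IsAttractor Γ) (hd : 0 ≤ d)
    (hsum : ∑ m, S.ratio m ^ d = 1) {v : Eucl n → ℂ} {U : Set (Eucl n)} (hU : IsOpen U)
    (hΓU : convexHull ℝ Γ ⊆ U) (hv : ContDiffOn ℝ ∞ v U) {σ : Eucl n → ℂ} {w : 𝓢(Eucl n, ℂ)}
    (hσ : IsCutoff Γ σ) (hw : ∀ x, w x = σ x * v x) {h hQ : ℝ} (hQ0 : 0 < hQ) (hQh : hQ ≤ h)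
    {N : ℕ} {idx : Fin N → List (Fin M)} (hidx : S.IsMesh Γ h idx) {ψ : Hneg1 n} {c : Fin N → ℂ}
    (hψ : IsTraceAdjoint Γ d (fun x => ∑ j, c j * S.chi Γ d (idx j) x) ψ) :
    ‖functionalJ Γ (H1.ofSchwartz w) ψ - ∑ j, c j * S.momentQ Γ d hQ idx v j‖ ≤
      hQ ^ 2 * seminorm2 v (convexHull ℝ Γ) * ‖WithLp.toLp 2 c‖ * √((hausM n d).real Γ) := by
  have hwc : HasCompactSupport w := by
    have : (w : Eucl n → ℂ) = fun x => σ x * v x := funext hw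
    rw [this]; exact hσ.2.1.mul_right
  have hwv : ∀ x ∈ Γ, w x = v x := fun x hx => by
    have h1 : σ x = 1 := (hσ.2.2.self_of_nhdsSet x hx)
    rw [hw, h1, one_mul]
  have hfi : ∀ j, IntegrableOn v (S.cell Γ (idx j)) (hausM n d) := fun j => by
    have hm := hΓ.ae_mem_cell (d := d) (idx j)
    have := hΓ.isFiniteMeasure_restrict hd hsum (idx j)
    have hc : ContinuousOn v (S.cell Γ (idx j)) := hv.continuousOn.mono
      ((hΓ.cell_subset _).trans ((subset_convexHull ℝ _).trans hΓU))
    have := hc.integrableOn_compact (μ := (hausM n d).restrict (S.cell Γ (idx j)))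
      (hΓ.isCompact_cell _)
    rwa [IntegrableOn, Measure.restrict_eq_self_of_ae_mem hm] at this
  have hchi : ∀ j x, v x * (c j * S.chi Γ d (idx j) x) = (S.cell Γ (idx j)).indicator
      (fun x => c j * (((√(S.wt Γ d (idx j)))⁻¹ : ℝ) * v x)) x := fun j x => by
    by_cases hx : x ∈ S.cell Γ (idx j) <;> simp [chi, hx]; ring
  -- The cutoff equals one on `Γ`, and each basis function confines the integral to its own element.
  have hJ : functionalJ Γ (H1.ofSchwartz w) ψ = ∑ j, c j * S.moment Γ d idx v j := by
    rw [functionalJ_eq hψ, hψ w hwc]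
    have : ∫ x in Γ, w x * ∑ j, c j * S.chi Γ d (idx j) x ∂(hausM n d) =
        ∫ x in Γ, ∑ j, (S.cell Γ (idx j)).indicator
          (fun x => c j * (((√(S.wt Γ d (idx j)))⁻¹ : ℝ) * v x)) x ∂(hausM n d) := by
      refine setIntegral_congr_fun hΓ.2.1.measurableSet fun x hx => ?_
      simp only [hwv x hx, Finset.mul_sum, hchi]
    rw [this, integral_finsetSum]
    · refine Finset.sum_congr rfl fun j _ => ?_
      rw [setIntegral_indicator (hΓ.measurableSet_cell _),
        inter_eq_self_of_subset_right (hΓ.cell_subset _), integral_const_mul, integral_const_mul,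
        moment]
    · intro j _
      refine (IntegrableOn.integrable_indicator ?_ (hΓ.measurableSet_cell _))
      rw [IntegrableOn, Measure.restrict_restrict (hΓ.measurableSet_cell _),
        inter_eq_self_of_subset_left (hΓ.cell_subset _)]
      exact ((hfi j).const_mul _).const_mul _
  rw [hJ, ← Finset.sum_sub_distrib]
  simp_rw [← mul_sub]
  have hcs : ‖∑ j, c j * (S.moment Γ d idx v j - S.momentQ Γ d hQ idx v j)‖ ≤
      ‖WithLp.toLp 2 c‖ * ‖WithLp.toLp 2 (S.moment Γ d idx v - S.momentQ Γ d hQ idx v)‖ := by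
    rw [EuclideanSpace.norm_eq, EuclideanSpace.norm_eq]
    refine (norm_sum_le _ _).trans ?_
    simp_rw [norm_mul]
    exact Real.sum_mul_le_sqrt_mul_sqrt _ _ _
  refine hcs.trans ?_
  have h1 := norm_moment_sub_momentQ_vec_le hn hΓ hd hsum hU hΓU hv hQ0 hQh hidx
  calc _ ≤ ‖WithLp.toLp 2 c‖ *
        (hQ ^ 2 * seminorm2 v (convexHull ℝ Γ) * √((hausM n d).real Γ)) := by gcongr
    _ = _ := by ring

end IFS

/-! ### Radial kernels and their growth at the origin -/

open Asymptotics in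
/-- `f` is twice differentiable on `(0, R]`, with `f' = O(u^(-q/2))` and `f'' = O(u^(-q/2-1))`: the
radial kernel `f (‖z‖ ^ 2)` then has second derivatives of size `O(‖z‖^(-q))`. -/
def RadialC2 (f : ℝ → ℂ) (q R : ℝ) : Prop :=
  ∃ f₁ f₂ : ℝ → ℂ, (∀ u ∈ Ioc 0 R, HasDerivAt f (f₁ u) u) ∧ (∀ u ∈ Ioc 0 R, HasDerivAt f₁ (f₂ u) u) ∧
    f₁ =O[𝓟 (Ioc 0 R)] (fun u => u ^ (-q / 2)) ∧ f₂ =O[𝓟 (Ioc 0 R)] (fun u => u ^ (-q / 2 - 1))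

section Asymptotics

open Asymptotics

theorem isBigO_rpow_rpow {R p q : ℝ} (hpq : p ≤ q) :
    (fun u : ℝ => u ^ q) =O[𝓟 (Ioc 0 R)] (fun u => u ^ p) := by
  refine isBigO_principal.2 ⟨R ^ (q - p), fun u hu => ?_⟩
  have h1 := Real.rpow_nonneg hu.1.le q
  have h2 := Real.rpow_nonneg hu.1.le p
  rw [Real.norm_of_nonneg h1, Real.norm_of_nonneg h2]
  calc u ^ q = u ^ (q - p) * u ^ p := by rw [← Real.rpow_add hu.1]; ring_nf
    _ ≤ _ := by
        refine mul_le_mul_of_nonneg_right ?_ h2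
        exact Real.rpow_le_rpow hu.1.le hu.2 (by linarith)

theorem isBigO_one_rpow {R p : ℝ} (hp : p ≤ 0) :
    (fun _ : ℝ => (1 : ℝ)) =O[𝓟 (Ioc 0 R)] (fun u => u ^ p) := by
  simpa using isBigO_rpow_rpow (R := R) hp

theorem Continuous.isBigO_one_Ioc {E : Type*} [NormedAddCommGroup E] {f : ℝ → E}
    (hf : Continuous f) (R : ℝ) : f =O[𝓟 (Ioc 0 R)] (fun _ => (1 : ℝ)) := by
  obtain ⟨C, hC⟩ := (isCompact_Icc (a := (0 : ℝ)) (b := R)).exists_bound_of_continuousOn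
    hf.continuousOn
  exact isBigO_principal.2 ⟨C, fun u hu => by simpa using hC u (Ioc_subset_Icc_self hu)⟩

theorem Continuous.isBigO_rpow_Ioc {E : Type*} [NormedAddCommGroup E] {f : ℝ → E}
    (hf : Continuous f) (R : ℝ) {p : ℝ} (hp : p ≤ 0) :
    f =O[𝓟 (Ioc 0 R)] (fun u => u ^ p) :=
  (hf.isBigO_one_Ioc R).trans (isBigO_one_rpow hp)

theorem ContDiff.sub_isBigO_id {E : Type*} [NormedAddCommGroup E] [NormedSpace ℝ E] {f : ℝ → E}
    (hf : ContDiff ℝ 2 f) (R : ℝ) :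
    (fun u => f u - f 0) =O[𝓟 (Ioc 0 R)] (fun u => u) := by
  obtain ⟨C, hC⟩ := (isCompact_Icc (a := (0 : ℝ)) (b := R)).exists_bound_of_continuousOn
    (hf.continuous_deriv (by simp)).continuousOn
  refine isBigO_principal.2 ⟨C, fun u hu => ?_⟩
  have h := norm_image_sub_le_of_norm_deriv_right_le_segment (f := f) (a := 0) (b := R)
    hf.continuous.continuousOn
    (fun x _ => (hf.differentiable (by simp) x).hasDerivAt.hasDerivWithinAt)
    (fun x hx => hC x (Ico_subset_Icc_self hx)) u (Ioc_subset_Icc_self hu)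
  simpa [abs_of_pos hu.1] using h

/-- The bound `log u ≤ u ^ ε / ε` with `ε = -p`, applied to `u` and to `u⁻¹`, controls both signs;
on a bounded interval the positive power is absorbed. -/
theorem isBigO_log_rpow {R p : ℝ} (hp : p < 0) :
    Real.log =O[𝓟 (Ioc 0 R)] (fun u => u ^ p) := by
  have h1 : (fun u : ℝ => u ^ (-p) + u ^ p) =O[𝓟 (Ioc 0 R)] (fun u => u ^ p) :=
    (isBigO_rpow_rpow (by linarith)).add (isBigO_refl _ _)
  refine IsBigO.trans (isBigO_principal.2 ⟨1 / (-p), fun u hu => ?_⟩) h1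
  have hp' : 0 < -p := by linarith
  have ha := Real.log_le_rpow_div hu.1.le hp'
  have hb := Real.log_le_rpow_div (inv_nonneg.2 hu.1.le) hp'
  rw [Real.log_inv, Real.inv_rpow hu.1.le, ← Real.rpow_neg hu.1.le, neg_neg] at hb
  have h2 := Real.rpow_pos_of_pos hu.1 (-p)
  have h3 := Real.rpow_pos_of_pos hu.1 p
  rw [Real.norm_eq_abs, Real.norm_of_nonneg (by positivity), one_div_mul_eq_div, add_div]
  have h4 := div_pos h2 hp'
  have h5 := div_pos h3 hp'
  rw [abs_le]
  constructor <;> linarith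

theorem isBigO_rpow_mul {E : Type*} [NormedRing E] {f g : ℝ → E} {R p q r : ℝ}
    (hf : f =O[𝓟 (Ioc 0 R)] (fun u => u ^ p)) (hg : g =O[𝓟 (Ioc 0 R)] (fun u => u ^ q))
    (hr : p + q = r) : (fun u => f u * g u) =O[𝓟 (Ioc 0 R)] (fun u => u ^ r) := by
  refine (hf.mul hg).congr' EventuallyEq.rfl ?_
  refine eventually_principal.2 fun u hu => ?_
  rw [← hr]; exact (Real.rpow_add hu.1 p q).symm

theorem isBigO_ofReal {f : ℝ → ℝ} {g : ℝ → ℝ} {l : Filter ℝ} (hf : f =O[l] g) :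
    (fun u => (f u : ℂ)) =O[l] g :=
  IsBigO.trans (.of_bound 1 (.of_forall fun u => by simp)) hf

theorem RadialC2.add {f g : ℝ → ℂ} {q R : ℝ} (hf : RadialC2 f q R) (hg : RadialC2 g q R) :
    RadialC2 (fun u => f u + g u) q R := by
  obtain ⟨f₁, f₂, h1, h2, h3, h4⟩ := hf
  obtain ⟨g₁, g₂, k1, k2, k3, k4⟩ := hg
  exact ⟨_, _, fun u hu => (h1 u hu).add (k1 u hu), fun u hu => (h2 u hu).add (k2 u hu),
    h3.add k3, h4.add k4⟩

theorem RadialC2.mono {f : ℝ → ℂ} {q q' R : ℝ} (hf : RadialC2 f q R) (hq : q ≤ q') :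
    RadialC2 f q' R := by
  obtain ⟨f₁, f₂, h1, h2, h3, h4⟩ := hf
  exact ⟨f₁, f₂, h1, h2, h3.trans (isBigO_rpow_rpow (by linarith)),
    h4.trans (isBigO_rpow_rpow (by linarith))⟩

theorem RadialC2.const_mul {f : ℝ → ℂ} {q R : ℝ} (hf : RadialC2 f q R) (c : ℂ) :
    RadialC2 (fun u => c * f u) q R := by
  obtain ⟨f₁, f₂, h1, h2, h3, h4⟩ := hf
  exact ⟨fun u => c * f₁ u, fun u => c * f₂ u, fun u hu => (h1 u hu).const_mul c,
    fun u hu => (h2 u hu).const_mul c, h3.const_mul_left c, h4.const_mul_left c⟩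

theorem radialC2_rpow (R p : ℝ) : RadialC2 (fun u => ((u ^ (-p / 2) : ℝ) : ℂ)) (p + 2) R := by
  have h : ∀ (c : ℝ), ∀ u ∈ Ioc 0 R, HasDerivAt (fun u : ℝ => ((u ^ c : ℝ) : ℂ))
      ((c * u ^ (c - 1) : ℝ) : ℂ) u :=
    fun c u hu => (Real.hasDerivAt_rpow_const (Or.inl hu.1.ne')).ofReal_comp
  refine ⟨fun u => ((-p / 2 : ℝ) : ℂ) * ((u ^ (-p / 2 - 1) : ℝ) : ℂ),
    fun u => ((-p / 2 : ℝ) : ℂ) * (((-p / 2 - 1) * u ^ (-p / 2 - 1 - 1) : ℝ) : ℂ),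
    fun u hu => ?_, fun u hu => ?_, ?_, ?_⟩
  · simpa using h (-p / 2) u hu
  · exact (h (-p / 2 - 1) u hu).const_mul _
  · refine (isBigO_ofReal ?_).const_mul_left _
    refine (isBigO_refl _ _).congr_right fun u => ?_
    congr 1; ring
  · refine (isBigO_ofReal (IsBigO.const_mul_left ?_ _)).const_mul_left _
    refine (isBigO_refl _ _).congr_right fun u => ?_
    congr 1; ring

theorem radialC2_log (R : ℝ) : RadialC2 (fun u => ((Real.log u : ℝ) : ℂ)) 2 R := by
  refine ⟨fun u => ((u⁻¹ : ℝ) : ℂ), fun u => ((-(u ^ 2)⁻¹ : ℝ) : ℂ),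
    fun u hu => (Real.hasDerivAt_log hu.1.ne').ofReal_comp,
    fun u hu => (hasDerivAt_inv hu.1.ne').ofReal_comp, isBigO_ofReal ?_, isBigO_ofReal ?_⟩
  · refine (isBigO_refl _ _).congr_right fun u => ?_
    norm_num [Real.rpow_neg_one]
  · refine (isBigO_refl _ _).neg_left.congr' EventuallyEq.rfl
      (eventually_principal.2 fun u hu => ?_)
    change (u ^ 2)⁻¹ = u ^ (-2 / 2 - 1 : ℝ)
    norm_num [Real.rpow_neg hu.1.le]

/-- Kernels of the form `a(u) + b(u) log u` with `a`, `b` smooth, `b(0) = 0`. -/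
theorem radialC2_add_log_mul {a b : ℝ → ℂ} (ha : ContDiff ℝ 2 a) (hb : ContDiff ℝ 2 b)
    (hb0 : b 0 = 0) {s : ℝ} (hs : 0 < s) (R : ℝ) :
    RadialC2 (fun u => a u + (Real.log u : ℂ) * b u) s R ∧
      (fun u => a u + (Real.log u : ℂ) * b u - (a 0 + (Real.log 0 : ℂ) * b 0))
        =O[𝓟 (Ioc 0 R)] (fun u => u ^ (1 - s / 2)) := by
  have h1 : ∀ {f : ℝ → ℂ}, ContDiff ℝ 2 f → ∀ u, HasDerivAt f (deriv f u) u :=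
    fun hf u => (hf.differentiable (by simp) u).hasDerivAt
  have hd : ∀ {f : ℝ → ℂ}, ContDiff ℝ 2 f → ContDiff ℝ 1 (deriv f) := fun hf =>
    (contDiff_succ_iff_deriv (n := 1).1 (by simpa using! hf)).2.2
  have h2 : ∀ {f : ℝ → ℂ}, ContDiff ℝ 2 f → ∀ u, HasDerivAt (deriv f) (deriv (deriv f) u) u :=
    fun hf u => ((hd hf).differentiable (by simp) u).hasDerivAt
  have hc1 : ∀ {f : ℝ → ℂ}, ContDiff ℝ 2 f → Continuous (deriv f) := fun hf => (hd hf).continuous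
  have hc2 : ∀ {f : ℝ → ℂ}, ContDiff ℝ 2 f → Continuous (deriv (deriv f)) := fun hf =>
    (hd hf).continuous_deriv (by simp)
  -- The zero of `b` gains one power: `b / u` is bounded and `b / u²` is `O(u⁻¹)`, so the only loss
  -- is logarithmic, which `s > 0` absorbs.
  have hbu : b =O[𝓟 (Ioc 0 R)] (fun u => u ^ (1 : ℝ)) := by
    simpa [hb0] using hb.sub_isBigO_id R
  have hlog : (fun u => (Real.log u : ℂ)) =O[𝓟 (Ioc 0 R)] (fun u => u ^ (-s / 2)) :=
    isBigO_ofReal (isBigO_log_rpow (by linarith))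
  have hinv : (fun u : ℝ => ((u⁻¹ : ℝ) : ℂ)) =O[𝓟 (Ioc 0 R)] (fun u => u ^ (-1 : ℝ)) :=
    isBigO_ofReal ((isBigO_refl _ _).congr_right fun u => (Real.rpow_neg_one u).symm)
  have hinv2 : (fun u : ℝ => ((-(u ^ 2)⁻¹ : ℝ) : ℂ)) =O[𝓟 (Ioc 0 R)] (fun u => u ^ (-2 : ℝ)) := by
    refine isBigO_ofReal ((isBigO_refl _ _).neg_left.congr' EventuallyEq.rfl
      (eventually_principal.2 fun u hu => ?_))
    change (u ^ 2)⁻¹ = u ^ (-2 : ℝ)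
    rw [Real.rpow_neg hu.1.le]; norm_num
  refine ⟨⟨fun u => deriv a u + (((u⁻¹ : ℝ) : ℂ) * b u + (Real.log u : ℂ) * deriv b u),
    fun u => deriv (deriv a) u + ((((-(u ^ 2)⁻¹ : ℝ) : ℂ) * b u + ((u⁻¹ : ℝ) : ℂ) * deriv b u) +
      (((u⁻¹ : ℝ) : ℂ) * deriv b u + (Real.log u : ℂ) * deriv (deriv b) u)),
    fun u hu => (h1 ha u).add
      (((Real.hasDerivAt_log hu.1.ne').ofReal_comp).mul (h1 hb u)),
    fun u hu => (h2 ha u).add ((((hasDerivAt_inv hu.1.ne').ofReal_comp).mul (h1 hb u)).add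
      (((Real.hasDerivAt_log hu.1.ne').ofReal_comp).mul (h2 hb u))), ?_, ?_⟩, ?_⟩
  · refine ((hc1 ha).isBigO_rpow_Ioc R (by linarith)).add (IsBigO.add ?_ ?_)
    · exact (isBigO_rpow_mul hinv hbu rfl).trans (isBigO_rpow_rpow (by linarith))
    · exact isBigO_rpow_mul hlog ((hc1 hb).isBigO_rpow_Ioc R le_rfl) (by ring)
  · refine ((hc2 ha).isBigO_rpow_Ioc R (by linarith)).add (IsBigO.add (IsBigO.add ?_ ?_)
      (IsBigO.add ?_ ?_))
    · exact (isBigO_rpow_mul hinv2 hbu rfl).trans (isBigO_rpow_rpow (by linarith))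
    · exact (isBigO_rpow_mul hinv ((hc1 hb).isBigO_rpow_Ioc R le_rfl) rfl).trans
        (isBigO_rpow_rpow (by linarith))
    · exact (isBigO_rpow_mul hinv ((hc1 hb).isBigO_rpow_Ioc R le_rfl) rfl).trans
        (isBigO_rpow_rpow (by linarith))
    · exact (isBigO_rpow_mul hlog ((hc2 hb).isBigO_rpow_Ioc R le_rfl) rfl).trans
        (isBigO_rpow_rpow (by linarith))
  · have e : (fun u => a u + (Real.log u : ℂ) * b u - (a 0 + (Real.log 0 : ℂ) * b 0)) =
        fun u => (a u - a 0) + (Real.log u : ℂ) * b u := by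
      ext u; rw [hb0]; ring
    rw [e]
    refine IsBigO.add ?_ (isBigO_rpow_mul hlog hbu (by ring))
    have : (fun u => a u - a 0) =O[𝓟 (Ioc 0 R)] (fun u => u ^ (1 : ℝ)) := by
      simpa using ha.sub_isBigO_id R
    exact this.trans (isBigO_rpow_rpow (by linarith))

/-- Kernels of the form `g(√u)` with `g` smooth. -/
theorem radialC2_comp_sqrt {g : ℝ → ℂ} (hg : ContDiff ℝ 2 g) (R : ℝ) :
    RadialC2 (fun u => g (u ^ (1 / 2 : ℝ))) 1 R ∧
      (fun u : ℝ => g (u ^ (1 / 2 : ℝ)) - g ((0 : ℝ) ^ (1 / 2 : ℝ)))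
        =O[𝓟 (Ioc 0 R)] (fun u => u ^ (1 - (1 : ℝ) / 2)) := by
  have hd : ContDiff ℝ 1 (deriv g) :=
    (contDiff_succ_iff_deriv (n := 1).1 (by simpa using! hg)).2.2
  have hsq : Continuous fun u : ℝ => u ^ (1 / 2 : ℝ) := Real.continuous_rpow_const (by norm_num)
  have h1 : ∀ (c : ℝ), ∀ u ∈ Ioc 0 R, HasDerivAt (fun u : ℝ => u ^ c) (c * u ^ (c - 1)) u :=
    fun c u hu => Real.hasDerivAt_rpow_const (Or.inl hu.1.ne')
  have hO : ∀ c p : ℝ, ∀ q, p = q → (fun u : ℝ => ((c * u ^ p : ℝ) : ℂ)) =O[𝓟 (Ioc 0 R)]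
      (fun u => u ^ q) := fun c p q h => by
    subst h; exact isBigO_ofReal ((isBigO_refl _ _).const_mul_left c)
  refine ⟨⟨fun u => ((1 / 2 * u ^ (1 / 2 - 1 : ℝ) : ℝ) : ℂ) * deriv g (u ^ (1 / 2 : ℝ)),
    fun u => ((1 / 2 * ((1 / 2 - 1) * u ^ (1 / 2 - 1 - 1 : ℝ)) : ℝ) : ℂ) *
        deriv g (u ^ (1 / 2 : ℝ)) +
      ((1 / 2 * u ^ (1 / 2 - 1 : ℝ) : ℝ) : ℂ) *
        (((1 / 2 * u ^ (1 / 2 - 1 : ℝ) : ℝ) : ℂ) * deriv (deriv g) (u ^ (1 / 2 : ℝ))),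
    fun u hu => ?_, fun u hu => ?_, ?_, ?_⟩, ?_⟩
  · have := (hg.differentiable (by simp) (u ^ (1 / 2 : ℝ))).hasDerivAt.scomp u
      (h1 (1 / 2) u hu)
    simpa only [Complex.real_smul] using! this
  · have := (hd.differentiable (by simp) (u ^ (1 / 2 : ℝ))).hasDerivAt.scomp u
      (h1 (1 / 2) u hu)
    have := (((h1 (1 / 2 - 1) u hu).const_mul (1 / 2)).ofReal_comp).mul this
    simpa only [Complex.real_smul] using! this
  · exact isBigO_rpow_mul (hO _ _ _ rfl)
      ((hd.continuous.comp hsq).isBigO_rpow_Ioc R le_rfl) (by norm_num)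
  · refine IsBigO.add ?_ ?_
    · simp_rw [← mul_assoc]
      exact isBigO_rpow_mul (hO _ _ _ rfl)
        ((hd.continuous.comp hsq).isBigO_rpow_Ioc R le_rfl) (by norm_num)
    · refine (isBigO_rpow_mul (hO _ _ _ rfl) (isBigO_rpow_mul (hO _ _ _ rfl)
        (((hd.continuous_deriv (by simp)).comp hsq).isBigO_rpow_Ioc R le_rfl) rfl) rfl).trans
        (isBigO_rpow_rpow (by norm_num))
  · obtain ⟨C, hC⟩ := isBigO_principal.1 (hg.sub_isBigO_id (R ^ (1 / 2 : ℝ)))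
    refine isBigO_principal.2 ⟨C, fun u hu => ?_⟩
    have := hC (u ^ (1 / 2 : ℝ)) ⟨Real.rpow_pos_of_pos hu.1 _,
      Real.rpow_le_rpow hu.1.le hu.2 (by norm_num)⟩
    norm_num at this ⊢
    exact this

end Asymptotics

/-- Second order Taylor estimate for the radial kernel `f (‖z‖ ^ 2)` away from the origin. -/
theorem RadialC2.exists_taylor {f : ℝ → ℂ} {q D : ℝ} (hf : RadialC2 f q (D ^ 2)) (hq : 0 ≤ q) :
    ∃ C, 0 ≤ C ∧ ∀ {E : Type} [NormedAddCommGroup E] [InnerProductSpace ℝ E] (Z : Set E),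
      Convex ℝ Z → ∀ δ, 0 < δ → (∀ z ∈ Z, δ ≤ ‖z‖ ∧ ‖z‖ ≤ D) → ∀ z₀ ∈ Z,
      ∃ L : E →L[ℝ] ℂ, ∀ z ∈ Z,
        ‖f (‖z‖ ^ 2) - f (‖z₀‖ ^ 2) - L (z - z₀)‖ ≤ C * δ ^ (-q) * ‖z - z₀‖ ^ 2 := by
  obtain ⟨f₁, f₂, h1, h2, h3, h4⟩ := hf
  obtain ⟨C₁, hC₁⟩ := Asymptotics.isBigO_principal.1 h3
  obtain ⟨C₂, hC₂⟩ := Asymptotics.isBigO_principal.1 h4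
  -- Half of `4 |C₂| + 2 |C₁|`, which bounds the second derivative in `t` of `f (‖z₀ + t v‖²)` up to
  -- the factor `δ ^ (-q) ‖v‖²`.
  refine ⟨2 * |C₂| + |C₁|, by positivity, ?_⟩
  intro E _ _ Z hZ δ hδ hZδ z₀ hz₀
  -- The differential of `z ↦ f (‖z‖²)` at `z₀`.
  refine ⟨(ContinuousLinearMap.toSpanSingleton ℝ (2 * f₁ (‖z₀‖ ^ 2))).comp (innerSL ℝ z₀), ?_⟩
  intro z hz
  set v := z - z₀ with hv
  have hseg : ∀ t ∈ Icc (0 : ℝ) 1, z₀ + t • v ∈ Z := fun t ht => hZ.add_smul_sub_mem hz₀ hz ht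
  have hu : ∀ t ∈ Icc (0 : ℝ) 1, ‖z₀ + t • v‖ ^ 2 ∈ Ioc 0 (D ^ 2) := fun t ht => by
    obtain ⟨ha, hb⟩ := hZδ _ (hseg t ht)
    have : 0 < ‖z₀ + t • v‖ := hδ.trans_le ha
    exact ⟨by positivity, by gcongr⟩
  have hline : ∀ t : ℝ, HasDerivAt (fun t : ℝ => z₀ + t • v) v t := fun t => by
    simpa using! ((hasDerivAt_id t).smul_const v).const_add z₀
  have hr : ∀ t : ℝ, HasDerivAt (fun t : ℝ => ‖z₀ + t • v‖ ^ 2) (2 * inner ℝ (z₀ + t • v) v) t :=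
    fun t => (hline t).norm_sq
  have hi : ∀ t : ℝ, HasDerivAt (fun t : ℝ => 2 * inner ℝ (z₀ + t • v) v) (2 * ‖v‖ ^ 2) t :=
    fun t => by
      have := ((hline t).inner ℝ (hasDerivAt_const t v)).const_mul 2
      simpa using this
  have h := norm_sub_sub_le_of_hasDerivAt (g := fun t : ℝ => f (‖z₀ + t • v‖ ^ 2))
    (g₁ := fun t => (2 * inner ℝ (z₀ + t • v) v) • f₁ (‖z₀ + t • v‖ ^ 2))
    (g₂ := fun t => (2 * inner ℝ (z₀ + t • v) v) • ((2 * inner ℝ (z₀ + t • v) v) •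
      f₂ (‖z₀ + t • v‖ ^ 2)) + (2 * ‖v‖ ^ 2) • f₁ (‖z₀ + t • v‖ ^ 2))
    (C := (4 * |C₂| + 2 * |C₁|) * δ ^ (-q) * ‖v‖ ^ 2)
    (fun t ht => (h1 _ (hu t ht)).scomp t (hr t))
    (fun t ht => (hi t).smul ((h2 _ (hu t ht)).scomp t (hr t)))
    (fun t ht => by
      have hut := hu t ht
      obtain ⟨ha, hb⟩ := hZδ _ (hseg t ht)
      set x := z₀ + t • v
      have hx : 0 < ‖x‖ := hδ.trans_le ha
      have hin : |inner ℝ x v| ≤ ‖x‖ * ‖v‖ := abs_real_inner_le_norm x v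
      have e1 := hC₁ _ hut
      have e2 := hC₂ _ hut
      have p1 : (‖x‖ ^ 2) ^ (-q / 2) = ‖x‖ ^ (-q) := by
        rw [← Real.rpow_natCast, ← Real.rpow_mul hx.le]; congr 1; push_cast; ring
      -- The two inner products multiplying `f₂` supply `‖x‖²`, which compensates the extra power in
      -- its growth.
      have p2 : (‖x‖ ^ 2) ^ (-q / 2 - 1) * ‖x‖ ^ 2 = ‖x‖ ^ (-q) := by
        rw [← p1, Real.rpow_sub_one (by positivity)]
        field_simp
      have p3 : ‖x‖ ^ (-q) ≤ δ ^ (-q) := Real.rpow_le_rpow_of_nonpos hδ ha (by linarith)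
      have p4 : 0 ≤ (‖x‖ ^ 2) ^ (-q / 2 - 1) := by positivity
      rw [Real.norm_of_nonneg (by positivity), p1] at e1
      rw [Real.norm_of_nonneg p4] at e2
      have e1' : ‖f₁ (‖x‖ ^ 2)‖ ≤ |C₁| * δ ^ (-q) := by
        refine e1.trans ?_
        gcongr
        exact le_abs_self _
      have e2' : ‖f₂ (‖x‖ ^ 2)‖ * ‖x‖ ^ 2 ≤ |C₂| * δ ^ (-q) := by
        calc _ ≤ C₂ * (‖x‖ ^ 2) ^ (-q / 2 - 1) * ‖x‖ ^ 2 := by gcongr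
          _ = C₂ * ‖x‖ ^ (-q) := by rw [mul_assoc, p2]
          _ ≤ _ := by gcongr; exact le_abs_self _
      refine (norm_add_le _ _).trans ?_
      simp only [norm_smul, Real.norm_eq_abs, abs_mul, abs_two, abs_pow, abs_norm]
      calc _ ≤ 2 * (‖x‖ * ‖v‖) * (2 * (‖x‖ * ‖v‖) * ‖f₂ (‖x‖ ^ 2)‖) +
            2 * ‖v‖ ^ 2 * ‖f₁ (‖x‖ ^ 2)‖ := by gcongr
        _ = 4 * ‖v‖ ^ 2 * (‖f₂ (‖x‖ ^ 2)‖ * ‖x‖ ^ 2) + 2 * ‖v‖ ^ 2 * ‖f₁ (‖x‖ ^ 2)‖ := by ring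
        _ ≤ 4 * ‖v‖ ^ 2 * (|C₂| * δ ^ (-q)) + 2 * ‖v‖ ^ 2 * (|C₁| * δ ^ (-q)) := by gcongr
        _ = _ := by ring)
  simp only [one_smul, zero_smul, add_zero] at h
  have e : z₀ + v = z := by simp [hv]
  rw [e] at h
  refine (le_of_eq ?_).trans (h.trans_eq (by ring))
  congr 2
  simp
  ring

/-! ### The Helmholtz kernels as radial kernels -/

/-- On each ball the exponential series is a summable majorant, so the sum is a locally uniform
limit of polynomials. -/
theorem differentiable_tsum_mul_pow {a : ℕ → ℂ} (ha : ∀ j, ‖a j‖ ≤ 1 / (j.factorial : ℝ)) :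
    Differentiable ℂ fun z => ∑' j, a j * z ^ j := by
  intro z
  have h : DifferentiableOn ℂ (fun z => ∑' j, a j * z ^ j) (Metric.ball 0 (‖z‖ + 1)) := by
    refine Complex.differentiableOn_tsum_of_summable_norm
      (Real.summable_pow_div_factorial (‖z‖ + 1)) (fun j => by fun_prop) Metric.isOpen_ball ?_
    intro j w hw
    rw [norm_mul, norm_pow]
    have hw' : ‖w‖ ≤ ‖z‖ + 1 := by simpa using (mem_ball_zero_iff.1 hw).le
    calc _ ≤ 1 / (j.factorial : ℝ) * (‖z‖ + 1) ^ j := by gcongr; exact ha j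
      _ = _ := by ring
  exact h.differentiableAt (Metric.isOpen_ball.mem_nhds (by simp))

theorem Differentiable.contDiff_comp_real {F : ℂ → ℂ} (hF : Differentiable ℂ F) (c : ℂ) :
    ContDiff ℝ 2 fun u : ℝ => F (c * u) := by
  have h1 : ContDiff ℝ 2 F := (hF.contDiff (n := 2)).restrict_scalars ℝ
  exact h1.comp (contDiff_const.mul Complex.ofRealCLM.contDiff)

/-- The entire function `∑ (-1)ʲ zʲ / (j!)²`, so that `J₀(z) = besselEntireJ (z² / 4)`. -/
def besselEntireJ (z : ℂ) : ℂ := ∑' j : ℕ, ((-1) ^ j / ((j.factorial : ℝ) ^ 2) : ℝ) * z ^ j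

/-- The entire function `∑ (-1)ʲ Hⱼ zʲ / (j!)²` occurring in `Y₀`. -/
def besselEntireH (z : ℂ) : ℂ :=
  ∑' j : ℕ, ((-1) ^ j * (harmonic j : ℝ) / ((j.factorial : ℝ) ^ 2) : ℝ) * z ^ j

/-- This crude bound brings the coefficients `H_j / (j!)²` under `1 / j!`. -/
theorem harmonic_le_factorial (j : ℕ) : (harmonic j : ℝ) ≤ j.factorial := by
  have h1 : (harmonic j : ℝ) ≤ j := by
    have : (harmonic j : ℚ) ≤ j := by
      rw [harmonic]
      refine (Finset.sum_le_card_nsmul _ _ 1 fun i _ => ?_).trans (by simp)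
      exact inv_le_one_of_one_le₀ (by push_cast; linarith [(Nat.cast_nonneg i : (0 : ℚ) ≤ i)])
    exact_mod_cast this
  exact h1.trans (by exact_mod_cast Nat.self_le_factorial j)

theorem differentiable_besselEntireJ : Differentiable ℂ besselEntireJ := by
  refine differentiable_tsum_mul_pow fun j => ?_
  have h : (1 : ℝ) ≤ j.factorial := by exact_mod_cast Nat.one_le_iff_ne_zero.2 j.factorial_ne_zero
  rw [Complex.norm_real, norm_div, norm_pow, norm_neg, norm_one, one_pow,
    Real.norm_of_nonneg (by positivity)]
  exact one_div_le_one_div_of_le (by positivity) (by nlinarith)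

theorem differentiable_besselEntireH : Differentiable ℂ besselEntireH := by
  refine differentiable_tsum_mul_pow fun j => ?_
  have h : (1 : ℝ) ≤ j.factorial := by exact_mod_cast Nat.one_le_iff_ne_zero.2 j.factorial_ne_zero
  have h0 : (0 : ℝ) ≤ harmonic j := by
    have : (0 : ℚ) ≤ harmonic j := Finset.sum_nonneg fun i _ => by positivity
    exact_mod_cast this
  rw [Complex.norm_real, norm_div, norm_mul, norm_pow, norm_neg, norm_one, one_pow, one_mul,
    Real.norm_of_nonneg h0, Real.norm_of_nonneg (by positivity), div_le_div_iff₀ (by positivity)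
    (by positivity)]
  nlinarith [harmonic_le_factorial j]

theorem besselEntireJ_zero : besselEntireJ 0 = 1 := by
  rw [besselEntireJ, tsum_eq_single 0 fun j hj => by simp [hj]]; simp

theorem besselEntireH_zero : besselEntireH 0 = 0 := by
  rw [besselEntireH, tsum_eq_single 0 fun j hj => by simp [hj]]; simp

theorem besselJ0_eq (z : ℝ) : (besselJ0 z : ℂ) = besselEntireJ (z ^ 2 / 4) := by
  rw [besselJ0, besselEntireJ, Complex.ofReal_tsum]
  refine tsum_congr fun j => ?_
  push_cast; ring

theorem besselY0_eq (z : ℝ) : (besselY0 z : ℂ) =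
    2 / Real.pi * (Real.log (z / 2) + Real.eulerMascheroniConstant) * besselEntireJ (z ^ 2 / 4) -
      2 / Real.pi * besselEntireH (z ^ 2 / 4) := by
  have h : besselEntireH (z ^ 2 / 4) = ((∑' j : ℕ,
      (-1) ^ j * (harmonic j : ℝ) * (z ^ 2 / 4) ^ j / ((j.factorial : ℝ) ^ 2) : ℝ) : ℂ) := by
    rw [besselEntireH, Complex.ofReal_tsum]
    refine tsum_congr fun j => ?_
    push_cast; ring
  rw [h, ← besselJ0_eq, besselY0]
  push_cast
  rfl

open Asymptotics in
/-- A splitting of the Helmholtz kernel into radial kernels, together with the estimates on which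
the quadrature error bounds rest. -/
structure IsRadialSplitting (n : ℕ) (k R s : ℝ) (fs fr : ℝ → ℂ) : Prop where
  measurable_sing : Measurable fs
  measurable_reg : Measurable fr
  sing_eq : ∀ x y : Eucl n, singKernel n x y = fs (dist x y ^ 2)
  reg_eq : ∀ x y : Eucl n, regKernel n k x y = fr (dist x y ^ 2)
  radialC2_sing : RadialC2 fs n R
  radialC2_reg : RadialC2 fr s R
  sing_isBigO : fs =O[𝓟 (Ioc 0 R)] (fun u => u ^ (-s / 2))
  reg_isBigO : (fun u => fr u - fr 0) =O[𝓟 (Ioc 0 R)] (fun u => u ^ (1 - s / 2))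

/-- In the variable `u = r²` the regular part is `a(u) + b(u) log u` with `a`, `b` smooth and `b =
(1 - J₀) / (4π)`, which vanishes at zero. Only a logarithm remains, so any `s > 0` is admissible. -/
theorem isRadialSplitting_two {k : ℝ} (hk : 0 < k) (R : ℝ) {s : ℝ} (hs : 0 < s) :
    ∃ fs fr, IsRadialSplitting 2 k R s fs fr := by
  have hπ : (Real.pi : ℂ) ≠ 0 := by exact_mod_cast Real.pi_ne_zero
  set c : ℂ := Complex.I / 4 -
    (Real.log (k / 2) + Real.eulerMascheroniConstant) / (2 * Real.pi) with hc
  set κ : ℂ := (k : ℂ) ^ 2 / 4 with hκ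
  let a : ℝ → ℂ := fun u => c * besselEntireJ (κ * u) + 1 / (2 * Real.pi) * besselEntireH (κ * u)
  let b : ℝ → ℂ := fun u => (1 - besselEntireJ (κ * u)) * (1 / (4 * Real.pi))
  have hJ := differentiable_besselEntireJ.contDiff_comp_real κ
  have hH := differentiable_besselEntireH.contDiff_comp_real κ
  have ha : ContDiff ℝ 2 a := (contDiff_const.mul hJ).add (contDiff_const.mul hH)
  have hb : ContDiff ℝ 2 b := (contDiff_const.sub hJ).mul contDiff_const
  have hb0 : b 0 = 0 := by simp [b, besselEntireJ_zero]
  have hlog : Measurable fun u : ℝ => (Real.log u : ℂ) :=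
    Complex.measurable_ofReal.comp Real.measurable_log
  obtain ⟨hC2, hO⟩ := radialC2_add_log_mul ha hb hb0 hs R
  refine ⟨fun u => (-1 / (4 * Real.pi) : ℂ) * (Real.log u : ℂ),
    fun u => a u + (Real.log u : ℂ) * b u, ?_, ?_, ?_, ?_, ?_, hC2, ?_, hO⟩
  · exact hlog.const_mul _
  · exact ha.continuous.measurable.add (hlog.mul hb.continuous.measurable)
  · intro x y
    rw [singKernel, if_pos rfl, Real.log_pow]
    push_cast
    field_simp
    norm_num
  · intro x y
    by_cases hxy : x = y
    · simp [regKernel, hxy, a, b, besselEntireJ_zero, besselEntireH_zero, hc]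
    · have hr : 0 < dist x y := dist_pos.2 hxy
      rw [regKernel, if_neg hxy, helmholtzKernel, if_pos rfl, singKernel, if_pos rfl, hankel0,
        besselJ0_eq, besselY0_eq]
      have e1 : Real.log (k * dist x y / 2) = Real.log (k / 2) + Real.log (dist x y) := by
        rw [← Real.log_mul (by positivity) hr.ne']; ring_nf
      have e2 : ((k * dist x y : ℝ) : ℂ) ^ 2 / 4 = κ * ((dist x y ^ 2 : ℝ) : ℂ) := by
        rw [hκ]; push_cast; ring
      rw [e1, e2, Real.log_pow]
      simp only [a, b, hc]
      generalize besselEntireJ (κ * ((dist x y ^ 2 : ℝ) : ℂ)) = J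
      generalize besselEntireH (κ * ((dist x y ^ 2 : ℝ) : ℂ)) = H
      push_cast
      field_simp
      ring_nf
      simp only [Complex.I_sq]
      ring
  · simpa using (radialC2_log R).const_mul (-1 / (4 * Real.pi) : ℂ)
  · exact (isBigO_ofReal (isBigO_log_rpow (by linarith))).const_mul_left _

/-- The regular part `(exp(ikr) - 1) / (4πr)` is a difference quotient of the exponential, hence
smooth in `r`; as it is not smooth in `r²`, the exponent is `s = 1`. -/
theorem isRadialSplitting_three {k : ℝ} (hk : 0 < k) (R : ℝ) :
    ∃ fs fr, IsRadialSplitting 3 k R 1 fs fr := by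
  have hπ : (Real.pi : ℂ) ≠ 0 := by exact_mod_cast Real.pi_ne_zero
  have hE : Differentiable ℂ (dslope Complex.exp 0) := by
    rw [← differentiableOn_univ, Complex.differentiableOn_dslope univ_mem]
    exact Complex.differentiable_exp.differentiableOn
  let g : ℝ → ℂ := fun r => Complex.I * k / (4 * Real.pi) * dslope Complex.exp 0 (Complex.I * k * r)
  have hg : ContDiff ℝ 2 g := contDiff_const.mul (hE.contDiff_comp_real (Complex.I * k))
  have hm : ∀ c : ℝ, Measurable fun u : ℝ => u ^ c := fun c => measurable_id.pow_const c
  have hsq : ∀ x y : Eucl 3, (dist x y ^ 2) ^ (1 / 2 : ℝ) = dist x y := fun x y => by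
    rw [← Real.sqrt_eq_rpow, Real.sqrt_sq dist_nonneg]
  obtain ⟨hC2, hO⟩ := radialC2_comp_sqrt hg R
  refine ⟨fun u => (1 / (4 * Real.pi) : ℂ) * ((u ^ (-1 / 2 : ℝ) : ℝ) : ℂ),
    fun u => g (u ^ (1 / 2 : ℝ)), ?_, ?_, ?_, ?_, ?_, hC2, ?_, hO⟩
  · exact (Complex.measurable_ofReal.comp (hm _)).const_mul _
  · exact hg.continuous.measurable.comp (hm _)
  · intro x y
    have e : (dist x y ^ 2) ^ (-1 / 2 : ℝ) = (dist x y)⁻¹ := by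
      rw [neg_div, Real.rpow_neg (by positivity), hsq]
    rw [singKernel, if_neg (by norm_num), e]
    push_cast
    field_simp
  · intro x y
    rw [hsq]
    by_cases hxy : x = y
    · simp [regKernel, hxy, g]
    · have hr : 0 < dist x y := dist_pos.2 hxy
      have hne : (Complex.I * k * dist x y : ℂ) ≠ 0 := by
        simp [hk.ne', hxy]
      have hr' : (dist x y : ℂ) ≠ 0 := by exact_mod_cast hr.ne'
      have hk' : (k : ℂ) ≠ 0 := by exact_mod_cast hk.ne'
      rw [regKernel, if_neg hxy, helmholtzKernel, if_neg (by norm_num), singKernel,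
        if_neg (by norm_num)]
      simp only [g]
      rw [dslope_of_ne _ hne, slope_def_field, Complex.exp_zero, sub_zero]
      push_cast
      field_simp
  · have := (radialC2_rpow R 1).const_mul (1 / (4 * Real.pi) : ℂ)
    norm_num at this ⊢
    exact this
  · exact (isBigO_ofReal (Asymptotics.isBigO_refl _ _)).const_mul_left _

/-- The exponent must stay below `d` for the energy to be finite: `s = min d 1 / 2` works for `n =
2`, and for `n = 3` the assumption `d > 1` allows `s = 1`. -/
theorem exists_isRadialSplitting {n : ℕ} (hn : n = 2 ∨ n = 3) {k : ℝ} (hk : 0 < k) {d : ℝ}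
    (hd : (n : ℝ) - 2 < d) (R : ℝ) :
    ∃ s fs fr, 0 < s ∧ s ≤ 1 ∧ s < d ∧ IsRadialSplitting n k R s fs fr := by
  rcases hn with rfl | rfl
  · have hd0 : 0 < d := by norm_num at hd; exact hd
    have hs : 0 < min d 1 := lt_min hd0 one_pos
    obtain ⟨fs, fr, h⟩ := isRadialSplitting_two hk R (half_pos hs)
    refine ⟨_, fs, fr, half_pos hs, ?_, ?_, h⟩
    · linarith [min_le_right d 1]
    · linarith [min_le_left d 1]
  · obtain ⟨fs, fr, h⟩ := isRadialSplitting_three hk R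
    exact ⟨1, fs, fr, one_pos, le_rfl, by norm_num at hd; linarith, h⟩

/-! ### Double integrals over hull-disjoint attractors -/

namespace IFS

variable {n M : ℕ} {S : IFS n M} {Γ : Set (Eucl n)} {d : ℝ}

variable (S Γ d) in
/-- A hull-disjoint attractor of positive similarity dimension `d`. -/
structure IsHullDisjointAttractor : Prop where
  attractor : S.IsAttractor Γ
  dim_pos : 0 < d
  sum_ratio : ∑ m, S.ratio m ^ d = 1
  disjoint : S.HullDisjoint Γ

variable (n Γ d) in
/-- The product measure `ℋᵈ ⊗ ℋᵈ` on `Γ × Γ`. -/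
def pairMeasure : Measure (Eucl n × Eucl n) :=
  ((hausM n d).restrict Γ).prod ((hausM n d).restrict Γ)

variable (S Γ d) in
/-- The double integral of a kernel over `Γ_w × Γ_w'`. -/
def pairInt {E : Type*} [NormedAddCommGroup E] [NormedSpace ℝ E] (F : Eucl n → Eucl n → E)
    (w w' : List (Fin M)) : E :=
  ∫ z in S.cell Γ w ×ˢ S.cell Γ w', F z.1 z.2 ∂(pairMeasure n Γ d)

namespace IsHullDisjointAttractor

variable (hS : S.IsHullDisjointAttractor Γ d)
include hS

theorem isFiniteMeasure : IsFiniteMeasure ((hausM n d).restrict Γ) := by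
  simpa using hS.attractor.isFiniteMeasure_restrict hS.dim_pos.le hS.sum_ratio []

theorem isFiniteMeasure_pairMeasure : IsFiniteMeasure (pairMeasure n Γ d) := by
  have := hS.isFiniteMeasure
  unfold pairMeasure; infer_instance

theorem restrict_restrict_cell (w : List (Fin M)) :
    ((hausM n d).restrict Γ).restrict (S.cell Γ w) = (hausM n d).restrict (S.cell Γ w) := by
  rw [Measure.restrict_restrict (hS.attractor.measurableSet_cell w),
    inter_eq_self_of_subset_left (hS.attractor.cell_subset w)]

theorem restrict_pairMeasure (w w' : List (Fin M)) :
    (pairMeasure n Γ d).restrict (S.cell Γ w ×ˢ S.cell Γ w') =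
      ((hausM n d).restrict (S.cell Γ w)).prod ((hausM n d).restrict (S.cell Γ w')) := by
  have := hS.isFiniteMeasure
  rw [pairMeasure, ← Measure.prod_restrict, hS.restrict_restrict_cell, hS.restrict_restrict_cell]

theorem pairMeasure_cell (w w' : List (Fin M)) :
    pairMeasure n Γ d (S.cell Γ w ×ˢ S.cell Γ w') =
      hausM n d (S.cell Γ w) * hausM n d (S.cell Γ w') := by
  have := hS.isFiniteMeasure
  rw [pairMeasure, Measure.prod_prod,
    Measure.restrict_apply (hS.attractor.measurableSet_cell w),
    Measure.restrict_apply (hS.attractor.measurableSet_cell w'),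
    inter_eq_self_of_subset_left (hS.attractor.cell_subset w),
    inter_eq_self_of_subset_left (hS.attractor.cell_subset w')]

theorem real_pairMeasure_cell (w w' : List (Fin M)) :
    (pairMeasure n Γ d).real (S.cell Γ w ×ˢ S.cell Γ w') = S.wt Γ d w * S.wt Γ d w' := by
  rw [measureReal_def, hS.pairMeasure_cell, ENNReal.toReal_mul]; rfl

theorem measurableSet_prod_cell (w w' : List (Fin M)) :
    MeasurableSet (S.cell Γ w ×ˢ S.cell Γ w') :=
  (hS.attractor.measurableSet_cell w).prod (hS.attractor.measurableSet_cell w')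

theorem ae_mem_prod_cell (w w' : List (Fin M)) :
    ∀ᵐ z ∂(pairMeasure n Γ d).restrict (S.cell Γ w ×ˢ S.cell Γ w'),
      z.1 ∈ S.cell Γ w ∧ z.2 ∈ S.cell Γ w' :=
  ae_restrict_mem (hS.measurableSet_prod_cell w w')

theorem ae_mem_prod : ∀ᵐ z ∂pairMeasure n Γ d, z.1 ∈ Γ ∧ z.2 ∈ Γ := by
  have := hS.isFiniteMeasure
  have h := Measure.prod_restrict (μ := (hausM n d).restrict Γ) (ν := (hausM n d).restrict Γ) Γ Γ
  rw [Measure.restrict_restrict hS.attractor.2.1.measurableSet, inter_self] at h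
  rw [pairMeasure, h]
  exact ae_restrict_mem (hS.attractor.2.1.measurableSet.prod hS.attractor.2.1.measurableSet)

/-- Points are null for `d > 0`, so by Fubini the diagonal is null and the default kernel values on
it do not affect integrals. -/
theorem ae_ne : ∀ᵐ z ∂pairMeasure n Γ d, z.1 ≠ z.2 := by
  have := hS.isFiniteMeasure
  have hm : MeasurableSet {z : Eucl n × Eucl n | z.1 = z.2} :=
    measurableSet_eq_fun measurable_fst measurable_snd
  have h0 : pairMeasure n Γ d {z | z.1 = z.2} = 0 := by
    rw [pairMeasure, Measure.measure_prod_null hm]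
    refine .of_forall fun x => ?_
    have e : Prod.mk x ⁻¹' {z : Eucl n × Eucl n | z.1 = z.2} = {x} := by
      ext y; simp [eq_comm]
    change (hausM n d).restrict Γ (Prod.mk x ⁻¹' {z : Eucl n × Eucl n | z.1 = z.2}) = 0
    rw [e]
    have := Measure.nullSingletonClass_hausdorff (Eucl n) hS.dim_pos
    have h1 : hausM n d {x} = 0 := by simp [hausM]
    exact nonpos_iff_eq_zero.1 ((Measure.restrict_apply_le _ _).trans h1.le)
  rw [ae_iff]; simpa using h0

theorem pairInt_eq_setIntegral {F : Eucl n → Eucl n → ℂ}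
    (hF : Integrable (fun z : Eucl n × Eucl n => F z.1 z.2) (pairMeasure n Γ d))
    (w w' : List (Fin M)) :
    ∫ x in S.cell Γ w, ∫ y in S.cell Γ w', F x y ∂(hausM n d) ∂(hausM n d) =
      S.pairInt Γ d F w w' := by
  have h1 := hS.attractor.isFiniteMeasure_restrict hS.dim_pos.le hS.sum_ratio w
  have h2 := hS.attractor.isFiniteMeasure_restrict hS.dim_pos.le hS.sum_ratio w'
  have h := hF.integrableOn (s := S.cell Γ w ×ˢ S.cell Γ w')
  rw [IntegrableOn, hS.restrict_pairMeasure] at h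
  rw [pairInt, hS.restrict_pairMeasure, integral_prod _ h]

section Additivity

variable {E : Type*} [NormedAddCommGroup E] [NormedSpace ℝ E] {F : Eucl n → Eucl n → E}
  (hF : Integrable (fun z : Eucl n × Eucl n => F z.1 z.2) (pairMeasure n Γ d))
include hF

theorem pairInt_eq_sum_left (w w' : List (Fin M)) :
    S.pairInt Γ d F w w' = ∑ m, S.pairInt Γ d F (w ++ [m]) w' := by
  rw [pairInt, hS.attractor.cell_eq_iUnion, iUnion_prod_const,
    integral_iUnion_ae (fun m => (hS.measurableSet_prod_cell _ _).nullMeasurableSet) ?_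
      hF.integrableOn, tsum_fintype]
  · rfl
  · intro m m' hmm
    have h := hS.attractor.aedisjoint_cell hS.dim_pos.le hS.sum_ratio w hmm
    have := hS.isFiniteMeasure
    change pairMeasure n Γ d _ = 0
    rw [prod_inter_prod, pairMeasure, Measure.prod_prod]
    have h0 : (hausM n d).restrict Γ (S.cell Γ (w ++ [m]) ∩ S.cell Γ (w ++ [m'])) = 0 :=
      nonpos_iff_eq_zero.1 ((Measure.restrict_apply_le _ _).trans h.le)
    rw [h0, zero_mul]

theorem pairInt_eq_sum_right (w w' : List (Fin M)) :
    S.pairInt Γ d F w w' = ∑ m, S.pairInt Γ d F w (w' ++ [m]) := by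
  conv_lhs => rw [pairInt, hS.attractor.cell_eq_iUnion w', prod_iUnion]
  rw [integral_iUnion_ae (fun m => (hS.measurableSet_prod_cell _ _).nullMeasurableSet) ?_
      hF.integrableOn, tsum_fintype]
  · rfl
  · intro m m' hmm
    have h := hS.attractor.aedisjoint_cell hS.dim_pos.le hS.sum_ratio w' hmm
    have := hS.isFiniteMeasure
    change pairMeasure n Γ d _ = 0
    rw [prod_inter_prod, pairMeasure, Measure.prod_prod]
    have h0 : (hausM n d).restrict Γ (S.cell Γ (w' ++ [m]) ∩ S.cell Γ (w' ++ [m'])) = 0 :=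
      nonpos_iff_eq_zero.1 ((Measure.restrict_apply_le _ _).trans h.le)
    rw [h0, mul_zero]

theorem pairInt_eq_sum_subIndex {h : ℝ} (hh : 0 < h) (w w' : List (Fin M)) :
    S.pairInt Γ d F w w' = ∑ p ∈ (S.finite_subIndex hS.attractor.2.1 w hh).toFinset,
      ∑ p' ∈ (S.finite_subIndex hS.attractor.2.1 w' hh).toFinset, S.pairInt Γ d F p p' := by
  rw [hS.attractor.eq_finsum_subIndex (F := fun p => S.pairInt Γ d F p w')
    (fun p => hS.pairInt_eq_sum_left hF p w') hh w,
    finsum_mem_eq_finite_toFinset_sum _ (S.finite_subIndex hS.attractor.2.1 w hh)]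
  refine Finset.sum_congr rfl fun p _ => ?_
  rw [hS.attractor.eq_finsum_subIndex (F := fun p' => S.pairInt Γ d F p p')
    (fun p' => hS.pairInt_eq_sum_right hF p p') hh w',
    finsum_mem_eq_finite_toFinset_sum _ (S.finite_subIndex hS.attractor.2.1 w' hh)]

end Additivity

theorem wt_eq_sum_subIndex {h : ℝ} (hh : 0 < h) (w : List (Fin M)) :
    S.wt Γ d w = ∑ p ∈ (S.finite_subIndex hS.attractor.2.1 w hh).toFinset, S.wt Γ d p := by
  rw [hS.attractor.eq_finsum_subIndex (wt_eq_sum hS.dim_pos.le hS.sum_ratio) hh w,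
    finsum_mem_eq_finite_toFinset_sum _ (S.finite_subIndex hS.attractor.2.1 w hh)]

/-- The double integral over `Γ_w × Γ_w` as a double integral over `Γ × Γ`. -/
theorem pairInt_self_eq {E : Type*} [NormedAddCommGroup E] [NormedSpace ℝ E]
    (F : Eucl n → Eucl n → E) (w : List (Fin M)) :
    S.pairInt Γ d F w w = S.wordRatio w ^ (2 * d) •
      ∫ z, F (S.wordMap w z.1) (S.wordMap w z.2) ∂(pairMeasure n Γ d) := by
  have := hS.isFiniteMeasure
  have hr := S.wordRatio_pos w
  have he := S.measurableEmbedding_wordMap w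
  rw [pairInt, hS.restrict_pairMeasure, restrict_cell hS.dim_pos.le, Measure.prod_smul_left,
    Measure.prod_smul_right, Measure.map_prod_map _ _ he.measurable he.measurable,
    integral_smul_measure, integral_smul_measure, (he.prodMap he).integral_map, smul_smul,
    ENNReal.toReal_ofReal (by positivity), ← Real.rpow_add hr, ← two_mul]
  rfl

/-! ### Separation of the components -/

/-- Finitely many disjoint compact hulls at the first level have a positive mutual distance, and a
word map rescales it by its ratio. -/
theorem exists_separation : ∃ c : ℝ, 0 < c ∧ ∀ (v : List (Fin M)) (m m' : Fin M), m ≠ m' →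
    ∀ a ∈ convexHull ℝ (S.cell Γ (v ++ [m])), ∀ b ∈ convexHull ℝ (S.cell Γ (v ++ [m'])),
      c * S.wordRatio v ≤ dist a b := by
  have h : ∀ q : Fin M × Fin M, ∃ c : ℝ, 0 < c ∧ (q.1 ≠ q.2 → ∀ a ∈ convexHull ℝ (S.cell Γ [q.1]),
      ∀ b ∈ convexHull ℝ (S.cell Γ [q.2]), c ≤ dist a b) := by
    rintro ⟨m, m'⟩
    by_cases hm : m = m'
    · exact ⟨1, one_pos, fun h => absurd hm h⟩
    have hdis : Disjoint (convexHull ℝ (S.cell Γ [m])) (convexHull ℝ (S.cell Γ [m'])) := by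
      have := hS.disjoint m m' hm
      simpa [cell, wordMap] using this
    obtain ⟨r, hr, hrd⟩ := Metric.exists_pos_forall_lt_edist
      (hS.attractor.isCompact_convexHull_cell [m])
      (hS.attractor.isCompact_convexHull_cell [m']).isClosed hdis
    refine ⟨r, by exact_mod_cast hr, fun _ a ha b hb => ?_⟩
    have h1 := hrd a ha b hb
    rw [edist_nndist] at h1
    exact_mod_cast h1.le
  choose c hc hcd using h
  have : Nonempty (Fin M × Fin M) :=
    have : Nonempty (Fin M) := ⟨⟨0, by have := S.two_le; omega⟩⟩
    inferInstance
  obtain ⟨q₀, hq₀⟩ := Finite.exists_min c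
  refine ⟨c q₀, hc q₀, fun v m m' hm => ?_⟩
  rw [convexHull_cell_append, convexHull_cell_append]
  rintro _ ⟨a, ha, rfl⟩ _ ⟨b, hb, rfl⟩
  rw [S.dist_wordMap, mul_comm]
  gcongr
  · exact (S.wordRatio_pos v).le
  · exact (hq₀ (m, m')).trans (hcd (m, m') hm a ha b hb)

theorem diam_pos : 0 < Metric.diam Γ := by
  obtain ⟨c, hc, hsep⟩ := hS.exists_separation
  have hM := S.two_le
  obtain ⟨x, hx⟩ := hS.attractor.cell_nonempty [⟨0, by omega⟩]
  obtain ⟨y, hy⟩ := hS.attractor.cell_nonempty [⟨1, by omega⟩]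
  have h1 := hsep [] ⟨0, by omega⟩ ⟨1, by omega⟩ (by simp) x (subset_convexHull ℝ _ hx) y
    (subset_convexHull ℝ _ hy)
  simp only [wordRatio_nil, mul_one] at h1
  exact hc.trans_le (h1.trans (Metric.dist_le_diam_of_mem hS.attractor.2.1.isBounded
    (hS.attractor.cell_subset _ hx) (hS.attractor.cell_subset _ hy)))

/-- Distinct components in a composite rule of width `h` have hulls at distance at least `c h`. -/
theorem exists_separation_subIndex : ∃ c : ℝ, 0 < c ∧ ∀ (w p p' : List (Fin M)) (h : ℝ),
    p ∈ S.subIndex Γ w h → p' ∈ S.subIndex Γ w h → p ≠ p' →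
    ∀ a ∈ convexHull ℝ (S.cell Γ p), ∀ b ∈ convexHull ℝ (S.cell Γ p'), c * h ≤ dist a b := by
  obtain ⟨c, hc, hsep⟩ := hS.exists_separation
  have hD := hS.diam_pos
  -- The last common ancestor has diameter above `h`, so its ratio exceeds `h / diam Γ`.
  refine ⟨c / Metric.diam Γ, by positivity, fun w p p' h hp hp' hne a ha b hb => ?_⟩
  obtain ⟨v, m, m', hm, h1, h2, h3⟩ := hS.attractor.exists_common_ancestor hp hp' hne
  have h4 := hsep v m m' hm a (convexHull_mono (hS.attractor.cell_anti h1) ha) b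
    (convexHull_mono (hS.attractor.cell_anti h2) hb)
  rw [diam_cell] at h3
  calc c / Metric.diam Γ * h ≤ c / Metric.diam Γ * (S.wordRatio v * Metric.diam Γ) := by gcongr
    _ = c * S.wordRatio v := by field_simp
    _ ≤ _ := h4

/-! ### Finite energy -/

theorem sum_ratio_rpow_lt_one {t : ℝ} (ht : d < t) : ∑ m, S.ratio m ^ t < 1 := by
  have : Nonempty (Fin M) := ⟨⟨0, by have := S.two_le; omega⟩⟩
  rw [← hS.sum_ratio]
  exact Finset.sum_lt_sum_of_nonempty Finset.univ_nonempty fun m _ =>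
    Real.rpow_lt_rpow_of_exponent_gt (S.ratio_pos m) (S.ratio_lt_one m) ht

/-- Self-similarity gives `e ≤ θ e + const` with `θ = ∑ ρ_m ^ (2d - s) < 1`, since distinct children
are separated. Truncation makes `e` finite, so that `θ e` can be subtracted, and the resulting bound
does not depend on `N`. -/
theorem exists_bound_truncated_energy {s : ℝ} (hs0 : 0 < s) (hs : s < d) :
    ∃ B : ℝ, ∀ N : ℕ, ∫ z, min (dist z.1 z.2 ^ (-s)) (N : ℝ) ∂(pairMeasure n Γ d) ≤ B := by
  have hfin := hS.isFiniteMeasure_pairMeasure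
  obtain ⟨c, hc, hsep⟩ := hS.exists_separation
  have hθ := hS.sum_ratio_rpow_lt_one (t := 2 * d - s) (by linarith)
  set θ := ∑ m, S.ratio m ^ (2 * d - s)
  set P := (pairMeasure n Γ d).real univ
  refine ⟨(M * (M * (c ^ (-s) * P))) / (1 - θ), fun N => ?_⟩
  have hint : Integrable (fun z : Eucl n × Eucl n => min (dist z.1 z.2 ^ (-s)) (N : ℝ))
      (pairMeasure n Γ d) := by
    refine Integrable.of_bound (C := N)
          (Measurable.aestronglyMeasurable (by fun_prop)) (.of_forall fun z => ?_)
    have : 0 ≤ dist z.1 z.2 ^ (-s) := by positivity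
    rw [Real.norm_of_nonneg (by positivity)]
    exact min_le_right _ _
  set e := ∫ z, min (dist z.1 z.2 ^ (-s)) (N : ℝ) ∂(pairMeasure n Γ d) with he
  set F : Eucl n → Eucl n → ℝ := fun x y => min (dist x y ^ (-s)) (N : ℝ) with hF
  have he' : e = S.pairInt Γ d F [] [] := by
    rw [hS.pairInt_self_eq]
    simp [wordMap, he, hF]
  have hdiag : ∀ m, S.pairInt Γ d F [m] [m] ≤ S.ratio m ^ (2 * d - s) * e := by
    intro m
    have hr := S.ratio_pos m
    -- As the scaling factor is at least one, the truncation level survives rescaling as an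
    -- inequality.
    have hr1 : 1 ≤ S.ratio m ^ (-s) :=
      Real.one_le_rpow_of_pos_of_le_one_of_nonpos hr (S.ratio_lt_one m).le (by linarith)
    have hle : ∀ z : Eucl n × Eucl n, F (S.wordMap [m] z.1) (S.wordMap [m] z.2) ≤
        S.ratio m ^ (-s) * F z.1 z.2 := by
      intro z
      simp only [hF]
      rw [S.dist_wordMap, wordRatio_singleton, Real.mul_rpow hr.le dist_nonneg,
        mul_min_of_nonneg _ _ (by positivity)]
      refine min_le_min le_rfl ?_
      nlinarith [(Nat.cast_nonneg N : (0 : ℝ) ≤ N)]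
    rw [hS.pairInt_self_eq, wordRatio_singleton, smul_eq_mul, Real.rpow_sub hr]
    have h0 : 0 ≤ S.ratio m ^ (2 * d) := by positivity
    calc _ ≤ S.ratio m ^ (2 * d) * ∫ z, S.ratio m ^ (-s) * F z.1 z.2 ∂(pairMeasure n Γ d) := by
          refine mul_le_mul_of_nonneg_left (integral_mono_of_nonneg (.of_forall fun z => ?_)
            (hint.const_mul _) (.of_forall hle)) h0
          simp only [hF, Pi.zero_apply]
          positivity
      _ = _ := by rw [integral_const_mul, Real.rpow_neg hr.le]; ring
  have hoff : ∀ m m', m ≠ m' → S.pairInt Γ d F [m] [m'] ≤ c ^ (-s) * P := by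
    intro m m' hm
    have h1 : S.pairInt Γ d F [m] [m'] ≤
        ∫ _ in S.cell Γ [m] ×ˢ S.cell Γ [m'], c ^ (-s) ∂(pairMeasure n Γ d) := by
      refine integral_mono_ae hint.integrableOn (integrable_const _) ?_
      filter_upwards [hS.ae_mem_prod_cell [m] [m']] with z hz
      have := hsep [] m m' hm z.1 (subset_convexHull ℝ _ hz.1) z.2 (subset_convexHull ℝ _ hz.2)
      simp only [wordRatio_nil, mul_one] at this
      exact (min_le_left _ _).trans (Real.rpow_le_rpow_of_nonpos hc this (by linarith))
    refine h1.trans ?_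
    rw [setIntegral_const, smul_eq_mul, mul_comm]
    gcongr
    exact measureReal_mono (subset_univ _)
  have hP : 0 ≤ c ^ (-s) * P := by positivity
  have hsum : e ≤ θ * e + M * (M * (c ^ (-s) * P)) := by
    have e0 : 0 ≤ e := integral_nonneg fun z => by positivity
    calc e = ∑ m, ∑ m', S.pairInt Γ d F [m] [m'] := by
          rw [he', hS.pairInt_eq_sum_left hint]
          refine Finset.sum_congr rfl fun m _ => ?_
          rw [hS.pairInt_eq_sum_right hint]; rfl
      _ ≤ ∑ m, (S.ratio m ^ (2 * d - s) * e + M * (c ^ (-s) * P)) := by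
          refine Finset.sum_le_sum fun m _ => ?_
          rw [← Finset.add_sum_erase _ _ (Finset.mem_univ m)]
          refine add_le_add (hdiag m) ?_
          refine (Finset.sum_le_card_nsmul _ _ (c ^ (-s) * P) fun m' hm' =>
            hoff m m' (Finset.ne_of_mem_erase hm').symm).trans ?_
          rw [nsmul_eq_mul]
          gcongr
          exact (Finset.card_le_univ _).trans (by simp)
      _ = _ := by
          rw [Finset.sum_add_distrib, ← Finset.sum_mul]
          simp [θ]
  rw [le_div_iff₀ (by linarith)]
  linarith

theorem integrable_dist_rpow {s : ℝ} (hs0 : 0 < s) (hs : s < d) :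
    Integrable (fun z : Eucl n × Eucl n => dist z.1 z.2 ^ (-s)) (pairMeasure n Γ d) := by
  have hfin := hS.isFiniteMeasure_pairMeasure
  obtain ⟨B, hB⟩ := hS.exists_bound_truncated_energy hs0 hs
  have hmeas : Measurable fun z : Eucl n × Eucl n => dist z.1 z.2 ^ (-s) := by fun_prop
  refine ⟨hmeas.aestronglyMeasurable, ?_⟩
  have hlim := lintegral_tendsto_of_tendsto_of_monotone (μ := pairMeasure n Γ d)
    (f := fun (N : ℕ) z => ENNReal.ofReal (min (dist z.1 z.2 ^ (-s)) (N : ℝ)))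
    (F := fun z => ENNReal.ofReal (dist z.1 z.2 ^ (-s)))
    (fun N => by fun_prop)
    (.of_forall fun z N N' hN => ENNReal.ofReal_le_ofReal (min_le_min le_rfl (by exact_mod_cast hN)))
    (.of_forall fun z => by
      refine tendsto_const_nhds.congr' ?_
      obtain ⟨N₀, hN₀⟩ := exists_nat_ge (dist z.1 z.2 ^ (-s))
      filter_upwards [eventually_ge_atTop N₀] with N hN
      rw [min_eq_left (hN₀.trans (by exact_mod_cast hN))])
  have hle : ∫⁻ z, ENNReal.ofReal (dist z.1 z.2 ^ (-s)) ∂(pairMeasure n Γ d) ≤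
      ENNReal.ofReal B := by
    refine le_of_tendsto' hlim fun N => ?_
    rw [← ofReal_integral_eq_lintegral_ofReal]
    · exact ENNReal.ofReal_le_ofReal (hB N)
    · refine Integrable.of_bound (C := N)
          (Measurable.aestronglyMeasurable (by fun_prop)) (.of_forall fun z => ?_)
      rw [Real.norm_of_nonneg (by positivity)]
      exact min_le_right _ _
    · exact .of_forall fun z => by simp only [Pi.zero_apply]; positivity
  rw [hasFiniteIntegral_iff_ofReal (.of_forall fun z => by simp only [Pi.zero_apply]; positivity)]
  exact hle.trans_lt ENNReal.ofReal_lt_top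

/-- The energy scales by `ρ_w ^ (2d - s)`, that is, by `ρ_w ^ (-s)` relative to the squared measure;
as `ρ_w ≤ 1`, replacing `s` by `n` only enlarges it and matches the bound for the singular part. -/
theorem exists_energy_bound {s : ℝ} (hs : s ≤ n) : ∃ K : ℝ, 0 ≤ K ∧
    ∀ w : List (Fin M), S.pairInt Γ d (fun x y => dist x y ^ (-s)) w w ≤
      K * (S.wordRatio w ^ n)⁻¹ * S.wt Γ d w ^ 2 := by
  set E₀ := ∫ z, dist z.1 z.2 ^ (-s) ∂(pairMeasure n Γ d) with hE₀
  have hE0 : 0 ≤ E₀ := integral_nonneg fun z => by positivity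
  refine ⟨E₀ / (hausM n d).real Γ ^ 2, by positivity, fun w => ?_⟩
  have hr := S.wordRatio_pos w
  have hr1 : S.wordRatio w ≤ 1 := by
    obtain ⟨r, h0, h1, h2⟩ := S.exists_ratio_bound
    exact (wordRatio_le_pow h0 h2 w).trans (pow_le_one₀ h0.le h1.le)
  have e1 : S.pairInt Γ d (fun x y => dist x y ^ (-s)) w w =
      S.wordRatio w ^ (2 * d) * (S.wordRatio w ^ (-s) * E₀) := by
    rw [hS.pairInt_self_eq, smul_eq_mul]
    simp_rw [S.dist_wordMap, Real.mul_rpow hr.le dist_nonneg]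
    rw [integral_const_mul]
  have e2 : S.wordRatio w ^ (-s) ≤ (S.wordRatio w ^ n)⁻¹ := by
    rw [← Real.rpow_natCast, ← Real.rpow_neg hr.le]
    exact Real.rpow_le_rpow_of_exponent_ge hr hr1 (by linarith)
  have e3 : S.wordRatio w ^ (2 * d) = (S.wordRatio w ^ d) ^ 2 := by
    rw [mul_comm, Real.rpow_mul hr.le]; norm_num
  rw [e1, wt_eq hS.dim_pos.le, e3]
  by_cases h0 : (hausM n d).real Γ = 0
  · have hfin := (hS.attractor.hausM_lt_top hS.dim_pos.le hS.sum_ratio).ne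
    rw [measureReal_eq_zero_iff hfin] at h0
    have : E₀ = 0 := by
      rw [hE₀, pairMeasure, Measure.restrict_eq_zero.2 h0]; simp
    simp [this]
  · calc _ ≤ (S.wordRatio w ^ d) ^ 2 * ((S.wordRatio w ^ n)⁻¹ * E₀) := by gcongr
      _ = _ := by field_simp

end IsHullDisjointAttractor

end IFS

/-! ### Quadrature errors on pairs of components -/

namespace IFS

variable {n M : ℕ} {S : IFS n M} {Γ : Set (Eucl n)} {d : ℝ}

namespace IsHullDisjointAttractor

variable (hS : S.IsHullDisjointAttractor Γ d)
include hS

theorem pairInt_eq_zero {E : Type*} [NormedAddCommGroup E] [NormedSpace ℝ E]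
    (F : Eucl n → Eucl n → E) {w w' : List (Fin M)} (h : S.wt Γ d w * S.wt Γ d w' = 0) :
    S.pairInt Γ d F w w' = 0 := by
  have := hS.isFiniteMeasure_pairMeasure
  rw [← hS.real_pairMeasure_cell, measureReal_eq_zero_iff] at h
  rw [pairInt, Measure.restrict_eq_zero.2 h, integral_zero_measure]

theorem dist_le_of_mem_convexHull {p : List (Fin M)} {h : ℝ}
    (hp : Metric.diam (S.cell Γ p) ≤ h) {a b : Eucl n} (ha : a ∈ convexHull ℝ (S.cell Γ p))
    (hb : b ∈ convexHull ℝ (S.cell Γ p)) : dist a b ≤ h := by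
  refine (Metric.dist_le_diam_of_mem ?_ ha hb).trans ((convexHull_diam _).le.trans hp)
  exact (hS.attractor.isCompact_convexHull_cell p).isBounded

theorem dist_le_diam {p p' : List (Fin M)} {a b : Eucl n} (ha : a ∈ convexHull ℝ (S.cell Γ p))
    (hb : b ∈ convexHull ℝ (S.cell Γ p')) : dist a b ≤ Metric.diam Γ := by
  have h := fun q => hS.attractor.cell_anti (List.nil_prefix (l := q))
  exact hS.dist_le_of_mem_convexHull (p := []) (by simp) (convexHull_mono (h p) ha)
    (convexHull_mono (h p') hb)

/-- The error of the barycentre rule for a radial kernel on a pair of separated components. -/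
theorem exists_norm_pairInt_sub_le {F : Eucl n → Eucl n → ℂ}
    (hFi : Integrable (fun z : Eucl n × Eucl n => F z.1 z.2) (pairMeasure n Γ d))
    {f : ℝ → ℂ} {q : ℝ} (hq : 0 ≤ q) (hf : RadialC2 f q (Metric.diam Γ ^ 2))
    (hF : ∀ x y, x ≠ y → F x y = f (dist x y ^ 2)) :
    ∃ C : ℝ, 0 ≤ C ∧ ∀ (p p' : List (Fin M)) (δ h : ℝ), 0 < δ →
      (∀ a ∈ convexHull ℝ (S.cell Γ p), ∀ b ∈ convexHull ℝ (S.cell Γ p'), δ ≤ dist a b) →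
      Metric.diam (S.cell Γ p) ≤ h → Metric.diam (S.cell Γ p') ≤ h →
      ‖S.pairInt Γ d F p p' -
          (S.wt Γ d p : ℂ) * (S.wt Γ d p' : ℂ) * F (S.bary Γ d p) (S.bary Γ d p')‖ ≤
        C * δ ^ (-q) * h ^ 2 * (S.wt Γ d p * S.wt Γ d p') := by
  obtain ⟨C, hC0, hC⟩ := hf.exists_taylor hq
  -- A difference `x - y` moves by at most `2h` from the difference of the barycentres; squaring
  -- gives the factor four.
  refine ⟨4 * C, by positivity, fun p p' δ h hδ hsep hp hp' => ?_⟩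
  by_cases h0 : S.wt Γ d p * S.wt Γ d p' = 0
  · rw [hS.pairInt_eq_zero F h0, ← Complex.ofReal_mul, h0]; simp
  have hfin := hS.isFiniteMeasure_pairMeasure
  have hfin1 := hS.attractor.isFiniteMeasure_restrict hS.dim_pos.le hS.sum_ratio p
  have hfin2 := hS.attractor.isFiniteMeasure_restrict hS.dim_pos.le hS.sum_ratio p'
  set xb := S.bary Γ d p with hxb
  set yb := S.bary Γ d p' with hyb
  have hxm : xb ∈ convexHull ℝ (S.cell Γ p) :=
    hS.attractor.bary_mem hS.dim_pos.le hS.sum_ratio p (left_ne_zero_of_mul h0)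
  have hym : yb ∈ convexHull ℝ (S.cell Γ p') :=
    hS.attractor.bary_mem hS.dim_pos.le hS.sum_ratio p' (right_ne_zero_of_mul h0)
  -- Passing to differences makes the kernel a function of one variable on a convex set that avoids
  -- the origin.
  let Z : Set (Eucl n) := (fun z : Eucl n × Eucl n => z.1 - z.2) ''
    (convexHull ℝ (S.cell Γ p) ×ˢ convexHull ℝ (S.cell Γ p'))
  have hZ : Convex ℝ Z := ((convex_convexHull ℝ _).prod (convex_convexHull ℝ _)).is_linear_image
    (IsLinearMap.mk (fun a b => by simp; abel) (fun c a => by simp [smul_sub]))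
  have hZd : ∀ z ∈ Z, δ ≤ ‖z‖ ∧ ‖z‖ ≤ Metric.diam Γ := by
    rintro _ ⟨⟨a, b⟩, ⟨ha, hb⟩, rfl⟩
    simp only [← dist_eq_norm]
    exact ⟨hsep a ha b hb, hS.dist_le_diam ha hb⟩
  have hmemZ : ∀ {a b}, a ∈ convexHull ℝ (S.cell Γ p) → b ∈ convexHull ℝ (S.cell Γ p') →
      a - b ∈ Z := fun {a b} ha hb => ⟨(a, b), ⟨ha, hb⟩, rfl⟩
  have hFf : ∀ {a b}, a ∈ convexHull ℝ (S.cell Γ p) → b ∈ convexHull ℝ (S.cell Γ p') →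
      F a b = f (‖a - b‖ ^ 2) := fun {a b} ha hb => by
    rw [hF a b (dist_pos.1 (hδ.trans_le (hsep a ha b hb))), dist_eq_norm]
  obtain ⟨L, hL⟩ := hC Z hZ δ hδ hZd (xb - yb) (hmemZ hxm hym)
  have hi1 : Integrable (fun x : Eucl n => x - xb) ((hausM n d).restrict (S.cell Γ p)) :=
    Continuous.integrable_of_ae_mem_compact (by fun_prop) (hS.attractor.isCompact_cell p)
      (hS.attractor.ae_mem_cell p)
  have hi2 : Integrable (fun x : Eucl n => x - yb) ((hausM n d).restrict (S.cell Γ p')) :=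
    Continuous.integrable_of_ae_mem_compact (by fun_prop) (hS.attractor.isCompact_cell p')
      (hS.attractor.ae_mem_cell p')
  have hi1' := hi1.comp_fst ((hausM n d).restrict (S.cell Γ p'))
  have hi2' := hi2.comp_snd ((hausM n d).restrict (S.cell Γ p))
  have e : ∀ z : Eucl n × Eucl n, z.1 - z.2 - (xb - yb) = (z.1 - xb) - (z.2 - yb) := fun z => by abel
  have key := norm_integral_sub_mul_le
    (ρ := (pairMeasure n Γ d).restrict (S.cell Γ p ×ˢ S.cell Γ p'))
    (X := fun z => z.1 - z.2) (z₀ := xb - yb) (G := fun z => F z.1 z.2)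
    (by
      rw [hS.restrict_pairMeasure]
      simp_rw [e]
      exact hi1'.sub hi2')
    (by
      rw [hS.restrict_pairMeasure]
      simp_rw [e]
      rw [integral_sub hi1' hi2', integral_fun_fst (fun x => x - xb),
        integral_fun_snd (fun x => x - yb)]
      have h1 : ∫ x in S.cell Γ p, (x - xb) ∂(hausM n d) = 0 := integral_sub_average _ _
      have h2 : ∫ x in S.cell Γ p', (x - yb) ∂(hausM n d) = 0 := integral_sub_average _ _
      rw [h1, h2]; simp)
    hFi.integrableOn (F xb yb) L (B := fun _ => C * δ ^ (-q) * (2 * h) ^ 2) (integrable_const _)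
    (by
      filter_upwards [hS.ae_mem_prod_cell p p'] with z hz
      have hz1 := subset_convexHull ℝ _ hz.1
      have hz2 := subset_convexHull ℝ _ hz.2
      rw [hFf hz1 hz2, hFf hxm hym]
      refine (hL _ (hmemZ hz1 hz2)).trans ?_
      gcongr
      rw [e]
      refine (norm_sub_le _ _).trans ?_
      rw [← dist_eq_norm, ← dist_eq_norm, two_mul]
      exact add_le_add (hS.dist_le_of_mem_convexHull hp hz1 hxm)
        (hS.dist_le_of_mem_convexHull hp' hz2 hym))
  rw [integral_const, smul_eq_mul, measureReal_restrict_apply_univ, hS.real_pairMeasure_cell,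
    Complex.ofReal_mul] at key
  exact key.trans_eq (by ring)

theorem quad2_eq_sum {hQ : ℝ} (hQ0 : 0 < hQ) (w w' : List (Fin M)) (F : Eucl n → Eucl n → ℂ) :
    S.quad2 Γ d hQ w w' F = ∑ p ∈ (S.finite_subIndex hS.attractor.2.1 w hQ0).toFinset,
      ∑ p' ∈ (S.finite_subIndex hS.attractor.2.1 w' hQ0).toFinset,
        (S.wt Γ d p : ℂ) * (S.wt Γ d p' : ℂ) * F (S.bary Γ d p) (S.bary Γ d p') := by
  rw [quad2, finsum_mem_eq_finite_toFinset_sum _ (S.finite_subIndex hS.attractor.2.1 w hQ0)]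
  refine Finset.sum_congr rfl fun p _ => ?_
  rw [finsum_mem_eq_finite_toFinset_sum _ (S.finite_subIndex hS.attractor.2.1 w' hQ0)]

/-- The error of the composite rule for a radial kernel on a pair of separated components. -/
theorem exists_norm_pairInt_sub_quad2_le {F : Eucl n → Eucl n → ℂ}
    (hFi : Integrable (fun z : Eucl n × Eucl n => F z.1 z.2) (pairMeasure n Γ d))
    {f : ℝ → ℂ} {q : ℝ} (hq : 0 ≤ q) (hf : RadialC2 f q (Metric.diam Γ ^ 2))
    (hF : ∀ x y, x ≠ y → F x y = f (dist x y ^ 2)) :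
    ∃ C : ℝ, 0 ≤ C ∧ ∀ (w w' : List (Fin M)) (δ hQ : ℝ), 0 < δ → 0 < hQ →
      (∀ a ∈ convexHull ℝ (S.cell Γ w), ∀ b ∈ convexHull ℝ (S.cell Γ w'), δ ≤ dist a b) →
      ‖S.pairInt Γ d F w w' - S.quad2 Γ d hQ w w' F‖ ≤
        C * δ ^ (-q) * hQ ^ 2 * (S.wt Γ d w * S.wt Γ d w') := by
  obtain ⟨C, hC0, hC⟩ := hS.exists_norm_pairInt_sub_le hFi hq hf hF
  refine ⟨C, hC0, fun w w' δ hQ hδ hQ0 hsep => ?_⟩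
  rw [hS.pairInt_eq_sum_subIndex hFi hQ0, hS.quad2_eq_sum hQ0, ← Finset.sum_sub_distrib,
    hS.wt_eq_sum_subIndex hQ0 w, hS.wt_eq_sum_subIndex hQ0 w', Finset.sum_mul_sum, Finset.mul_sum]
  refine (norm_sum_le _ _).trans (Finset.sum_le_sum fun p hp => ?_)
  rw [← Finset.sum_sub_distrib, Finset.mul_sum]
  refine (norm_sum_le _ _).trans (Finset.sum_le_sum fun p' hp' => ?_)
  rw [Set.Finite.mem_toFinset] at hp hp'
  exact hC p p' δ hQ hδ
    (fun a ha b hb => hsep a (convexHull_mono (hS.attractor.cell_anti hp.1) ha) b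
      (convexHull_mono (hS.attractor.cell_anti hp'.1) hb)) hp.2.1 hp'.2.1

/-- The error of the composite rule for a weakly singular kernel on `Γ_w × Γ_w`. -/
theorem exists_norm_pairInt_sub_quad2_self_le {s : ℝ} (hs0 : 0 < s) (hsd : s < d)
    {F : Eucl n → Eucl n → ℂ}
    (hFi : Integrable (fun z : Eucl n × Eucl n => F z.1 z.2) (pairMeasure n Γ d))
    {f : ℝ → ℂ} (hf : RadialC2 f s (Metric.diam Γ ^ 2))
    (hf0 : (fun u => f u - f 0) =O[𝓟 (Ioc 0 (Metric.diam Γ ^ 2))] (fun u => u ^ (1 - s / 2)))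
    (hF : ∀ x y, F x y = f (dist x y ^ 2)) :
    ∃ C : ℝ, 0 ≤ C ∧ ∀ (w : List (Fin M)) (hQ : ℝ), 0 < hQ →
      ‖S.pairInt Γ d F w w - S.quad2 Γ d hQ w w F‖ ≤
        C * hQ ^ 2 * S.pairInt Γ d (fun x y => dist x y ^ (-s)) w w := by
  have hE := hS.integrable_dist_rpow hs0 hsd
  have hfin := hS.isFiniteMeasure_pairMeasure
  obtain ⟨C₁, hC₁, hpair⟩ := hS.exists_norm_pairInt_sub_le hFi hs0.le hf fun x y _ => hF x y
  obtain ⟨C₂, hC₂⟩ := Asymptotics.isBigO_principal.1 hf0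
  obtain ⟨c, hc, hsep⟩ := hS.exists_separation_subIndex
  -- For separated sub-components of diameter at most `hQ`, moving within both hulls changes a
  -- distance by at most `2 hQ`, that is, `2 / c` times the separation. All distances between the
  -- hulls thus agree up to the factor `A`.
  set A := 1 + 2 / c with hA
  have hA0 : 0 < A := by positivity
  set C := max |C₂| (C₁ * A ^ s) with hCdef
  have hC0 : 0 ≤ C := (abs_nonneg _).trans (le_max_left _ _)
  have hEnn : ∀ p p', 0 ≤ S.pairInt Γ d (fun x y => dist x y ^ (-s)) p p' := fun p p' =>
    integral_nonneg fun z => by positivity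
  refine ⟨C, hC0, fun w hQ hQ0 => ?_⟩
  have hterm : ∀ p ∈ S.subIndex Γ w hQ, ∀ p' ∈ S.subIndex Γ w hQ,
      ‖S.pairInt Γ d F p p' -
          (S.wt Γ d p : ℂ) * (S.wt Γ d p' : ℂ) * F (S.bary Γ d p) (S.bary Γ d p')‖ ≤
        C * hQ ^ 2 * S.pairInt Γ d (fun x y => dist x y ^ (-s)) p p' := by
    intro p hp p' hp'
    by_cases hpp : p = p'
    · subst hpp
      -- On a diagonal pair the rule samples `F` at coinciding points, so it integrates the constant
      -- `f 0`; the increment bound then gives `dist ^ (2 - s) ≤ hQ² dist ^ (-s)`.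
      have e : S.pairInt Γ d F p p -
          (S.wt Γ d p : ℂ) * (S.wt Γ d p : ℂ) * F (S.bary Γ d p) (S.bary Γ d p) =
          ∫ z in S.cell Γ p ×ˢ S.cell Γ p, (F z.1 z.2 - f 0) ∂(pairMeasure n Γ d) := by
        rw [integral_sub hFi.integrableOn (integrable_const _), setIntegral_const,
          hS.real_pairMeasure_cell, Complex.real_smul, hF, dist_self, Complex.ofReal_mul, pairInt]
        norm_num
      rw [e, pairInt, ← integral_const_mul]
      refine norm_integral_le_of_norm_le (hE.integrableOn.const_mul _) ?_
      filter_upwards [hS.ae_mem_prod_cell p p] with z hz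
      have hz1 := subset_convexHull ℝ _ hz.1
      have hz2 := subset_convexHull ℝ _ hz.2
      have hdist := hS.dist_le_of_mem_convexHull hp.2.1 hz1 hz2
      rw [hF]
      rcases (dist_nonneg (x := z.1) (y := z.2)).eq_or_lt with h0 | h0
      · rw [← h0]; simp; positivity
      · have h1 := hC₂ (dist z.1 z.2 ^ 2) ⟨by positivity, by
          have := hS.dist_le_diam hz1 hz2
          gcongr⟩
        have h2 : (dist z.1 z.2 ^ 2) ^ (1 - s / 2) = dist z.1 z.2 ^ 2 * dist z.1 z.2 ^ (-s) := by
          rw [← Real.rpow_natCast, ← Real.rpow_mul h0.le, ← Real.rpow_add h0]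
          congr 1; push_cast; ring
        rw [Real.norm_of_nonneg (by positivity), h2] at h1
        calc _ ≤ C₂ * (dist z.1 z.2 ^ 2 * dist z.1 z.2 ^ (-s)) := h1
          _ ≤ C * (hQ ^ 2 * dist z.1 z.2 ^ (-s)) := by
              gcongr
              exact (le_abs_self _).trans (le_max_left _ _)
          _ = _ := by ring
    · set err := ‖S.pairInt Γ d F p p' -
          (S.wt Γ d p : ℂ) * (S.wt Γ d p' : ℂ) * F (S.bary Γ d p) (S.bary Γ d p')‖ with herr
      set W := S.wt Γ d p * S.wt Γ d p' with hW
      have hW0 : 0 ≤ W := mul_nonneg (wt_nonneg _) (wt_nonneg _)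
      rcases hW0.eq_or_lt with h0 | h0
      · have : err = 0 := by
          rw [herr, hS.pairInt_eq_zero F h0.symm, ← Complex.ofReal_mul, ← hW, ← h0]; simp
        rw [this]
        have := hEnn p p'
        positivity
      have hsep' := hsep w p p' hQ hp hp' hpp
      -- The separated estimate holds with any pair `x`, `y` providing the scale `dist x y / A`.
      -- Integrating over all pairs and dividing by `W` turns it into a bound by the energy.
      have hpt : ∀ x ∈ S.cell Γ p, ∀ y ∈ S.cell Γ p',
          err ≤ C * hQ ^ 2 * W * dist x y ^ (-s) := by
        intro x hx y hy
        have hx' := subset_convexHull ℝ _ hx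
        have hy' := subset_convexHull ℝ _ hy
        have hxy : 0 < dist x y := (by positivity : 0 < c * hQ).trans_le (hsep' x hx' y hy')
        have h1 := hpair p p' (dist x y / A) hQ (by positivity)
          (fun a ha b hb => by
            rw [div_le_iff₀ hA0]
            have t1 := hS.dist_le_of_mem_convexHull hp.2.1 hx' ha
            have t2 := hS.dist_le_of_mem_convexHull hp'.2.1 hb hy'
            have t3 := hsep' a ha b hb
            have t4 : dist x y ≤ dist x a + dist a b + dist b y := dist_triangle4 x a b y
            have t5 : 2 * hQ ≤ 2 / c * dist a b := by
              calc 2 * hQ = 2 / c * (c * hQ) := by field_simp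
                _ ≤ _ := by gcongr
            rw [hA]; linarith)
          hp.2.1 hp'.2.1
        have h2 : (dist x y / A) ^ (-s) = A ^ s * dist x y ^ (-s) := by
          rw [Real.div_rpow hxy.le hA0.le, Real.rpow_neg hA0.le, div_inv_eq_mul, mul_comm]
        calc err ≤ C₁ * (dist x y / A) ^ (-s) * hQ ^ 2 * W := h1
          _ = (C₁ * A ^ s) * hQ ^ 2 * W * dist x y ^ (-s) := by rw [h2]; ring
          _ ≤ _ := by gcongr; exact le_max_right _ _
      have h3 : ∫ _ in S.cell Γ p ×ˢ S.cell Γ p', err ∂(pairMeasure n Γ d) ≤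
          ∫ z in S.cell Γ p ×ˢ S.cell Γ p', C * hQ ^ 2 * W * dist z.1 z.2 ^ (-s)
            ∂(pairMeasure n Γ d) := by
        refine integral_mono_ae (integrable_const _) (hE.integrableOn.const_mul _) ?_
        filter_upwards [hS.ae_mem_prod_cell p p'] with z hz using hpt _ hz.1 _ hz.2
      rw [setIntegral_const, hS.real_pairMeasure_cell, integral_const_mul, smul_eq_mul] at h3
      refine le_of_mul_le_mul_left (h3.trans_eq ?_) h0
      rw [pairInt]; ring
  rw [hS.pairInt_eq_sum_subIndex hFi hQ0, hS.quad2_eq_sum hQ0, hS.pairInt_eq_sum_subIndex hE hQ0,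
    ← Finset.sum_sub_distrib, Finset.mul_sum]
  refine (norm_sum_le _ _).trans (Finset.sum_le_sum fun p hp => ?_)
  rw [← Finset.sum_sub_distrib, Finset.mul_sum]
  refine (norm_sum_le _ _).trans (Finset.sum_le_sum fun p' hp' => ?_)
  rw [Set.Finite.mem_toFinset] at hp hp'
  exact hterm p hp p' hp'

/-! ### The singular diagonal terms -/

/-- The part of the double integral over `Γ_w × Γ_w` coming from distinct children of `Γ_w`. -/
theorem pairInt_sub_sum_children {F : Eucl n → Eucl n → ℂ}
    (hFi : Integrable (fun z : Eucl n × Eucl n => F z.1 z.2) (pairMeasure n Γ d))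
    (w : List (Fin M)) : S.pairInt Γ d F w w = ∑ m, S.pairInt Γ d F (w ++ [m]) (w ++ [m]) +
      ∑ m, ∑ m', if m = m' then 0 else S.pairInt Γ d F (w ++ [m]) (w ++ [m']) := by
  rw [hS.pairInt_eq_sum_left hFi, ← Finset.sum_add_distrib]
  refine Finset.sum_congr rfl fun m _ => ?_
  rw [hS.pairInt_eq_sum_right hFi]
  have : ∀ m', S.pairInt Γ d F (w ++ [m]) (w ++ [m']) =
      (if m = m' then S.pairInt Γ d F (w ++ [m]) (w ++ [m']) else 0) +
        if m = m' then 0 else S.pairInt Γ d F (w ++ [m]) (w ++ [m']) := fun m' => by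
    split_ifs <;> simp
  rw [Finset.sum_congr rfl fun m' _ => this m', Finset.sum_add_distrib]
  simp

/-- The kernel is homogeneous of degree `-1` and the product measure of degree `2d`; hence the
denominator with `2d - 1` in the rule. -/
theorem pairInt_singKernel_three (hn : n ≠ 2) (w : List (Fin M)) :
    S.pairInt Γ d (singKernel n) w w =
      ((S.wordRatio w ^ (2 * d - 1) : ℝ) : ℂ) * S.pairInt Γ d (singKernel n) [] [] := by
  have hr := S.wordRatio_pos w
  have e : ∀ x y : Eucl n, singKernel n (S.wordMap w x) (S.wordMap w y) =
      ((S.wordRatio w)⁻¹ : ℝ) * singKernel n x y := fun x y => by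
    rw [singKernel, if_neg hn, singKernel, if_neg hn, S.dist_wordMap, ← Complex.ofReal_mul]
    congr 1
    rw [one_div, one_div, ← mul_inv]; ring
  rw [hS.pairInt_self_eq _ w, hS.pairInt_self_eq _ []]
  simp_rw [e]
  rw [integral_const_mul, Real.rpow_sub_one hr.ne', Complex.real_smul]
  simp only [wordMap, wordRatio_nil, Real.one_rpow, one_smul, id]
  push_cast
  ring

/-- The logarithm turns scaling into an additive constant off the diagonal. On the diagonal this
fails because `Real.log 0 = 0`, so the identity is used almost everywhere. -/
theorem pairInt_singKernel_two (hn : n = 2)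
    (hFi : Integrable (fun z : Eucl n × Eucl n => singKernel n z.1 z.2) (pairMeasure n Γ d))
    (w : List (Fin M)) :
    S.pairInt Γ d (singKernel n) w w = ((S.wordRatio w ^ (2 * d) : ℝ) : ℂ) *
      (S.pairInt Γ d (singKernel n) [] [] -
        ((Real.log (S.wordRatio w) / (2 * Real.pi) * S.wt Γ d [] ^ 2 : ℝ) : ℂ)) := by
  have hr := S.wordRatio_pos w
  have hfin := hS.isFiniteMeasure_pairMeasure
  have e : ∀ z : Eucl n × Eucl n, z.1 ≠ z.2 →
      singKernel n (S.wordMap w z.1) (S.wordMap w z.2) =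
      singKernel n z.1 z.2 - ((Real.log (S.wordRatio w) / (2 * Real.pi) : ℝ) : ℂ) := fun z hz => by
    rw [singKernel, if_pos hn, singKernel, if_pos hn, S.dist_wordMap,
      Real.log_mul hr.ne' (dist_pos.2 hz).ne', ← Complex.ofReal_sub]
    congr 1
    ring
  rw [hS.pairInt_self_eq _ w, integral_congr_ae (hS.ae_ne.mono e),
    integral_sub hFi (integrable_const _), hS.pairInt_self_eq _ [], integral_const]
  have h1 : (pairMeasure n Γ d).real univ = S.wt Γ d [] ^ 2 := by
    have := hS.isFiniteMeasure
    rw [sq, wt, cell_nil, measureReal_def, measureReal_def, pairMeasure, ← univ_prod_univ,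
      Measure.prod_prod, Measure.restrict_apply_univ, ENNReal.toReal_mul]
  rw [h1]
  simp only [wordMap, wordRatio_nil, Real.one_rpow, one_smul, id, Complex.real_smul]
  push_cast
  ring

/-- The error of the singularity subtraction rule is controlled by the error of the composite rule
for the interaction of distinct children. -/
theorem exists_norm_pairInt_sub_quadSing_le (hn : n = 2 ∨ n = 3) (hnd : (n : ℝ) - 2 < d)
    (hFi : Integrable (fun z : Eucl n × Eucl n => singKernel n z.1 z.2) (pairMeasure n Γ d)) :
    ∃ κ : ℝ, 0 ≤ κ ∧ ∀ (w : List (Fin M)) (hQ : ℝ),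
      ‖S.pairInt Γ d (singKernel n) w w - S.quadSing Γ d hQ w‖ ≤
        κ * ‖(∑ m, ∑ m', if m = m' then 0
            else S.pairInt Γ d (singKernel n) (w ++ [m]) (w ++ [m'])) -
          ∑ m, ∑ m', if m = m' then 0
            else S.quad2 Γ d hQ (w ++ [m]) (w ++ [m']) (singKernel n)‖ := by
  rcases hn with h2 | h3
  · have hθ := hS.sum_ratio_rpow_lt_one (t := 2 * d) (by linarith [hS.dim_pos])
    set θ := ∑ m, S.ratio m ^ (2 * d) with hθdef
    have h0 : ((1 - θ : ℝ) : ℂ) ≠ 0 := by exact_mod_cast (sub_pos.2 hθ).ne'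
    refine ⟨(1 - θ)⁻¹, inv_nonneg.2 (sub_pos.2 hθ).le, fun w hQ => ?_⟩
    have hsplit := hS.pairInt_sub_sum_children hFi w
    rw [quadSing]
    simp only [if_pos h2]
    set I := S.pairInt Γ d (singKernel n) w w with hI
    set R := ∑ m, ∑ m', if m = m' then 0
            else S.pairInt Γ d (singKernel n) (w ++ [m]) (w ++ [m'])
    set RQ := ∑ m, ∑ m', if m = m' then 0
            else S.quad2 Γ d hQ (w ++ [m]) (w ++ [m']) (singKernel n)
    have hr := S.wordRatio_pos w
    have hch : ∀ m, S.pairInt Γ d (singKernel n) (w ++ [m]) (w ++ [m]) =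
        ((S.ratio m ^ (2 * d) : ℝ) : ℂ) * I - ((S.wt Γ d w ^ 2 *
          (S.ratio m ^ (2 * d) * Real.log (S.ratio m)) / (2 * Real.pi) : ℝ) : ℂ) := fun m => by
      have hm := S.ratio_pos m
      have hw : S.wt Γ d w ^ 2 = S.wordRatio w ^ (2 * d) * S.wt Γ d [] ^ 2 := by
        rw [wt_eq hS.dim_pos.le, wt_eq hS.dim_pos.le, wordRatio_nil, Real.one_rpow, one_mul,
          mul_pow, mul_comm 2 d, Real.rpow_mul hr.le]
        norm_num
      rw [hI, hS.pairInt_singKernel_two h2 hFi w, hS.pairInt_singKernel_two h2 hFi (w ++ [m]), hw,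
        wordRatio_append, wordRatio_singleton, Real.mul_rpow hr.le hm.le,
        Real.log_mul hr.ne' hm.ne']
      push_cast
      ring
    simp_rw [hch] at hsplit
    rw [Finset.sum_sub_distrib, ← Finset.sum_mul, ← Complex.ofReal_sum, ← Complex.ofReal_sum,
      ← Finset.sum_div, ← Finset.mul_sum, ← hθdef] at hsplit
    -- By scaling of the children, `(1 - θ) I = R -` the same logarithmic constant as in the rule;
    -- subtraction leaves only `R - RQ`.
    have e : I - (RQ - ((S.wt Γ d w ^ 2 * (∑ m, S.ratio m ^ (2 * d) * Real.log (S.ratio m)) /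
        (2 * Real.pi) : ℝ) : ℂ)) / ((1 - θ : ℝ) : ℂ) = ((1 - θ : ℝ) : ℂ)⁻¹ * (R - RQ) := by
      field_simp
      rw [Complex.ofReal_sub, Complex.ofReal_one]
      linear_combination hsplit
    rw [e, norm_mul, norm_inv, Complex.norm_real, Real.norm_of_nonneg (sub_pos.2 hθ).le]
  · have h2 : n ≠ 2 := by omega
    have hd1 : 1 < d := by rw [h3] at hnd; norm_num at hnd; linarith
    -- Here `d > 1` is what makes `2d - 1 > d`, so that the equation for `I` can be solved.
    have hθ := hS.sum_ratio_rpow_lt_one (t := 2 * d - 1) (by linarith)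
    set θ := ∑ m, S.ratio m ^ (2 * d - 1) with hθdef
    have h0 : ((1 - θ : ℝ) : ℂ) ≠ 0 := by exact_mod_cast (sub_pos.2 hθ).ne'
    refine ⟨(1 - θ)⁻¹, inv_nonneg.2 (sub_pos.2 hθ).le, fun w hQ => ?_⟩
    have hsplit := hS.pairInt_sub_sum_children hFi w
    rw [quadSing]
    simp only [if_neg h2]
    set I := S.pairInt Γ d (singKernel n) w w with hI
    set R := ∑ m, ∑ m', if m = m' then 0
            else S.pairInt Γ d (singKernel n) (w ++ [m]) (w ++ [m'])
    set RQ := ∑ m, ∑ m', if m = m' then 0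
            else S.quad2 Γ d hQ (w ++ [m]) (w ++ [m']) (singKernel n)
    have hch : ∀ m, S.pairInt Γ d (singKernel n) (w ++ [m]) (w ++ [m]) =
        ((S.ratio m ^ (2 * d - 1) : ℝ) : ℂ) * I := fun m => by
      rw [hI, hS.pairInt_singKernel_three h2 w, hS.pairInt_singKernel_three h2 (w ++ [m]),
        wordRatio_append, wordRatio_singleton,
        Real.mul_rpow (S.wordRatio_pos w).le (S.ratio_pos m).le]
      push_cast
      ring
    simp_rw [hch] at hsplit
    rw [← Finset.sum_mul, ← Complex.ofReal_sum, ← hθdef] at hsplit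
    have e : I - RQ / ((1 - θ : ℝ) : ℂ) = ((1 - θ : ℝ) : ℂ)⁻¹ * (R - RQ) := by
      field_simp
      rw [Complex.ofReal_sub, Complex.ofReal_one]
      linear_combination hsplit
    rw [e, norm_mul, norm_inv, Complex.norm_real, Real.norm_of_nonneg (sub_pos.2 hθ).le]

end IsHullDisjointAttractor

end IFS

/-! ### Assembly of the Galerkin matrix error -/

/-- The entries are dominated by those of `a` times the rank one matrix of the vector `√t`, whose
squared norm is `∑ t`; Cauchy–Schwarz in each row suffices. -/
theorem Matrix.norm_toEuclideanCLM_le_of_norm_le {N : ℕ} {B : Matrix (Fin N) (Fin N) ℂ} {a : ℝ}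
    {t : Fin N → ℝ} (ha : 0 ≤ a) (ht : ∀ i, 0 ≤ t i) (hB : ∀ i j, ‖B i j‖ ≤ a * (√(t i) * √(t j))) :
    ‖Matrix.toEuclideanCLM (𝕜 := ℂ) B‖ ≤ a * ∑ i, t i := by
  have hT : 0 ≤ ∑ i, t i := Finset.sum_nonneg fun i _ => ht i
  refine ContinuousLinearMap.opNorm_le_bound _ (by positivity) fun x => ?_
  have hrow : ∀ i, ‖Matrix.toEuclideanCLM (𝕜 := ℂ) B x i‖ ≤
      a * √(t i) * (√(∑ j, t j) * ‖x‖) := by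
    intro i
    have e : Matrix.toEuclideanCLM (𝕜 := ℂ) B x i = ∑ j, B i j * x j := by
      rw [Matrix.ofLp_toEuclideanCLM]; rfl
    rw [e]
    calc ‖∑ j, B i j * x j‖ ≤ ∑ j, a * √(t i) * (√(t j) * ‖x j‖) := by
          refine (norm_sum_le _ _).trans (Finset.sum_le_sum fun j _ => ?_)
          rw [norm_mul]
          calc _ ≤ a * (√(t i) * √(t j)) * ‖x j‖ := by gcongr; exact hB i j
            _ = _ := by ring
      _ = a * √(t i) * ∑ j, √(t j) * ‖x j‖ := by rw [Finset.mul_sum]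
      _ ≤ _ := by
          gcongr
          have := Real.sum_mul_le_sqrt_mul_sqrt Finset.univ (fun j => √(t j)) fun j => ‖x j‖
          simpa [Real.sq_sqrt, ht, EuclideanSpace.norm_eq] using this
  rw [EuclideanSpace.norm_eq]
  refine Real.sqrt_le_iff.2 ⟨by positivity, ?_⟩
  calc _ ≤ ∑ i, (a * √(t i) * (√(∑ j, t j) * ‖x‖)) ^ 2 := by
        gcongr with i; exact hrow i
    _ = ∑ i, t i * (a ^ 2 * (∑ j, t j) * ‖x‖ ^ 2) := by
        refine Finset.sum_congr rfl fun i _ => ?_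
        rw [mul_pow, mul_pow, mul_pow, Real.sq_sqrt (ht i), Real.sq_sqrt hT]; ring
    _ = _ := by rw [← Finset.sum_mul]; ring

namespace IFS

variable {n M : ℕ} {S : IFS n M} {Γ : Set (Eucl n)} {d : ℝ}

/-- Mesh elements are not much smaller than `h`, because their parents exceed `h`; for the root this
is replaced by `h ≤ diam Γ`. -/
theorem le_wordRatio_of_mem_meshIndex {ρ : ℝ}
    (hρ : ∀ m, ρ ≤ S.ratio m) {h : ℝ} (hh : 0 < h) (hhD : h ≤ Metric.diam Γ)
    {w : List (Fin M)} (hw : w ∈ S.meshIndex Γ h) : ρ * h ≤ S.wordRatio w * Metric.diam Γ := by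
  have hρ1 : ρ ≤ 1 := by
    have hM := S.two_le
    exact (hρ ⟨0, by omega⟩).trans (S.ratio_lt_one _).le
  rcases hw.2.2 with rfl | h1
  · rw [wordRatio_nil]
    exact mul_le_mul hρ1 hhD hh.le zero_le_one
  · rcases List.eq_nil_or_concat w with rfl | ⟨q, m, rfl⟩
    · simp only [List.dropLast_nil, cell_nil] at h1
      rw [wordRatio_nil]
      exact mul_le_mul hρ1 hhD hh.le zero_le_one
    · rw [List.concat_eq_append] at h1 ⊢
      rw [List.dropLast_concat, diam_cell] at h1
      rw [wordRatio_append, wordRatio_singleton]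
      have := S.wordRatio_pos q
      calc ρ * h ≤ S.ratio m * (S.wordRatio q * Metric.diam Γ) :=
            mul_le_mul (hρ m) h1.le hh.le (S.ratio_pos m).le
        _ = _ := by ring

namespace IsHullDisjointAttractor

variable (hS : S.IsHullDisjointAttractor Γ d)
include hS

theorem integrable_of_isBigO {s : ℝ} (hs0 : 0 < s) (hsd : s < d) {f : ℝ → ℂ} (hf : Measurable f)
    (hO : f =O[𝓟 (Ioc 0 (Metric.diam Γ ^ 2))] (fun u => u ^ (-s / 2))) :
    Integrable (fun z : Eucl n × Eucl n => f (dist z.1 z.2 ^ 2)) (pairMeasure n Γ d) := by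
  obtain ⟨C, hC⟩ := Asymptotics.isBigO_principal.1 hO
  refine ((hS.integrable_dist_rpow hs0 hsd).const_mul C).mono'
    (hf.comp (by fun_prop)).aestronglyMeasurable ?_
  filter_upwards [hS.ae_mem_prod, hS.ae_ne] with z hz hne
  have h0 : 0 < dist z.1 z.2 := dist_pos.2 hne
  have h1 := Metric.dist_le_diam_of_mem hS.attractor.2.1.isBounded hz.1 hz.2
  have h2 := hC (dist z.1 z.2 ^ 2) ⟨by positivity, by gcongr⟩
  have h3 : (dist z.1 z.2 ^ 2) ^ (-s / 2) = dist z.1 z.2 ^ (-s) := by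
    rw [← Real.rpow_natCast, ← Real.rpow_mul h0.le]; congr 1; push_cast; ring
  rwa [Real.norm_of_nonneg (by positivity), h3] at h2

/-- The exact double integrals and their quadrature approximations differ, uniformly over the
mesh, by `O(hQ² h⁻ⁿ)` relative to the product of the measures of the elements. -/
theorem exists_entry_bound (hn : n = 2 ∨ n = 3) {k : ℝ} (hk : 0 < k) (hdn : (n : ℝ) - 2 < d) :
    ∃ C : ℝ, 0 ≤ C ∧ ∀ (h hQ : ℝ), 0 < hQ → hQ ≤ h → h ≤ Metric.diam Γ →
      ∀ w ∈ S.meshIndex Γ h, ∀ w' ∈ S.meshIndex Γ h,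
        ‖(∫ x in S.cell Γ w, ∫ y in S.cell Γ w', helmholtzKernel n k x y
            ∂(hausM n d) ∂(hausM n d)) -
          (if w = w' then S.quadSing Γ d hQ w + S.quad2 Γ d hQ w w (regKernel n k)
            else S.quad2 Γ d hQ w w' (helmholtzKernel n k))‖ ≤
          C * hQ ^ 2 * (h ^ n)⁻¹ * (S.wt Γ d w * S.wt Γ d w') := by
  have hD := hS.diam_pos
  have hn1 : (1 : ℝ) ≤ n := by exact_mod_cast (by omega : 1 ≤ n)
  obtain ⟨s, fs, fr, hs0, hs1, hsd, hsplit⟩ :=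
    exists_isRadialSplitting hn hk hdn (Metric.diam Γ ^ 2)
  have hfin := hS.isFiniteMeasure_pairMeasure
  have hsn : s ≤ n := hs1.trans hn1
  have hhelm : ∀ x y : Eucl n, x ≠ y →
      helmholtzKernel n k x y = singKernel n x y + regKernel n k x y := fun x y hxy => by
    rw [regKernel, if_neg hxy]; ring
  have hsi : Integrable (fun z : Eucl n × Eucl n => singKernel n z.1 z.2) (pairMeasure n Γ d) := by
    simp_rw [hsplit.sing_eq]
    exact hS.integrable_of_isBigO hs0 hsd hsplit.measurable_sing hsplit.sing_isBigO
  have hri : Integrable (fun z : Eucl n × Eucl n => regKernel n k z.1 z.2)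
      (pairMeasure n Γ d) := by
    have h1 := hS.integrable_of_isBigO hs0 hsd (hsplit.measurable_reg.sub_const (fr 0))
      (hsplit.reg_isBigO.trans (isBigO_rpow_rpow (by linarith)))
    refine (h1.add (integrable_const (fr 0))).congr (.of_forall fun z => ?_)
    simp [hsplit.reg_eq]
  have hae : (fun z : Eucl n × Eucl n => singKernel n z.1 z.2 + regKernel n k z.1 z.2)
      =ᵐ[pairMeasure n Γ d] fun z => helmholtzKernel n k z.1 z.2 :=
    hS.ae_ne.mono fun z hz => (hhelm z.1 z.2 hz).symm
  have hhi : Integrable (fun z : Eucl n × Eucl n => helmholtzKernel n k z.1 z.2)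
      (pairMeasure n Γ d) := (hsi.add hri).congr hae
  -- Off the diagonal the kernel need not be split in the rule: its growth is that of the singular
  -- part, with exponent `n ≥ s`.
  obtain ⟨C₁, hC₁, hoff⟩ := hS.exists_norm_pairInt_sub_quad2_le hhi (Nat.cast_nonneg n)
    (hsplit.radialC2_sing.add (hsplit.radialC2_reg.mono hsn)) fun x y hxy => by
      rw [hhelm x y hxy, hsplit.sing_eq, hsplit.reg_eq]
  obtain ⟨C₂, hC₂, hsing⟩ := hS.exists_norm_pairInt_sub_quad2_le hsi (Nat.cast_nonneg n)
    hsplit.radialC2_sing fun x y _ => hsplit.sing_eq x y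
  obtain ⟨C₃, hC₃, hreg⟩ := hS.exists_norm_pairInt_sub_quad2_self_le hs0 hsd hri
    hsplit.radialC2_reg hsplit.reg_isBigO hsplit.reg_eq
  obtain ⟨κ, hκ, hqs⟩ := hS.exists_norm_pairInt_sub_quadSing_le hn hdn hsi
  obtain ⟨K, hK, hen⟩ := hS.exists_energy_bound hsn
  obtain ⟨c, hc, hsep⟩ := hS.exists_separation
  obtain ⟨c', hc', hsep'⟩ := hS.exists_separation_subIndex
  obtain ⟨ρ, hρ, hρm⟩ := S.exists_lt_ratio
  have hpow : ∀ t : ℝ, 0 < t → t ^ (-(n : ℝ)) = (t ^ n)⁻¹ := fun t ht => by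
    rw [Real.rpow_neg ht.le, Real.rpow_natCast]
  -- The singular and regular contributions, both of order `ρ_w ^ (-n)`, with the last factor
  -- converting the ratio of a mesh element into `h`.
  set Cd := (κ * C₂ * (c ^ n)⁻¹ + C₃ * K) * ((ρ / Metric.diam Γ) ^ n)⁻¹ with hCd
  have hCd0 : 0 ≤ Cd := by positivity
  refine ⟨max (C₁ * (c' ^ n)⁻¹) Cd, le_max_of_le_right hCd0, ?_⟩
  intro h hQ hQ0 hQh hhD w hw w' hw'
  have hh := hQ0.trans_le hQh
  have hW : 0 ≤ S.wt Γ d w * S.wt Γ d w' := mul_nonneg (wt_nonneg _) (wt_nonneg _)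
  rw [hS.pairInt_eq_setIntegral hhi]
  by_cases hww : w = w'
  · subst hww
    rw [if_pos rfl]
    have hr := S.wordRatio_pos w
    have hsum : S.pairInt Γ d (helmholtzKernel n k) w w =
        S.pairInt Γ d (singKernel n) w w + S.pairInt Γ d (regKernel n k) w w := by
      rw [pairInt, pairInt, pairInt, ← integral_add hsi.integrableOn hri.integrableOn]
      exact integral_congr_ae (ae_restrict_of_ae (hae.mono fun z hz => hz.symm))
    have hR : ‖(∑ m, ∑ m', if m = m' then 0
            else S.pairInt Γ d (singKernel n) (w ++ [m]) (w ++ [m'])) -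
          ∑ m, ∑ m', if m = m' then 0
            else S.quad2 Γ d hQ (w ++ [m]) (w ++ [m']) (singKernel n)‖ ≤
        C₂ * ((c * S.wordRatio w) ^ n)⁻¹ * hQ ^ 2 * (S.wt Γ d w * S.wt Γ d w) := by
      rw [wt_eq_sum hS.dim_pos.le hS.sum_ratio w, Finset.sum_mul_sum, Finset.mul_sum,
        ← Finset.sum_sub_distrib]
      refine (norm_sum_le _ _).trans (Finset.sum_le_sum fun m _ => ?_)
      rw [Finset.mul_sum, ← Finset.sum_sub_distrib]
      refine (norm_sum_le _ _).trans (Finset.sum_le_sum fun m' _ => ?_)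
      by_cases hm : m = m'
      · have := mul_nonneg (S.wt_nonneg (Γ := Γ) (d := d) (w ++ [m]))
          (S.wt_nonneg (Γ := Γ) (d := d) (w ++ [m']))
        rw [if_pos hm, if_pos hm, sub_zero, norm_zero]
        positivity
      · rw [if_neg hm, if_neg hm, ← hpow _ (by positivity)]
        exact hsing _ _ _ hQ (by positivity) hQ0 (hsep w m m' hm)
    have hwr : (S.wordRatio w ^ n)⁻¹ ≤ ((ρ / Metric.diam Γ) ^ n)⁻¹ * (h ^ n)⁻¹ := by
      rw [← mul_inv, ← mul_pow]
      have : ρ / Metric.diam Γ * h ≤ S.wordRatio w := by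
        rw [div_mul_eq_mul_div, div_le_iff₀ hD]
        exact le_wordRatio_of_mem_meshIndex hρm hh hhD hw
      gcongr
    rw [hsum, add_sub_add_comm]
    refine (norm_add_le _ _).trans ?_
    calc _ ≤ κ * (C₂ * ((c * S.wordRatio w) ^ n)⁻¹ * hQ ^ 2 * (S.wt Γ d w * S.wt Γ d w)) +
          C₃ * hQ ^ 2 * (K * (S.wordRatio w ^ n)⁻¹ * S.wt Γ d w ^ 2) := by
          refine add_le_add ((hqs w hQ).trans ?_) ((hreg w hQ hQ0).trans ?_)
          · gcongr
          · gcongr; exact hen w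
      _ = (κ * C₂ * (c ^ n)⁻¹ + C₃ * K) * hQ ^ 2 * (S.wordRatio w ^ n)⁻¹ *
          (S.wt Γ d w * S.wt Γ d w) := by rw [mul_pow, mul_inv]; ring
      _ ≤ (κ * C₂ * (c ^ n)⁻¹ + C₃ * K) * hQ ^ 2 *
          (((ρ / Metric.diam Γ) ^ n)⁻¹ * (h ^ n)⁻¹) * (S.wt Γ d w * S.wt Γ d w) := by gcongr
      _ = Cd * hQ ^ 2 * (h ^ n)⁻¹ * (S.wt Γ d w * S.wt Γ d w) := by rw [hCd]; ring
      _ ≤ _ := by gcongr; exact le_max_right _ _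
  · rw [if_neg hww]
    have h1 := hoff w w' (c' * h) hQ (by positivity) hQ0 (hsep' [] w w' h hw hw' hww)
    rw [hpow _ (by positivity), mul_pow, mul_inv] at h1
    calc _ ≤ C₁ * ((c' ^ n)⁻¹ * (h ^ n)⁻¹) * hQ ^ 2 * (S.wt Γ d w * S.wt Γ d w') := h1
      _ = C₁ * (c' ^ n)⁻¹ * hQ ^ 2 * (h ^ n)⁻¹ * (S.wt Γ d w * S.wt Γ d w') := by ring
      _ ≤ _ := by gcongr; exact le_max_left _ _

/-- The quadrature error in the Galerkin matrix is `O(hQ² h⁻ⁿ)` for hull-disjoint attractors. -/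
theorem exists_galMat_bound (hn : n = 2 ∨ n = 3) {k : ℝ} (hk : 0 < k) (hdn : (n : ℝ) - 2 < d) :
    ∃ C : ℝ, 0 < C ∧ ∀ (h hQ : ℝ), 0 < hQ → hQ ≤ h → h ≤ Metric.diam Γ →
      ∀ (N : ℕ) (idx : Fin N → List (Fin M)), S.IsMesh Γ h idx →
        ‖Matrix.toEuclideanCLM (𝕜 := ℂ) (S.galMat Γ d k idx - S.galMatQ Γ d k hQ idx)‖ ≤
          C * hQ ^ 2 * (h ^ n)⁻¹ * (hausM n d).real Γ := by
  obtain ⟨C, hC, hent⟩ := hS.exists_entry_bound hn hk hdn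
  -- The entry constant may be zero; adding one makes it positive.
  refine ⟨C + 1, by positivity, fun h hQ hQ0 hQh hhD N idx hidx => ?_⟩
  have hh := hQ0.trans_le hQh
  rw [← hidx.sum_wt hS.attractor hS.dim_pos.le hS.sum_ratio hh]
  refine Matrix.norm_toEuclideanCLM_le_of_norm_le (by positivity) (fun i => wt_nonneg _) ?_
  intro i j
  have hmem : ∀ i, idx i ∈ S.meshIndex Γ h := fun i => hidx.2 ▸ mem_range_self i
  have h1 := hent h hQ hQ0 hQh hhD (idx i) (hmem i) (idx j) (hmem j)
  have hwi := S.wt_nonneg (Γ := Γ) (d := d) (idx i)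
  have hwj := S.wt_nonneg (Γ := Γ) (d := d) (idx j)
  have e : (S.galMat Γ d k idx - S.galMatQ Γ d k hQ idx) i j =
      (((√(S.wt Γ d (idx i)))⁻¹ * (√(S.wt Γ d (idx j)))⁻¹ : ℝ) : ℂ) *
        ((∫ x in S.cell Γ (idx i), ∫ y in S.cell Γ (idx j), helmholtzKernel n k x y
            ∂(hausM n d) ∂(hausM n d)) -
          (if idx i = idx j then S.quadSing Γ d hQ (idx i) +
              S.quad2 Γ d hQ (idx i) (idx i) (regKernel n k)
            else S.quad2 Γ d hQ (idx i) (idx j) (helmholtzKernel n k))) := by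
    simp only [Matrix.sub_apply, galMat, galMatQ, Matrix.of_apply, hidx.1.eq_iff]
    push_cast
    ring
  rw [e, norm_mul, Complex.norm_real, Real.norm_of_nonneg (by positivity)]
  have hsq : ∀ t : ℝ, (√t)⁻¹ * t = √t := fun t => by
    rw [mul_comm, ← div_eq_mul_inv, Real.div_sqrt]
  calc _ ≤ (√(S.wt Γ d (idx i)))⁻¹ * (√(S.wt Γ d (idx j)))⁻¹ *
        (C * hQ ^ 2 * (h ^ n)⁻¹ * (S.wt Γ d (idx i) * S.wt Γ d (idx j))) := by gcongr
    _ = C * hQ ^ 2 * (h ^ n)⁻¹ * (((√(S.wt Γ d (idx i)))⁻¹ * S.wt Γ d (idx i)) *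
        ((√(S.wt Γ d (idx j)))⁻¹ * S.wt Γ d (idx j))) := by ring
    _ = C * hQ ^ 2 * (h ^ n)⁻¹ * (√(S.wt Γ d (idx i)) * √(S.wt Γ d (idx j))) := by
        rw [hsq, hsq]
    _ ≤ _ := by gcongr; linarith

end IsHullDisjointAttractor

end IFS

end

/-! ### The three estimates -/

theorem theorem4p6 {n M : ℕ} (hn : n = 2 ∨ n = 3) (k : ℝ) (hk : 0 < k)
    (S : IFS n M) (hS : S.OSC) (Γ : Set (Eucl n)) (hΓ : S.IsAttractor Γ)
    (d : ℝ) (hd : ∑ m, S.ratio m ^ d = 1) (hdn : (n : ℝ) - 2 < d) :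
    (∀ (u : Eucl n → ℂ) (U : Set (Eucl n)), IsOpen U → convexHull ℝ Γ ⊆ U →
      ContDiffOn ℝ ∞ u U → (∀ x ∈ U, Laplacian.laplacian u x + (k : ℂ) ^ 2 * u x = 0) →
      ∀ (h hQ : ℝ), 0 < hQ → hQ ≤ h → h ≤ Metric.diam Γ →
      ∀ (N : ℕ) (idx : Fin N → List (Fin M)), S.IsMesh Γ h idx →
        ‖WithLp.toLp 2 (S.rhs Γ d idx u - S.rhsQ Γ d hQ idx u)‖ ≤
          hQ ^ 2 * seminorm2 u (convexHull ℝ Γ) * √((hausM n d).real Γ)) ∧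
    (∀ (v : Eucl n → ℂ) (U : Set (Eucl n)), IsOpen U → convexHull ℝ Γ ⊆ U →
      ContDiffOn ℝ ∞ v U →
      ∀ (σ : Eucl n → ℂ) (w : 𝓢(Eucl n, ℂ)), IsCutoff Γ σ → (∀ x, w x = σ x * v x) →
      ∀ (h hQ : ℝ), 0 < hQ → hQ ≤ h → h ≤ Metric.diam Γ →
      ∀ (N : ℕ) (idx : Fin N → List (Fin M)), S.IsMesh Γ h idx →
      ∀ (ψ : Hneg1 n) (c : Fin N → ℂ),
        IsTraceAdjoint Γ d (fun x => ∑ j, c j * S.chi Γ d (idx j) x) ψ →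
        ‖functionalJ Γ (H1.ofSchwartz w) ψ - ∑ j, c j * S.momentQ Γ d hQ idx v j‖ ≤
          hQ ^ 2 * seminorm2 v (convexHull ℝ Γ) * ‖WithLp.toLp 2 c‖ * √((hausM n d).real Γ)) ∧
    (S.HullDisjoint Γ →
      (∃ C : ℝ, 0 < C ∧ ∀ (h hQ : ℝ), 0 < hQ → hQ ≤ h → h ≤ Metric.diam Γ →
        ∀ (N : ℕ) (idx : Fin N → List (Fin M)), S.IsMesh Γ h idx →
          ‖Matrix.toEuclideanCLM (𝕜 := ℂ) (S.galMat Γ d k idx - S.galMatQ Γ d k hQ idx)‖ ≤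
            C * hQ * (h ^ (n - 1))⁻¹ * (hausM n d).real Γ) ∧
      (S.Homogeneous →
        ∃ C : ℝ, 0 < C ∧ ∀ (h hQ : ℝ), 0 < hQ → hQ ≤ h → h ≤ Metric.diam Γ →
        ∀ (N : ℕ) (idx : Fin N → List (Fin M)), S.IsMesh Γ h idx →
          ‖Matrix.toEuclideanCLM (𝕜 := ℂ) (S.galMat Γ d k idx - S.galMatQ Γ d k hQ idx)‖ ≤
            C * hQ ^ 2 * (h ^ n)⁻¹ * (hausM n d).real Γ)) := by
  have hd0 : 0 < d := by
    have : (2 : ℝ) ≤ n := by exact_mod_cast (by omega : 2 ≤ n)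
    linarith
  have hn4 : n ≤ 4 := by omega
  refine ⟨?_, ?_, ?_⟩
  · intro u U hU hΓU hu _ h hQ hQ0 hQh _ N idx hidx
    exact IFS.norm_rhs_sub_rhsQ_le hn4 hΓ hd0.le hd hU hΓU hu hQ0 hQh hidx
  · intro v U hU hΓU hv σ w hσ hw h hQ hQ0 hQh _ N idx hidx ψ c hψ
    exact IFS.norm_functionalJ_sub_le hn4 hΓ hd0.le hd hU hΓU hv hσ hw hQ0 hQh hidx hψ
  · intro hdis
    have hS' : S.IsHullDisjointAttractor Γ d := ⟨hΓ, hd0, hd, hdis⟩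
    obtain ⟨C, hC, hbound⟩ := hS'.exists_galMat_bound hn hk hdn
    refine ⟨⟨C, hC, fun h hQ hQ0 hQh hhD N idx hidx => ?_⟩, fun _ => ⟨C, hC, hbound⟩⟩
    refine (hbound h hQ hQ0 hQh hhD N idx hidx).trans ?_
    have hh := hQ0.trans_le hQh
    have e : (h ^ n)⁻¹ = (h ^ (n - 1))⁻¹ * h⁻¹ := by
      rw [← mul_inv, ← pow_succ, Nat.sub_add_cancel (by omega)]
    -- Since `hQ ≤ h`, one factor `hQ / h` can be dropped, which turns the order `hQ² h ^ (-n)` into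
    -- `hQ h ^ (-(n - 1))`.
    have h1 : hQ ^ 2 * h⁻¹ ≤ hQ := by
      rw [← div_eq_mul_inv, div_le_iff₀ hh, sq]
      gcongr
    calc C * hQ ^ 2 * (h ^ n)⁻¹ * (hausM n d).real Γ
        = C * (hQ ^ 2 * h⁻¹) * (h ^ (n - 1))⁻¹ * (hausM n d).real Γ := by rw [e]; ring
      _ ≤ C * hQ * (h ^ (n - 1))⁻¹ * (hausM n d).real Γ := by gcongr
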